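/- \textbf{Local Frobenius Theorem.} Let $M=(|M|,\mathcal O_M)$ be a $C^\infty$-supermanifold of dimension $p|q$, i.e. a topological space with a sheaf of supercommutative $\mathbb R$-superalgebras with local stalks, in which every point has an open neighbourhood $V$ with $(V,\mathcal O_M|_V)$ isomorphic to a superdomain $(U,\,C^\infty_U[\theta^1,\dots,\theta^q])$, $U\subseteq\mathbb R^p$ open, the $\theta^j$ being odd (anticommuting); such an isomorphism is called a system of local coordinates $(t,\theta)=(t^1,\dots,t^p,\theta^1,\dots,\theta^q)$ on $V$. Let $\mathrm{Vec}_M$ be the tangent sheaf, whose sections over an open set are the vector fields there, i.e. the families of $\mathbb R$-linear superderivations of $\mathcal O_M$ compatible with restriction (sums of even and odd ones). Let $\mathcal D$ be a distribution on $M$, i.e. a ($\mathbb Z/2$-graded) $\mathcal O_M$-submodule sheaf of $\mathrm{Vec}_M$ which is locally a direct factor. Assume that $\mathcal D$ is integrable (involutive), i.e. for all homogeneous sections $X,Y$ of $\mathcal D$ over an open set, $[X,Y]=XY-(-1)^{|X||Y|}YX$ is a section of $\mathcal D$; and that $\mathcal D$ has rank $r|s$, i.e. for every $x\in|M|$ the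 subspace $\mathcal D_x\subseteq T_xM$ of the values at $x$ of the sections of $\mathcal D$ near $x$ has superdimension $r|s$. Then $r\le p$, $s\le q$ whenever $|M|\neq\emptyset$, and every point $x\in|M|$ has an open neighbourhood $V$ with local coordinates $(t^1,\dots,t^p,\theta^1,\dots,\theta^q)$ on $V$ in which $\mathcal D|_V$ is spanned over $\mathcal O_M|_V$ by $$\frac{\partial}{\partial t^1},\dots,\frac{\partial}{\partial t^r},\ \frac{\partial}{\partial\theta^1},\dots,\frac{\partial}{\partial\theta^s};$$ that is, for every open $W\subseteq V$, $\mathcal D(W)$ consists exactly of the vector fields $\sum_{i=1}^r a_i\,\partial/\partial t^i+\sum_{j=1}^s b_j\,\partial/\partial\theta^j$ with $a_i,b_j\in\mathcal O_M(W)$. -/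

import Mathlib

open CategoryTheory TopologicalSpace Opposite
open scoped ContDiff

universe u

/-- The Koszul sign `(-1)^{ab}` for parities `a, b ∈ ℤ/2ℤ`. -/
def superSign (a b : ZMod 2) : ℝ := if a = 1 ∧ b = 1 then -1 else 1

/-- A super ringed space over `ℝ`: a topological space with a sheaf of (associative, unital)
`ℝ`-algebras which is `ℤ/2ℤ`-graded and supercommutative. -/
structure SuperRingedSpace where
  carrier : TopCat.{u}
  sheaf : TopCat.Sheaf (AlgCat.{u} ℝ) carrier
  /-- even (`0`) and odd (`1`) sections -/
  parity : ∀ U : Opens carrier, ZMod 2 → Submodule ℝ (sheaf.presheaf.obj (op U))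
  parity_internal : ∀ U, DirectSum.IsInternal (parity U)
  parity_graded : ∀ U, SetLike.GradedMonoid (parity U)
  parity_map : ∀ {U V : Opens carrier} (h : V ⟶ U) (d : ZMod 2),
    ∀ f ∈ parity U d, (sheaf.presheaf.map h.op).hom f ∈ parity V d
  supercomm : ∀ (U) (d e : ZMod 2), ∀ f ∈ parity U d, ∀ g ∈ parity U e,
    f * g = superSign d e • (g * f)

namespace SuperRingedSpace

variable (M : SuperRingedSpace.{u})

/-- Sections of the structure sheaf over `U`. -/
abbrev Sec (U : Opens M.carrier) : Type u := M.sheaf.presheaf.obj (op U)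

/-- Restriction of sections. -/
def res {U V : Opens M.carrier} (h : V ≤ U) : M.Sec U →ₐ[ℝ] M.Sec V :=
  (M.sheaf.presheaf.map (homOfLE h).op).hom

/-- A superspace is a super ringed space all of whose stalks are local rings. -/
def IsSuperspace : Prop :=
  ∀ x : M.carrier, IsLocalRing
    (TopCat.Presheaf.stalk (C := RingCat.{u}) (M.sheaf.presheaf ⋙ forget₂ (AlgCat.{u} ℝ) RingCat.{u})
      x)

/-! ### Vector fields -/

/-- Families of `ℝ`-linear endomorphisms of the sections over the open subsets of `U`. The ring
structure is composition. Vector fields on `U` are the elements of `M.vec U` below. -/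
abbrev EndFamily (U : Opens M.carrier) : Type u :=
  ∀ W : {W : Opens M.carrier // W ≤ U}, Module.End ℝ (M.Sec W.1)

/-- Vector fields on `U` of parity `d`: families of superderivations of parity `d` of the algebras
of sections over the open subsets of `U`, compatible with restrictions. -/
def vecParity (U : Opens M.carrier) (d : ZMod 2) : Submodule ℝ (M.EndFamily U) where
  carrier := {X |
    (∀ (W W' : {W : Opens M.carrier // W ≤ U}) (h : W'.1 ≤ W.1) (f : M.Sec W.1),
      M.res h (X W f) = X W' (M.res h f)) ∧
    (∀ (W : {W : Opens M.carrier // W ≤ U}) (e : ZMod 2), ∀ f ∈ M.parity W.1 e,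
      X W f ∈ M.parity W.1 (d + e)) ∧
    (∀ (W : {W : Opens M.carrier // W ≤ U}) (e : ZMod 2), ∀ f ∈ M.parity W.1 e,
      ∀ g : M.Sec W.1, X W (f * g) = X W f * g + superSign d e • (f * X W g))}
  zero_mem' := by
    refine ⟨fun W W' h f => ?_, fun W e f _ => ?_, fun W e f _ g => ?_⟩ <;> simp
  add_mem' := by
    rintro X Y ⟨hX1, hX2, hX3⟩ ⟨hY1, hY2, hY3⟩
    refine ⟨fun W W' h f => ?_, fun W e f hf => ?_, fun W e f hf g => ?_⟩
    · simp [hX1 W W' h, hY1 W W' h]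
    · exact Submodule.add_mem _ (hX2 W e f hf) (hY2 W e f hf)
    · simp only [Pi.add_apply, LinearMap.add_apply, hX3 W e f hf g, hY3 W e f hf g, add_mul,
        mul_add, smul_add]
      abel
  smul_mem' := by
    rintro c X ⟨hX1, hX2, hX3⟩
    refine ⟨fun W W' h f => ?_, fun W e f hf => ?_, fun W e f hf g => ?_⟩
    · simp [hX1 W W' h]
    · exact Submodule.smul_mem _ c (hX2 W e f hf)
    · simp only [Pi.smul_apply, LinearMap.smul_apply, hX3 W e f hf g, smul_add, smul_mul_assoc,
        mul_smul_comm, smul_comm c]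

/-- The sections of the tangent sheaf over `U`: all vector fields on `U`, i.e. sums of an even
and an odd one. -/
def vec (U : Opens M.carrier) : Submodule ℝ (M.EndFamily U) :=
  M.vecParity U 0 ⊔ M.vecParity U 1

variable {M}

/-- Restriction of (families of endomorphisms and hence of) vector fields to a smaller open set. -/
def resVec {U V : Opens M.carrier} (h : V ≤ U) (X : M.EndFamily U) : M.EndFamily V :=
  fun W => X ⟨W.1, W.2.trans h⟩

/-- Multiplication of a vector field by a function from the left: `(a X)(f) = a · X(f)`. -/
def funMul {U : Opens M.carrier} (a : M.Sec U) (X : M.EndFamily U) : M.EndFamily U :=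
  fun W => LinearMap.mulLeft ℝ (M.res W.2 a) * X W

/-- The superbracket `[X, Y] = XY - (-1)^{de} YX` of vector fields of parities `d` and `e`. -/
def bracket {U : Opens M.carrier} (d e : ZMod 2) (X Y : M.EndFamily U) : M.EndFamily U :=
  X * Y - superSign d e • (Y * X)

variable (M)

/-- `D` restricts on `V` to a subsheaf of (graded) `𝒪`-submodules of the tangent sheaf. -/
structure IsSubmoduleSheafOn (V : Opens M.carrier)
    (D : ∀ U : Opens M.carrier, Submodule ℝ (M.EndFamily U)) : Prop where
  le_vec : ∀ U ≤ V, D U ≤ M.vec U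
  graded : ∀ U ≤ V, D U ≤ (D U ⊓ M.vecParity U 0) ⊔ (D U ⊓ M.vecParity U 1)
  funMul_mem : ∀ U ≤ V, ∀ (a : M.Sec U), ∀ X ∈ D U, funMul a X ∈ D U
  res_mem : ∀ U ≤ V, ∀ (W : Opens M.carrier) (h : W ≤ U), ∀ X ∈ D U, resVec h X ∈ D W
  mem_of_locally_mem : ∀ U ≤ V, ∀ X ∈ M.vec U,
    (∀ x ∈ U, ∃ (W : Opens M.carrier) (h : W ≤ U), x ∈ W ∧ resVec h X ∈ D W) → X ∈ D U

/-- A distribution: an `𝒪`-submodule sheaf of the tangent sheaf which is locally a direct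
factor. -/
structure Distribution where
  sec : ∀ U : Opens M.carrier, Submodule ℝ (M.EndFamily U)
  isSubmoduleSheaf : M.IsSubmoduleSheafOn ⊤ sec
  locally_direct_factor : ∀ x : M.carrier, ∃ (V : Opens M.carrier)
    (D' : ∀ U : Opens M.carrier, Submodule ℝ (M.EndFamily U)),
    x ∈ V ∧ M.IsSubmoduleSheafOn V D' ∧
      ∀ U ≤ V, sec U ⊓ D' U = ⊥ ∧ sec U ⊔ D' U = M.vec U

variable {M}

/-- A distribution is integrable (involutive) if it is stable under the superbracket. -/
def Distribution.IsIntegrable (D : M.Distribution) : Prop :=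
  ∀ (U : Opens M.carrier) (d e : ZMod 2), ∀ X ∈ D.sec U ⊓ M.vecParity U d,
    ∀ Y ∈ D.sec U ⊓ M.vecParity U e, bracket d e X Y ∈ D.sec U

/-- The value of a function `f` on `U` at `x ∈ U`: the (on a supermanifold, unique) real number
`c` such that `f - c` is not invertible on any neighbourhood of `x`. -/
noncomputable def value (x : M.carrier) {U : Opens M.carrier} (f : M.Sec U) : ℝ :=
  Classical.epsilon fun c : ℝ => ∀ (W : Opens M.carrier) (h : W ≤ U), x ∈ W →
    ¬ IsUnit (M.res h (f - algebraMap ℝ (M.Sec U) c))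

/-- The tangent vector at `x` of a vector field `X` on a neighbourhood `U` of `x`: the functional
`f ↦ (X f)(x)` on functions `f` defined near `x`. -/
noncomputable def tangentAt (x : M.carrier) {U : Opens M.carrier} (X : M.EndFamily U) :
    (Σ W : {W : Opens M.carrier // x ∈ W}, M.Sec W.1) → ℝ :=
  fun f => value x (X ⟨f.1.1 ⊓ U, inf_le_right⟩ (M.res inf_le_left f.2))

/-- The part of parity `d` of the fibre `D_x ⊆ T_x M`. -/
noncomputable def Distribution.fibre (D : M.Distribution) (x : M.carrier) (d : ZMod 2) :
    Submodule ℝ ((Σ W : {W : Opens M.carrier // x ∈ W}, M.Sec W.1) → ℝ) :=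
  Submodule.span ℝ {v | ∃ U : Opens M.carrier, x ∈ U ∧
    ∃ X ∈ D.sec U ⊓ M.vecParity U d, v = tangentAt x X}

/-- `D` has rank `r|s`: every fibre `D_x` has superdimension `r|s`. -/
def Distribution.HasRank (D : M.Distribution) (r s : ℕ) : Prop :=
  ∀ x : M.carrier, Module.rank ℝ (D.fibre x 0) = r ∧ Module.rank ℝ (D.fibre x 1) = s

end SuperRingedSpace

/-! ### Smooth functions on open subsets of `ℝ^p` -/

/-- The algebra `C^∞(W)` of smooth real functions on an open subset `W` of `ℝ^p`. (The extension
by zero only serves to speak of smoothness at the points of `W`.) -/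
def smoothFun {p : ℕ} (W : Opens (Fin p → ℝ)) : Subalgebra ℝ (W → ℝ) where
  carrier := {f | ContDiffOn ℝ ∞ (Function.extend Subtype.val f 0) W}
  mul_mem' := by
    intro f g hf hg
    refine (ContDiffOn.mul hf hg).congr fun x hx => ?_
    have h := fun k : W → ℝ => Subtype.val_injective.extend_apply k (0 : (Fin p → ℝ) → ℝ) ⟨x, hx⟩
    simp only at h
    simp [h]
  add_mem' := by
    intro f g hf hg
    refine (ContDiffOn.add hf hg).congr fun x hx => ?_
    have h := fun k : W → ℝ => Subtype.val_injective.extend_apply k (0 : (Fin p → ℝ) → ℝ) ⟨x, hx⟩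
    simp only at h
    simp [h]
  algebraMap_mem' := by
    intro c
    refine (contDiffOn_const (c := c)).congr fun x hx => ?_
    exact Subtype.val_injective.extend_apply _ (0 : (Fin p → ℝ) → ℝ) (⟨x, hx⟩ : W)

/-- Restriction of smooth functions. -/
def smoothFun.res {p : ℕ} {W W' : Opens (Fin p → ℝ)} (h : W' ≤ W) (f : smoothFun W) :
    smoothFun W' :=
  ⟨fun x => f.1 ⟨x.1, h x.2⟩, by
    have hf : ContDiffOn ℝ ∞ (Function.extend Subtype.val f.1 0) W := f.2
    refine (hf.mono (show (W' : Set (Fin p → ℝ)) ⊆ W from h)).congr fun x hx => ?_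
    exact (Subtype.val_injective.extend_apply _ (0 : (Fin p → ℝ) → ℝ) (⟨x, hx⟩ : W')).trans
      (Subtype.val_injective.extend_apply f.1 (0 : (Fin p → ℝ) → ℝ) (⟨x, h hx⟩ : W)).symm⟩

/-- The partial derivative `∂f/∂t^i` of a smooth function. -/
noncomputable def smoothFun.pderiv {p : ℕ} {W : Opens (Fin p → ℝ)} (i : Fin p)
    (f : smoothFun W) : smoothFun W :=
  ⟨fun x => fderiv ℝ (Function.extend Subtype.val f.1 0) x.1 (Pi.single i 1), by
    have hf : ContDiffOn ℝ ∞ (Function.extend Subtype.val f.1 0) W := f.2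
    have h1 := (hf.fderiv_of_isOpen (m := ∞) W.2 (by simp)).clm_apply
      (contDiffOn_const (c := (Pi.single i 1 : Fin p → ℝ)))
    refine h1.congr fun x hx => ?_
    exact Subtype.val_injective.extend_apply _ (0 : (Fin p → ℝ) → ℝ) (⟨x, hx⟩ : W)⟩

/-! ### Charts and supermanifolds -/

namespace SuperRingedSpace

/-- The open set `φ⁻¹(W)` of the domain of `φ`. -/
def chartPreimage {M : SuperRingedSpace.{u}} {p : ℕ}
    (φ : OpenPartialHomeomorph M.carrier (Fin p → ℝ)) (W : Opens (Fin p → ℝ)) :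
    Opens M.carrier :=
  ⟨φ.source ∩ φ ⁻¹' W, φ.isOpen_inter_preimage W.2⟩

theorem chartPreimage_mono {M : SuperRingedSpace.{u}} {p : ℕ}
    (φ : OpenPartialHomeomorph M.carrier (Fin p → ℝ)) {W W' : Opens (Fin p → ℝ)} (h : W' ≤ W) :
    chartPreimage φ W' ≤ chartPreimage φ W :=
  fun _ hx => ⟨hx.1, h hx.2⟩

theorem chartPreimage_le {M : SuperRingedSpace.{u}} {p : ℕ}
    (φ : OpenPartialHomeomorph M.carrier (Fin p → ℝ)) (W : Opens (Fin p → ℝ)) :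
    chartPreimage φ W ≤ ⟨φ.source, φ.open_source⟩ :=
  fun _ hx => hx.1

/-- A chart of dimension `p|q`, i.e. an isomorphism of an open sub-superspace `(V, 𝒪|_V)` with a
superdomain `U^{p|q} = (U, C^∞_U[θ^1, …, θ^q])`, `U ⊆ ℝ^p` open. It consists of a homeomorphism
`φ : V → U`, a homomorphism `pull` of sheaves of algebras from `C^∞_U` to the even part of
`φ_* 𝒪|_V`, and odd functions `θ^1, …, θ^q` on `V`, such that over every open subset each section
of `𝒪` is uniquely of the form `∑_I f_I(t) θ^I`, with `f_I` smooth and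
`θ^I = θ^{i_1} ⋯ θ^{i_k}` for `I = {i_1 < ⋯ < i_k}`. The even coordinates are the pullbacks
`t^1, …, t^p` of the standard coordinates of `ℝ^p`. -/
structure Chart (M : SuperRingedSpace.{u}) (p q : ℕ) where
  φ : OpenPartialHomeomorph M.carrier (Fin p → ℝ)
  pull : ∀ W : Opens (Fin p → ℝ), smoothFun W →ₐ[ℝ] M.Sec (chartPreimage φ W)
  pull_even : ∀ W f, pull W f ∈ M.parity _ 0
  pull_res : ∀ {W W' : Opens (Fin p → ℝ)} (h : W' ≤ W) (f : smoothFun W),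
    M.res (chartPreimage_mono φ h) (pull W f) = pull W' (smoothFun.res h f)
  θ : Fin q → M.Sec ⟨φ.source, φ.open_source⟩
  θ_odd : ∀ j, θ j ∈ M.parity _ 1
  bijective : ∀ W : Opens (Fin p → ℝ), (W : Set (Fin p → ℝ)) ⊆ φ.target →
    Function.Bijective fun f : Finset (Fin q) → smoothFun W =>
      ∑ I, pull W (f I) * M.res (chartPreimage_le φ W) ((I.sort).map θ).prod

namespace Chart

variable {M : SuperRingedSpace.{u}} {p q : ℕ} (c : M.Chart p q)

/-- The domain of the chart. -/
def domain : Opens M.carrier := ⟨c.φ.source, c.φ.open_source⟩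

/-- The function `f(t) θ^{j_1} ⋯ θ^{j_k}` on `φ⁻¹(W)`, for `f ∈ C^∞(W)` and a list of indices. -/
noncomputable def monomial {W : Opens (Fin p → ℝ)} (f : smoothFun W) (L : List (Fin q)) :
    M.Sec (chartPreimage c.φ W) :=
  c.pull W f * M.res (chartPreimage_le c.φ W) (L.map c.θ).prod

/-- `X` is the coordinate vector field `∂/∂t^i` of the chart: the vector field with
`X (f_I θ^I) = (∂f_I/∂t^i) θ^I`. -/
def IsPartialT (i : Fin p) (X : M.EndFamily c.domain) : Prop :=
  X ∈ M.vec c.domain ∧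
  ∀ (W : Opens (Fin p → ℝ)), (W : Set (Fin p → ℝ)) ⊆ c.φ.target →
    ∀ (f : smoothFun W) (I : Finset (Fin q)),
      X ⟨chartPreimage c.φ W, chartPreimage_le c.φ W⟩ (c.monomial f I.sort) =
        c.monomial (smoothFun.pderiv i f) I.sort

/-- `X` is the coordinate vector field `∂/∂θ^j` of the chart: the vector field with
`X (f_I θ^I) = 0` and `X (f_I θ^j θ^I) = f_I θ^I` for `j ∉ I`. -/
def IsPartialTheta (j : Fin q) (X : M.EndFamily c.domain) : Prop :=
  X ∈ M.vec c.domain ∧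
  ∀ (W : Opens (Fin p → ℝ)), (W : Set (Fin p → ℝ)) ⊆ c.φ.target →
    ∀ (f : smoothFun W) (I : Finset (Fin q)), j ∉ I →
      X ⟨chartPreimage c.φ W, chartPreimage_le c.φ W⟩ (c.monomial f I.sort) = 0 ∧
      X ⟨chartPreimage c.φ W, chartPreimage_le c.φ W⟩ (c.monomial f (j :: I.sort)) =
        c.monomial f I.sort

end Chart

/-- A `C^∞`-supermanifold of dimension `p|q`: a superspace locally isomorphic to `ℝ^{p|q}`. -/
structure IsSupermanifold (M : SuperRingedSpace.{u}) (p q : ℕ) : Prop where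
  isSuperspace : M.IsSuperspace
  exists_chart : ∀ x : M.carrier, ∃ c : M.Chart p q, x ∈ c.domain

end SuperRingedSpace

/-! The idea is to span the distribution `D` near `x` by homogeneous fields that supercommute
exactly, and then to straighten all of them at once by completing part of a coordinate system with
common first integrals.

Frame. The values at `x` of sections of `D` and of a local complement `D'` span all directions, so
homogeneous fields `Z a` can be chosen from `D` and `D'`, together with coordinates obtained by a
linear change, such that the matrix `Z a (x^b)` has body the identity at `x`
(`exists_adapted_chart`). This matrix is invertible near `x`, because its body is and the rest is
nilpotent (`isUnit_matrix`). As `D` and `D'` meet in zero, the `Z a` taken from `D` span `D`, and an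
inverse matrix turns them into fields `X a` in `D` whose values on the first `r|s` coordinates are
exactly `δ`. A section of `D` that annihilates these coordinates is zero. The bracket of `X a` and
`X b` lies in `D` by integrability and annihilates them, since the values of the frame on them are
constants; so it vanishes (`exists_frame`).

First integrals. Any function can be corrected so that all `X a` annihilate it, while its
differential at `x` keeps its components transversal to the frame (`IsDualFrame.exists_invariant`).
For an even field one solves a transport equation with zero data on the hyperplane `t^i = t^i(x)`;
commutativity and uniqueness show that the invariance already achieved is not lost. For an odd field
one subtracts `θ^j X_j G`, using that `X_j` has square zero. Replacing the coordinates outside the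
first `r|s` by such invariants gives a new chart by the inverse function theorem
(`exists_chart_of_dAt`). In it the `X a` have the values of coordinate fields on the coordinates,
and so are coordinate fields (`vec_ext`).

Analysis. Transport of sections is solved degree by degree in the odd coordinates: the leading
coefficients satisfy a linear transport system on `ℝ^p` along the body of the field (`cf_evenField`,
`exists_transport_section`, `eq_zero_of_field_eq_zero`). That system is treated by characteristics
(`exists_transport`, `transport_unique`), with smooth flows from the implicit function theorem in a
space of curves (`exists_smooth_flow`). The inverse function theorem changes first the odd
coordinates and then the even ones; in the second step functions are pulled back by a finite Taylor
expansion in the nilpotent part (`exists_chart_odd`, `exists_chart_even`). -/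

/-! ### Post-composition with a smooth map on spaces of continuous maps -/

section PostComposition

open Topology

variable {K : Type*} [TopologicalSpace K] [CompactSpace K]
variable {E : Type u} [NormedAddCommGroup E] [NormedSpace ℝ E]
variable {F : Type u} [NormedAddCommGroup F] [NormedSpace ℝ F]

/-- Pointwise application of a continuous family of continuous linear maps. -/
noncomputable def pointwiseApply (K : Type*) [TopologicalSpace K] [CompactSpace K]
    (E : Type u) [NormedAddCommGroup E] [NormedSpace ℝ E]
    (F : Type u) [NormedAddCommGroup F] [NormedSpace ℝ F] :
    C(K, E →L[ℝ] F) →L[ℝ] C(K, E) →L[ℝ] C(K, F) :=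
  LinearMap.mkContinuous₂
    (LinearMap.mk₂ ℝ (fun (A : C(K, E →L[ℝ] F)) (h : C(K, E)) => (⟨fun k => A k (h k), by fun_prop⟩ : C(K, F)))
      (fun _ _ _ => by ext; simp) (fun _ _ _ => by ext; simp)
      (fun _ _ _ => by ext; simp) (fun _ _ _ => by ext; simp)) 1 (by
      intro A h
      rw [one_mul]
      refine (ContinuousMap.norm_le _ (by positivity)).2 fun k => ?_
      exact ((A k).le_opNorm _).trans
        (mul_le_mul (A.norm_coe_le_norm k) (h.norm_coe_le_norm k) (norm_nonneg _) (norm_nonneg A)))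

@[simp] theorem pointwiseApply_apply (A : C(K, E →L[ℝ] F)) (h : C(K, E)) (k : K) :
    pointwiseApply K E F A h k = A k (h k) := rfl

/-- Compactness of `K` makes the variation of `fderiv ℝ v` near `γ` small uniformly in the point,
and the mean value inequality on balls turns this into a remainder `o(‖h‖)` in the sup norm. -/
theorem hasFDerivAt_postComp {v : E → F} (hv : ContDiff ℝ 1 v) (γ : C(K, E)) :
    HasFDerivAt (fun γ : C(K, E) => (⟨v, hv.continuous⟩ : C(E, F)).comp γ)
      (pointwiseApply K E F
        ((⟨fderiv ℝ v, hv.continuous_fderiv (by simp)⟩ : C(E, E →L[ℝ] F)).comp γ)) γ := by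
  have hd : Differentiable ℝ v := hv.differentiable (by simp)
  have hc : Continuous (fderiv ℝ v) := hv.continuous_fderiv (by simp)
  rw [hasFDerivAt_iff_isLittleO_nhds_zero, Asymptotics.isLittleO_iff]
  intro c hcpos
  have key : ∀ᶠ h : E in 𝓝 0, ∀ k ∈ (Set.univ : Set K),
      ‖fderiv ℝ v (γ k + h) - fderiv ℝ v (γ k)‖ < c := by
    apply isCompact_univ.eventually_forall_of_forall_eventually
    intro k _
    have hcont : Continuous fun z : E × K =>
        ‖fderiv ℝ v (γ z.2 + z.1) - fderiv ℝ v (γ z.2)‖ := by fun_prop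
    have := hcont.tendsto (0, k)
    simp only [add_zero, sub_self, norm_zero] at this
    exact this.eventually (gt_mem_nhds hcpos)
  obtain ⟨δ, hδ, hball⟩ := Metric.eventually_nhds_iff_ball.1 key
  filter_upwards [Metric.ball_mem_nhds (0 : C(K, E)) hδ] with h hh
  refine (ContinuousMap.norm_le _ (by positivity)).2 fun k => ?_
  have hk : ‖h k‖ < δ := lt_of_le_of_lt (h.norm_coe_le_norm k) (by simpa using hh)
  have := (convex_ball (γ k) δ).norm_image_sub_le_of_norm_hasFDerivWithin_le'
    (f := v) (f' := fderiv ℝ v) (φ := fderiv ℝ v (γ k)) (C := c) (x := γ k) (y := γ k + h k)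
    (fun y _ => (hd y).hasFDerivAt.hasFDerivWithinAt)
    (fun y hy => by
      have := hball (y - γ k) (by simpa [dist_eq_norm] using hy) k trivial
      simpa using this.le)
    (Metric.mem_ball_self hδ) (by simpa [dist_eq_norm] using hk)
  have h2 : ‖v (γ k + h k) - v (γ k) - fderiv ℝ v (γ k) (h k)‖ ≤ c * ‖h k‖ := by
    simpa using this
  have h3 : c * ‖h k‖ ≤ c * ‖h‖ := by gcongr; exact h.norm_coe_le_norm k
  exact h2.trans h3

/-- The derivative is again a post-composition, now with `fderiv ℝ v`, followed by the continuous
linear map `pointwiseApply`. It takes values in another space, which is why `F` is quantified inside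
the induction and shares the universe of `E`. -/
theorem contDiff_nat_postComp (n : ℕ) : ∀ {F : Type u} [NormedAddCommGroup F] [NormedSpace ℝ F]
    {v : E → F} (hv : ContDiff ℝ ∞ v),
    ContDiff ℝ n (fun γ : C(K, E) => (⟨v, hv.continuous⟩ : C(E, F)).comp γ) := by
  induction n with
  | zero =>
    intro F _ _ v hv
    exact contDiff_zero.2 (ContinuousMap.continuous_postcomp _)
  | succ n ih =>
    intro F _ _ v hv
    have h1 : ContDiff ℝ 1 v := hv.of_le (by exact_mod_cast le_top)
    have h2 : ContDiff ℝ ∞ (fderiv ℝ v) := hv.fderiv_right (by simp)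
    rw [Nat.cast_succ, contDiff_succ_iff_hasFDerivAt]
    refine ⟨_, ?_, fun γ => hasFDerivAt_postComp h1 γ⟩
    exact (pointwiseApply K E F).contDiff.comp (ih h2)

theorem contDiff_postComp {v : E → F} (hv : ContDiff ℝ ∞ v) :
    ContDiff ℝ ∞ (fun γ : C(K, E) => (⟨v, hv.continuous⟩ : C(E, F)).comp γ) :=
  contDiff_infty.2 fun n => contDiff_nat_postComp n hv

end PostComposition

/-! ### Smoothness of flows -/

section Flow

open Topology Set unitInterval

variable {E : Type u} [NormedAddCommGroup E] [NormedSpace ℝ E] [CompleteSpace E]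

theorem intervalIntegrable_IccExtend {E : Type*} [NormedAddCommGroup E] (γ : C(I, E)) (a b : ℝ) :
    IntervalIntegrable (fun τ => IccExtend zero_le_one γ τ) MeasureTheory.volume a b :=
  (γ.continuous.Icc_extend' ).intervalIntegrable a b

/-- The primitive vanishing at `0` of a continuous curve on the unit interval. -/
noncomputable def curvePrimitive (E : Type u) [NormedAddCommGroup E] [NormedSpace ℝ E]
    [CompleteSpace E] : C(I, E) →L[ℝ] C(I, E) :=
  LinearMap.mkContinuous
    { toFun := fun γ => ⟨fun t => ∫ τ in (0 : ℝ)..t, IccExtend zero_le_one γ τ, by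
        have := intervalIntegral.continuous_primitive
          (fun a b => intervalIntegrable_IccExtend γ a b) 0
        exact this.comp continuous_subtype_val⟩
      map_add' := fun γ β => by
        ext t
        simp only [ContinuousMap.coe_mk, ContinuousMap.add_apply]
        rw [← intervalIntegral.integral_add (intervalIntegrable_IccExtend γ _ _)
          (intervalIntegrable_IccExtend β _ _)]
        rfl
      map_smul' := fun c γ => by
        ext t
        simp only [ContinuousMap.coe_mk, ContinuousMap.smul_apply, RingHom.id_apply]
        rw [← intervalIntegral.integral_smul]
        rfl } 1 (by
    intro γ
    rw [one_mul]
    refine (ContinuousMap.norm_le _ (by positivity)).2 fun t => ?_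
    have := intervalIntegral.norm_integral_le_of_norm_le_const (a := (0 : ℝ)) (b := t)
      (f := fun τ => IccExtend zero_le_one γ τ) (C := ‖γ‖)
      (fun τ _ => γ.norm_coe_le_norm _)
    refine this.trans ?_
    rw [sub_zero, abs_of_nonneg t.2.1]
    exact mul_le_of_le_one_right (norm_nonneg _) t.2.2)

theorem curvePrimitive_apply (γ : C(I, E)) (t : I) :
    curvePrimitive E γ t = ∫ τ in (0 : ℝ)..t, IccExtend zero_le_one γ τ := rfl

theorem norm_curvePrimitive_le : ‖curvePrimitive E‖ ≤ 1 :=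
  LinearMap.mkContinuous_norm_le _ zero_le_one _

/-- Neumann series. In the application `T` is integration, `A` is the derivative of the field along
a curve, and `s` is the time. -/
theorem isInvertible_id_sub_smul_comp {X : Type*} [NormedAddCommGroup X] [NormedSpace ℝ X]
    [CompleteSpace X] (T A : X →L[ℝ] X) {s L : ℝ} (hT : ‖T‖ ≤ 1) (hA : ‖A‖ ≤ L)
    (hs : |s| * L < 1) : (ContinuousLinearMap.id ℝ X - s • (T ∘L A)).IsInvertible := by
  have hn : ‖s • (T ∘L A)‖ < 1 := by
    rw [norm_smul, Real.norm_eq_abs]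
    refine lt_of_le_of_lt ?_ hs
    gcongr
    refine (ContinuousLinearMap.opNorm_comp_le _ _).trans ?_
    calc ‖T‖ * ‖A‖ ≤ 1 * L := mul_le_mul hT hA (norm_nonneg _) zero_le_one
      _ = L := one_mul _
  have hu := isUnit_one_sub_of_norm_lt_one hn
  exact ⟨ContinuousLinearEquiv.unitsEquiv ℝ _ hu.unit, by ext; rfl⟩

theorem dist_smul_map_le {X : Type*} [NormedAddCommGroup X] [NormedSpace ℝ X]
    (T : X →L[ℝ] X) (s : ℝ) (hT : ‖T‖ ≤ 1) (x y : X) :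
    dist (s • T x) (s • T y) ≤ |s| * dist x y := by
  rw [dist_smul₀, Real.norm_eq_abs]
  gcongr
  rw [dist_eq_norm, ← map_sub, dist_eq_norm]
  exact (T.le_opNorm _).trans (mul_le_of_le_one_left (norm_nonneg _) hT)

/-- Constant curves. -/
noncomputable def constCurve (E : Type u) [NormedAddCommGroup E] [NormedSpace ℝ E] :
    E →L[ℝ] C(I, E) :=
  LinearMap.mkContinuous
    { toFun := fun x => ContinuousMap.const I x
      map_add' := fun _ _ => rfl
      map_smul' := fun _ _ => rfl } 1 (by
    intro x
    rw [one_mul]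
    exact (ContinuousMap.norm_le _ (by positivity)).2 fun t => le_rfl)

/-- The equation `γ = x + s ∫ v(γ)` for the curves `t ↦ Φ(st, x)` of the flow `Φ` of `v`. -/
noncomputable def picardDefect {v : E → E} (hv : Continuous v) (z : (ℝ × E) × C(I, E)) :
    C(I, E) :=
  z.2 - constCurve E z.1.2 - z.1.1 • curvePrimitive E ((⟨v, hv⟩ : C(E, E)).comp z.2)

theorem contDiff_picardDefect {v : E → E} (hv : ContDiff ℝ ∞ v) :
    ContDiff ℝ ∞ (picardDefect hv.continuous) := by
  have h1 : ContDiff ℝ ∞ fun z : (ℝ × E) × C(I, E) =>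
      ((⟨v, hv.continuous⟩ : C(E, E)).comp z.2) := (contDiff_postComp hv).comp contDiff_snd
  unfold picardDefect
  fun_prop

/-- In the curve variable the derivative is the identity minus `s` times the primitive of the
derivative of `v` along the curve. The Lipschitz constant bounds the latter, so the perturbation has
norm below one and the implicit function theorem becomes available. -/
theorem isInvertible_picardDefect {v : E → E} (hv : ContDiff ℝ ∞ v) {L : NNReal}
    (hL : LipschitzWith L v) (z : (ℝ × E) × C(I, E)) (hz : |z.1.1| * L < 1) :
    (fderiv ℝ (picardDefect hv.continuous) z ∘L .inr ℝ (ℝ × E) C(I, E)).IsInvertible := by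
  have h1 : ContDiff ℝ 1 v := hv.of_le (by exact_mod_cast le_top)
  set A := pointwiseApply I E E
    ((⟨fderiv ℝ v, h1.continuous_fderiv (by simp)⟩ : C(E, E →L[ℝ] E)).comp z.2) with hA
  have hcomp : HasFDerivAt (fun γ => picardDefect hv.continuous (z.1, γ))
      (ContinuousLinearMap.id ℝ C(I, E) - z.1.1 • (curvePrimitive E ∘L A)) z.2 := by
    have := ((hasFDerivAt_id z.2).sub_const (constCurve E z.1.2)).sub
      (((curvePrimitive E).hasFDerivAt.comp z.2 (hasFDerivAt_postComp (K := I) h1 z.2)).const_smul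
        z.1.1)
    exact this
  have hcomp' : HasFDerivAt (fun γ => picardDefect hv.continuous (z.1, γ))
      (fderiv ℝ (picardDefect hv.continuous) z ∘L .inr ℝ (ℝ × E) C(I, E)) z.2 :=
    HasFDerivAt.comp (g := picardDefect hv.continuous) (f := fun γ => (z.1, γ)) z.2
      (((contDiff_picardDefect hv).differentiable (by simp)) z).hasFDerivAt
      (hasFDerivAt_prodMk_right z.1 z.2)
  rw [hcomp'.unique hcomp]
  have hAn : ‖A‖ ≤ L := by
    refine ContinuousLinearMap.opNorm_le_bound _ L.2 fun h => ?_
    refine (ContinuousMap.norm_le _ (by positivity)).2 fun k => ?_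
    rw [hA, pointwiseApply_apply]
    refine ((ContinuousLinearMap.le_opNorm _ _)).trans ?_
    exact mul_le_mul (norm_fderiv_le_of_lipschitz ℝ hL) (h.norm_coe_le_norm k)
      (norm_nonneg _) L.2
  exact isInvertible_id_sub_smul_comp _ _ norm_curvePrimitive_le hAn hz

/-- Picard iteration, a contraction of constant `|s| * L`. Rescaling time to the unit interval keeps
all curves in one fixed Banach space. -/
theorem exists_picardDefect_eq_zero {v : E → E} (hv : Continuous v) {L : NNReal}
    (hL : LipschitzWith L v) (y : ℝ × E) (hy : |y.1| * L < 1) :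
    ∃! γ, picardDefect hv (y, γ) = 0 := by
  set f : C(I, E) → C(I, E) := fun γ =>
    constCurve E y.2 + y.1 • curvePrimitive E ((⟨v, hv⟩ : C(E, E)).comp γ) with hf
  have hk : (0 : ℝ) ≤ |y.1| * L := by positivity
  have hcontr : ContractingWith ⟨|y.1| * L, hk⟩ f := by
    refine ⟨by exact_mod_cast hy, LipschitzWith.of_dist_le_mul fun γ β => ?_⟩
    have h1 : dist ((⟨v, hv⟩ : C(E, E)).comp γ) ((⟨v, hv⟩ : C(E, E)).comp β) ≤ L * dist γ β :=
      (ContinuousMap.dist_le (by positivity)).2 fun t =>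
        (hL.dist_le_mul _ _).trans (by gcongr; exact ContinuousMap.dist_apply_le_dist t)
    change _ ≤ |y.1| * L * dist γ β
    rw [hf, dist_add_left, mul_assoc]
    exact (dist_smul_map_le _ _ norm_curvePrimitive_le _ _).trans (by gcongr)
  have hiff : ∀ γ, picardDefect hv (y, γ) = 0 ↔ f γ = γ := by
    intro γ
    rw [picardDefect, sub_sub, sub_eq_zero, eq_comm]
  refine ⟨hcontr.fixedPoint, (hiff _).2 hcontr.fixedPoint_isFixedPt, fun β hβ => ?_⟩
  exact hcontr.fixedPoint_unique ((hiff β).1 hβ)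

/-- The flow of a smooth globally Lipschitz vector field exists for a uniform time and is
smooth. -/
theorem exists_smooth_flow {v : E → E} (hv : ContDiff ℝ ∞ v) {L : NNReal}
    (hL : LipschitzWith L v) :
    ∃ ε > 0, ∃ Φ : ℝ × E → E, ContDiffOn ℝ ∞ Φ (Ioo (-ε) ε ×ˢ univ) ∧ (∀ x, Φ (0, x) = x) ∧
      ∀ x, ∀ s ∈ Ioo (-ε) ε, HasDerivAt (fun s => Φ (s, x)) (v (Φ (s, x))) s := by
  -- The summand 1 covers `L = 0`; with it `|s| < ε` implies `|s| * L < 1`.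
  set ε : ℝ := 1 / (L + 1) with hε
  have hε0 : 0 < ε := by positivity
  have hsmall : ∀ s : ℝ, s ∈ Ioo (-ε) ε → |s| * L < 1 := by
    intro s hs
    have h1 : |s| < ε := abs_lt.2 hs
    have h2 : |s| * (L + 1) < 1 := by
      rwa [hε, lt_div_iff₀ (by positivity)] at h1
    nlinarith [abs_nonneg s]
  choose! γ hγ hγu using fun (y : ℝ × E) (hy : |y.1| * L < 1) =>
    exists_picardDefect_eq_zero hv.continuous hL y hy
  have hγs : ∀ y : ℝ × E, y.1 ∈ Ioo (-ε) ε → ContDiffAt ℝ ∞ γ y := by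
    intro y hy
    have hy' := hsmall _ hy
    have cdf : ContDiffAt ℝ ∞ (picardDefect hv.continuous) (y, γ y) :=
      (contDiff_picardDefect hv).contDiffAt
    have hinv := isInvertible_picardDefect hv hL (y, γ y) hy'
    -- By uniqueness of the solution, `γ` agrees near `y` with the implicit function, and is
    -- therefore smooth.
    refine (cdf.contDiffAt_implicitFunction (by simp) hinv).congr_of_eventuallyEq ?_
    have hopen : ∀ᶠ y' : ℝ × E in 𝓝 y, y'.1 ∈ Ioo (-ε) ε :=
      continuous_fst.continuousAt.eventually (isOpen_Ioo.mem_nhds hy)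
    filter_upwards [cdf.eventually_apply_implicitFunction (by simp) hinv, hopen] with y' h1 h2
    rw [hγ y hy'] at h1
    exact (hγu y' (hsmall _ h2) _ h1).symm
  have heq : ∀ y : ℝ × E, y.1 ∈ Ioo (-ε) ε → ∀ t : I, γ y t =
      y.2 + y.1 • ∫ τ in (0 : ℝ)..t, IccExtend zero_le_one (fun τ => v (γ y τ)) τ := by
    intro y hy t
    have h := congrArg (fun β : C(I, E) => β t) (hγ y (hsmall _ hy))
    simp only [picardDefect, ContinuousMap.sub_apply, ContinuousMap.smul_apply,
      curvePrimitive_apply, ContinuousMap.zero_apply] at h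
    rw [sub_sub, sub_eq_zero] at h
    exact h
  -- Stopping at the fraction `t` of the time `s` is the same as running for the time `s * t`: the
  -- reparametrized curve `t' ↦ γ (s, x) (t * t')` solves the equation for `(s * t, x)`. This is
  -- what gives the endpoints `Φ` an integral equation in `s`.
  have hscale : ∀ (s : ℝ) (x : E), s ∈ Ioo (-ε) ε → ∀ t : I, γ (s * t, x) 1 = γ (s, x) t := by
    intro s x hs t
    have hst : s * t ∈ Ioo (-ε) ε := by
      rw [mem_Ioo, ← abs_lt] at hs ⊢
      rw [abs_mul, abs_of_nonneg t.2.1]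
      exact lt_of_le_of_lt (mul_le_of_le_one_right (abs_nonneg _) t.2.2) hs
    let β : C(I, E) := (γ (s, x)).comp ⟨fun t' => t * t', by fun_prop⟩
    have hβ : picardDefect hv.continuous ((s * t, x), β) = 0 := by
      ext t'
      simp only [picardDefect, ContinuousMap.sub_apply, ContinuousMap.smul_apply,
        curvePrimitive_apply, ContinuousMap.zero_apply]
      rw [sub_sub, sub_eq_zero]
      have h1 : β t' = γ (s, x) (t * t') := rfl
      rw [h1, heq (s, x) hs (t * t')]
      congr 1
      rw [mul_smul]
      congr 1
      have h2 := intervalIntegral.smul_integral_comp_mul_left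
        (f := IccExtend zero_le_one (fun τ => v (γ (s, x) τ))) (a := (0 : ℝ)) (b := (t' : ℝ)) (t : ℝ)
      rw [mul_zero] at h2
      rw [Set.Icc.coe_mul, ← h2]
      congr 1
      apply intervalIntegral.integral_congr
      intro τ hτ
      rw [uIcc_of_le t'.2.1] at hτ
      have hτ' : τ ∈ I := ⟨hτ.1, hτ.2.trans t'.2.2⟩
      have htτ : (t : ℝ) * τ ∈ I := unitInterval.mul_mem t.2 hτ'
      simp only
      rw [IccExtend_of_mem _ _ htτ, IccExtend_of_mem _ _ hτ']
      rfl
    rw [← hγu (s * t, x) (hsmall _ hst) β hβ]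
    change γ (s, x) (t * 1) = _
    rw [mul_one]
  set Φ : ℝ × E → E := fun y => γ y 1 with hΦ
  have hΦs : ContDiffOn ℝ ∞ Φ (Ioo (-ε) ε ×ˢ univ) := by
    intro y hy
    have h1 := (ContinuousMap.evalCLM ℝ (1 : I) : C(I, E) →L[ℝ] E).contDiff (n := ∞)
    exact ((h1.contDiffAt (x := γ y)).comp y (hγs y hy.1)).contDiffWithinAt
  have hΦ0 : ∀ x, Φ (0, x) = x := by
    intro x
    have := heq (0, x) (by simpa using hε0) 1
    simpa using this
  refine ⟨ε, hε0, Φ, hΦs, hΦ0, fun x s hs => ?_⟩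
  have hcont : ContinuousOn (fun s => v (Φ (s, x))) (Ioo (-ε) ε) :=
    hv.continuous.comp_continuousOn (hΦs.continuousOn.comp (by fun_prop) (fun s hs => ⟨hs, trivial⟩))
  have hint : ∀ a ∈ Ioo (-ε) ε, Φ (a, x) = x + ∫ τ in (0 : ℝ)..a, v (Φ (τ, x)) := by
    intro a ha
    have h1 := heq (a, x) ha 1
    change Φ (a, x) = _ at h1
    rw [h1]
    congr 1
    have h2 := intervalIntegral.smul_integral_comp_mul_left
        (f := fun τ => v (Φ (τ, x))) (a := (0 : ℝ)) (b := (1 : ℝ)) a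
    rw [mul_zero, mul_one] at h2
    rw [← h2]
    congr 1
    apply intervalIntegral.integral_congr
    intro τ hτ
    rw [Set.Icc.coe_one, uIcc_of_le zero_le_one] at hτ
    simp only
    rw [IccExtend_of_mem _ _ hτ, hΦ]
    simp only
    rw [← hscale a x ha ⟨τ, hτ⟩]
  have hd : HasDerivAt (fun a => x + ∫ τ in (0 : ℝ)..a, v (Φ (τ, x))) (v (Φ (s, x))) s := by
    refine HasDerivAt.const_add _ ?_
    refine intervalIntegral.integral_hasDerivAt_right ?_ ?_ ?_
    · refine (hcont.mono ?_).intervalIntegrable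
      intro τ hτ
      exact (convex_Ioo (-ε) ε).ordConnected.uIcc_subset (by simpa using hε0) hs hτ
    · exact hcont.stronglyMeasurableAtFilter isOpen_Ioo s hs
    · exact hcont.continuousAt (isOpen_Ioo.mem_nhds hs)
  refine hd.congr_of_eventuallyEq ?_
  filter_upwards [isOpen_Ioo.mem_nhds hs] with a ha using hint a ha

end Flow

/-! ### Cutoffs and Hadamard's lemma -/

section Cutoff

open Topology Set Filter

variable {E : Type*} [NormedAddCommGroup E] [NormedSpace ℝ E]
variable {F : Type*} [NormedAddCommGroup F] [NormedSpace ℝ F]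

theorem exists_smooth_cutoff [FiniteDimensional ℝ E] {W : Set E} {y : E} (hW : W ∈ 𝓝 y) :
    ∃ χ : E → ℝ, ContDiff ℝ ∞ χ ∧ HasCompactSupport χ ∧ tsupport χ ⊆ W ∧ χ =ᶠ[𝓝 y] 1 := by
  obtain ⟨ε, hε, hball⟩ := Metric.nhds_basis_closedBall.mem_iff.1 hW
  let b : ContDiffBump y := ⟨ε / 2, ε, by positivity, by linarith⟩
  exact ⟨b, b.contDiff, b.hasCompactSupport, by rw [b.tsupport_eq]; exact hball, b.eventuallyEq_one⟩

theorem contDiff_smul_of_tsupport_subset {W : Set E} (hW : IsOpen W) {χ : E → ℝ} {f : E → F}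
    (hχ : ContDiff ℝ ∞ χ) (hsub : tsupport χ ⊆ W) (hf : ContDiffOn ℝ ∞ f W) :
    ContDiff ℝ ∞ (fun y => χ y • f y) := by
  rw [contDiff_iff_contDiffAt]
  intro y
  by_cases hy : y ∈ W
  · exact hχ.contDiffAt.smul (hf.contDiffAt (hW.mem_nhds hy))
  · have h0 : (fun y => χ y • f y) =ᶠ[𝓝 y] fun _ => 0 := by
      have : (tsupport χ)ᶜ ∈ 𝓝 y :=
        (isClosed_tsupport χ).isOpen_compl.mem_nhds fun h => hy (hsub h)
      filter_upwards [this] with z hz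
      rw [image_eq_zero_of_notMem_tsupport hz, zero_smul]
    exact contDiffAt_const.congr_of_eventuallyEq h0

/-- The fundamental theorem of calculus along the segment from `y₀` to `y`, with `g i` the mean of
the `i`-th partial derivative over the segment. Smoothness in `y` needs no differentiation under the
integral sign, because `g i` is a composite of smooth maps through spaces of curves. -/
theorem hadamard_global {p : ℕ} {f : (Fin p → ℝ) → ℝ} (hf : ContDiff ℝ ∞ f) (y₀ : Fin p → ℝ) :
    ∃ g : Fin p → (Fin p → ℝ) → ℝ, (∀ i, ContDiff ℝ ∞ (g i)) ∧
      ∀ y, f y = f y₀ + ∑ i, (y i - y₀ i) * g i y := by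
  let E' := Fin p → ℝ
  let curve : E' → C(unitInterval, E') := fun y =>
    constCurve E' y₀ + curvePrimitive E' (constCurve E' (y - y₀))
  have hcurve : ContDiff ℝ ∞ curve := by fun_prop
  have hcurve_apply : ∀ (y : E') (t : unitInterval), curve y t = y₀ + (t : ℝ) • (y - y₀) := by
    intro y t
    change y₀ + curvePrimitive E' (constCurve E' (y - y₀)) t = _
    rw [curvePrimitive_apply]
    congr 1
    have : ∀ τ : ℝ, IccExtend zero_le_one (constCurve E' (y - y₀)) τ = y - y₀ := fun τ => rfl
    simp only [this, intervalIntegral.integral_const, sub_zero]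
  have hpd : ∀ i, ContDiff ℝ ∞ (fun y => fderiv ℝ f y (Pi.single i 1)) := fun i =>
    (hf.fderiv_right (m := ∞) (by simp)).clm_apply contDiff_const
  refine ⟨fun i y => curvePrimitive ℝ ((⟨_, (hpd i).continuous⟩ : C(E', ℝ)).comp (curve y)) 1,
    fun i => ?_, fun y => ?_⟩
  · have h1 := (ContinuousMap.evalCLM ℝ (1 : unitInterval) : C(unitInterval, ℝ) →L[ℝ] ℝ).contDiff
      (n := ∞)
    exact h1.comp ((curvePrimitive ℝ).contDiff.comp ((contDiff_postComp (hpd i)).comp hcurve))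
  · have hd : Differentiable ℝ f := hf.differentiable (by simp)
    have hline : ∀ t : ℝ, HasDerivAt (fun t : ℝ => f (y₀ + t • (y - y₀)))
        (fderiv ℝ f (y₀ + t • (y - y₀)) (y - y₀)) t := by
      intro t
      have h1 : HasDerivAt (fun t : ℝ => y₀ + t • (y - y₀)) (y - y₀) t := by
        simpa using ((hasDerivAt_id t).smul_const (y - y₀)).const_add y₀
      exact (hd _).hasFDerivAt.comp_hasDerivAt t h1
    have hc : Continuous fun t : ℝ => fderiv ℝ f (y₀ + t • (y - y₀)) (y - y₀) :=
      ((hf.continuous_fderiv (by simp)).comp (by fun_prop)).clm_apply continuous_const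
    have hftc := intervalIntegral.integral_eq_sub_of_hasDerivAt (a := 0) (b := 1)
      (fun t _ => hline t) (hc.intervalIntegrable _ _)
    have hsum : ∀ t : ℝ, fderiv ℝ f (y₀ + t • (y - y₀)) (y - y₀) =
        ∑ i, (y i - y₀ i) * fderiv ℝ f (y₀ + t • (y - y₀)) (Pi.single i 1) := by
      intro t
      generalize fderiv ℝ f (y₀ + t • (y - y₀)) = A
      conv_lhs => rw [pi_eq_sum_univ' (y - y₀)]
      simp [map_sum]
    have hci : ∀ i, Continuous fun t : ℝ => fderiv ℝ f (y₀ + t • (y - y₀)) (Pi.single i 1) :=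
      fun i => (hpd i).continuous.comp (by fun_prop)
    simp only [hsum] at hftc
    rw [intervalIntegral.integral_finsetSum
      (fun i _ => ((hci i).const_mul _).intervalIntegrable _ _)] at hftc
    simp only [one_smul, zero_smul, add_zero, add_sub_cancel] at hftc
    rw [eq_comm, ← eq_sub_iff_add_eq', ← hftc]
    refine Finset.sum_congr rfl fun i _ => ?_
    simp only
    rw [intervalIntegral.integral_const_mul, curvePrimitive_apply]
    congr 1
    rw [Set.Icc.coe_one]
    apply intervalIntegral.integral_congr
    intro t ht
    rw [uIcc_of_le zero_le_one] at ht
    simp only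
    rw [IccExtend_of_mem _ _ ht]
    change fderiv ℝ f (curve y ⟨t, ht⟩) _ = _
    rw [hcurve_apply]

theorem hadamard_local {p : ℕ} {f : (Fin p → ℝ) → ℝ} {W : Set (Fin p → ℝ)} (hW : IsOpen W)
    (hf : ContDiffOn ℝ ∞ f W) {y₀ : Fin p → ℝ} (hy₀ : y₀ ∈ W) :
    ∃ g : Fin p → (Fin p → ℝ) → ℝ, (∀ i, ContDiff ℝ ∞ (g i)) ∧
      ∀ᶠ y in 𝓝 y₀, f y = f y₀ + ∑ i, (y i - y₀ i) * g i y := by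
  obtain ⟨χ, hχ, -, hsub, h1⟩ := exists_smooth_cutoff (hW.mem_nhds hy₀)
  obtain ⟨g, hg, hfg⟩ := hadamard_global (contDiff_smul_of_tsupport_subset hW hχ hsub hf) y₀
  refine ⟨g, hg, ?_⟩
  filter_upwards [h1] with y hy
  have h2 := h1.self_of_nhds
  simp only [Pi.one_apply] at hy h2
  simpa [hy, h2] using hfg y

end Cutoff

/-! ### Transport equations -/

section Transport

open Topology Set Filter

variable {E : Type u} [NormedAddCommGroup E] [NormedSpace ℝ E]
variable {F : Type u} [NormedAddCommGroup F] [NormedSpace ℝ F]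

theorem integralCurve_unique {v : E → E} {L : NNReal} (hL : LipschitzWith L v) {a b s₀ s : ℝ}
    {f g : ℝ → E} (hs₀ : s₀ ∈ Ioo a b) (hf : ∀ s ∈ Ioo a b, HasDerivAt f (v (f s)) s)
    (hg : ∀ s ∈ Ioo a b, HasDerivAt g (v (g s)) s) (h : f s₀ = g s₀) (hs : s ∈ Ioo a b) :
    f s = g s :=
  ODE_solution_unique_of_mem_Ioo (v := fun _ => v) (s := fun _ => univ) (K := L)
    (fun _ _ => hL.lipschitzOnWith) hs₀ (fun t ht => ⟨hf t ht, trivial⟩)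
    (fun t ht => ⟨hg t ht, trivial⟩) h hs

/-- The functional `ℓ` serves as a clock along the flow: it tells how long an integral curve needs
to reach a given level. -/
theorem hasDerivAt_clm_unit_speed {v : E → E} {ℓ : E →L[ℝ] ℝ} (hℓ : ∀ y, ℓ (v y) = 1) {a b s₀ s : ℝ}
    {f : ℝ → E} (hs₀ : s₀ ∈ Ioo a b) (hf : ∀ s ∈ Ioo a b, HasDerivAt f (v (f s)) s)
    (hs : s ∈ Ioo a b) : ℓ (f s) = ℓ (f s₀) + (s - s₀) := by
  refine integralCurve_unique (v := fun _ : ℝ => (1 : ℝ)) (L := 0) (LipschitzWith.const 1)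
    (f := fun s => ℓ (f s)) (g := fun s => ℓ (f s₀) + (s - s₀)) hs₀ (fun s hs => ?_)
    (fun s _ => ?_) (by simp) hs
  · have := ℓ.hasFDerivAt.comp_hasDerivAt s (hf s hs)
    rwa [hℓ] at this
  · simpa using ((hasDerivAt_id s).sub_const s₀).const_add (ℓ (f s₀))

theorem flow_add {v : E → E} {L : NNReal} (hL : LipschitzWith L v) {ε : ℝ} {ρ : ℝ → E → E}
    (h0 : ∀ x, ρ 0 x = x) (hρ : ∀ x, ∀ s ∈ Ioo (-ε) ε, HasDerivAt (fun s => ρ s x) (v (ρ s x)) s)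
    {a b : ℝ} (ha : a ∈ Ioo (-ε) ε) (hb : b ∈ Ioo (-ε) ε) (hab : a + b ∈ Ioo (-ε) ε) (x : E) :
    ρ b (ρ a x) = ρ (a + b) x := by
  have hε : 0 < ε := by linarith [ha.1, ha.2]
  -- The interval of comparison consists of the `s` for which both `s` and `a + s` lie in `(-ε, ε)`.
  refine integralCurve_unique hL (a := max (-ε) (-ε - a)) (b := min ε (ε - a)) (s₀ := 0)
    (f := fun s => ρ s (ρ a x)) (g := fun s => ρ (a + s) x) ?_ ?_ ?_ (by simp [h0]) ?_
  · simp only [mem_Ioo, max_lt_iff, lt_min_iff] at *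
    refine ⟨⟨?_, ?_⟩, ?_, ?_⟩ <;> linarith
  · intro s hs
    simp only [mem_Ioo, max_lt_iff, lt_min_iff] at hs
    exact hρ _ s ⟨hs.1.1, hs.2.1⟩
  · intro s hs
    simp only [mem_Ioo, max_lt_iff, lt_min_iff] at hs
    have hd := hρ x (a + s) ⟨by linarith, by linarith⟩
    simpa using hd.comp_const_add a s
  · simp only [mem_Ioo, max_lt_iff, lt_min_iff] at *
    refine ⟨⟨?_, ?_⟩, ?_, ?_⟩ <;> linarith

/-- Method of characteristics for the field `(v, w)` on `E × F`. As `ℓ` grows at unit speed along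
`v`, flowing back from `x` for the time `ℓ x - ℓ x₀` reaches the initial hyperplane at a point `y`;
flowing `(y, 0)` forward for the same time ends at `(x, g x)`. -/
theorem exists_transport_global [CompleteSpace E] [CompleteSpace F] {v : E → E} {w : E × F → F}
    (hv : ContDiff ℝ ∞ v) (hw : ContDiff ℝ ∞ w) {Lv Lw : NNReal} (hLv : LipschitzWith Lv v)
    (hLw : LipschitzWith Lw w) {ℓ : E →L[ℝ] ℝ} (hℓ : ∀ y, ℓ (v y) = 1) (x₀ : E) :
    ∃ ε > 0, ∃ g : E → F, ContDiffOn ℝ ∞ g {x | |ℓ x - ℓ x₀| < ε} ∧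
      (∀ x, ℓ x = ℓ x₀ → g x = 0) ∧
      ∀ x, |ℓ x - ℓ x₀| < ε → fderiv ℝ g x (v x) = w (x, g x) := by
  have hV : ContDiff ℝ ∞ (fun z : E × F => (v z.1, w z)) := (hv.comp contDiff_fst).prodMk hw
  have hVL : LipschitzWith (max (Lv * 1) Lw) (fun z : E × F => (v z.1, w z)) :=
    (hLv.comp LipschitzWith.prod_fst).prodMk hLw
  obtain ⟨ε, hε, Φ, hΦ, hΦ0, hΦd⟩ := exists_smooth_flow hV hVL
  set τ : E → ℝ := fun x => ℓ x - ℓ x₀ with hτ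
  set ρ : ℝ → E → E := fun s x => (Φ (s, (x, 0))).1 with hρ
  have hρ0 : ∀ x, ρ 0 x = x := fun x => by rw [hρ]; simp [hΦ0]
  have hρd : ∀ x, ∀ s ∈ Ioo (-ε) ε, HasDerivAt (fun s => ρ s x) (v (ρ s x)) s := fun x s hs =>
    (hΦd (x, 0) s hs).fst
  have h0 : (0 : ℝ) ∈ Ioo (-ε) ε := by simpa using hε
  have hopen : IsOpen {x | |ℓ x - ℓ x₀| < ε} :=
    isOpen_lt (by fun_prop) continuous_const
  have hneg : ∀ x, |τ x| < ε → -τ x ∈ Ioo (-ε) ε := fun x hx => by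
    rw [mem_Ioo, ← abs_lt, abs_neg]; exact hx
  have hpos : ∀ x, |τ x| < ε → τ x ∈ Ioo (-ε) ε := fun x hx => abs_lt.1 hx
  set g : E → F := fun x => (Φ (τ x, (ρ (-τ x) x, 0))).2 with hg
  have hgs : ContDiffOn ℝ ∞ g {x | |ℓ x - ℓ x₀| < ε} := by
    have hτs : ContDiff ℝ ∞ τ := by fun_prop
    have h1 : ContDiffOn ℝ ∞ (fun x => ρ (-τ x) x) {x | |ℓ x - ℓ x₀| < ε} := by
      refine contDiff_fst.comp_contDiffOn (hΦ.comp (f := fun x => (-τ x, (x, (0 : F)))) ?_ ?_)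
      · exact (hτs.neg.prodMk (contDiff_id.prodMk contDiff_const)).contDiffOn
      · exact fun x hx => ⟨hneg x hx, trivial⟩
    refine contDiff_snd.comp_contDiffOn (hΦ.comp
      (f := fun x => (τ x, (ρ (-τ x) x, (0 : F)))) ?_ ?_)
    · exact hτs.contDiffOn.prodMk (h1.prodMk contDiffOn_const)
    · exact fun x hx => ⟨hpos x hx, trivial⟩
  refine ⟨ε, hε, g, hgs, fun x hx => ?_, fun x hx => ?_⟩
  · have : τ x = 0 := by simp [hτ, hx]
    rw [hg]
    simp [this, hΦ0]
  · have hgd : DifferentiableAt ℝ g x :=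
      (hgs.contDiffAt (hopen.mem_nhds hx)).differentiableAt (by simp)
    have hcurve : HasDerivAt (fun s => g (ρ s x)) (fderiv ℝ g x (v x)) 0 := by
      have h1 := hρd x 0 h0
      have h2 : HasFDerivAt g (fderiv ℝ g x) (ρ 0 x) := by rw [hρ0]; exact hgd.hasFDerivAt
      have := h2.comp_hasDerivAt 0 h1
      rwa [hρ0] at this
    set y := ρ (-τ x) x with hy
    -- The same derivative, computed along the characteristic that starts at `(y, 0)`. The two
    -- curves coincide near `s = 0`, because all points `ρ s x` of the characteristic have the same
    -- foot `y`.
    have hother : HasDerivAt (fun s => (Φ (τ x + s, (y, 0))).2) (w (Φ (τ x, (y, 0)))) 0 := by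
      have h1 := (hΦd (y, 0) (τ x) (hpos x hx)).snd
      have h2 : HasDerivAt (fun s => (Φ (s, (y, 0))).2) (w (Φ (τ x, (y, 0)))) (τ x + 0) := by
        rw [add_zero]; exact h1
      exact h2.comp_const_add (τ x) 0
    have hx' : (Φ (τ x, (y, 0))).1 = x := by
      change ρ (τ x) (ρ (-τ x) x) = x
      rw [flow_add hLv hρ0 hρd (hneg x hx) (hpos x hx) (by simpa using h0)]
      simp [hρ0]
    have hpair : Φ (τ x, (y, 0)) = (x, g x) := Prod.ext hx' rfl
    rw [hpair] at hother
    refine (hcurve.congr_of_eventuallyEq ?_).unique hother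
    have hnear : ∀ᶠ s : ℝ in 𝓝 0, s ∈ Ioo (-ε) ε ∧ τ x + s ∈ Ioo (-ε) ε := by
      refine Filter.Eventually.and (isOpen_Ioo.mem_nhds h0) ?_
      have hc : ContinuousAt (fun s : ℝ => τ x + s) 0 := by fun_prop
      exact hc.eventually (isOpen_Ioo.mem_nhds (by simpa using hpos x hx))
    filter_upwards [hnear] with s hs
    have h1 : τ (ρ s x) = τ x + s := by
      have := hasDerivAt_clm_unit_speed hℓ h0 (hρd x) hs.1
      simp only [hτ, this, hρ0]
      ring
    rw [hg]
    simp only [h1]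
    rw [flow_add hLv hρ0 hρd hs.1 (by rw [mem_Ioo, ← abs_lt, abs_neg]; exact abs_lt.2 hs.2)
      (by simpa using hneg x hx)]
    rw [hy]
    congr 5
    ring

/-- The flow theorem requires globally Lipschitz fields; these are obtained because a smooth
function with compact support is Lipschitz. -/
theorem exists_cutoff_data [FiniteDimensional ℝ E] [FiniteDimensional ℝ F] {W : Set E}
    (hW : IsOpen W) {x₀ : E} (hx₀ : x₀ ∈ W) {v : E → E} (hv : ContDiffOn ℝ ∞ v W) {w : E × F → F}
    (hw : ContDiffOn ℝ ∞ w (W ×ˢ univ)) {ℓ : E →L[ℝ] ℝ} (hℓ : ∀ y ∈ W, ℓ (v y) = 1) :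
    ∃ (v' : E → E) (w' : E × F → F) (Lv Lw : NNReal), ContDiff ℝ ∞ v' ∧ ContDiff ℝ ∞ w' ∧
      LipschitzWith Lv v' ∧ LipschitzWith Lw w' ∧ (∀ y, ℓ (v' y) = 1) ∧ v' =ᶠ[𝓝 x₀] v ∧
      w' =ᶠ[𝓝 (x₀, 0)] w ∧ ∀ z, w z = 0 → w' z = 0 := by
  obtain ⟨χ, hχ, hχc, hsub, h1⟩ := exists_smooth_cutoff (hW.mem_nhds hx₀)
  have hWF : IsOpen (W ×ˢ (univ : Set F)) := hW.prod isOpen_univ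
  obtain ⟨κ, hκ, hκc, hκsub, hκ1⟩ :=
    exists_smooth_cutoff (hWF.mem_nhds (show (x₀, (0 : F)) ∈ W ×ˢ univ from ⟨hx₀, trivial⟩))
  have hs1 := contDiff_smul_of_tsupport_subset hW hχ hsub (hv.sub (contDiffOn_const (c := v x₀)))
  have hs2 := contDiff_smul_of_tsupport_subset hWF hκ hκsub hw
  obtain ⟨L1, hL1⟩ := (hs1.of_le (by exact_mod_cast le_top : (1 : WithTop ℕ∞) ≤ ∞)).lipschitzWith_of_hasCompactSupport
    (hχc.smul_right) (by simp)
  obtain ⟨L2, hL2⟩ := (hs2.of_le (by exact_mod_cast le_top : (1 : WithTop ℕ∞) ≤ ∞)).lipschitzWith_of_hasCompactSupport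
    (hκc.smul_right) (by simp)
  -- The cutoff interpolates to the constant `v x₀` instead of zero, since `ℓ` has to take the value
  -- 1 on the field everywhere. Scaling `w` by `κ` preserves its zeros.
  refine ⟨fun y => v x₀ + χ y • (v y - v x₀), fun z => κ z • w z, 0 + L1, L2,
    contDiff_const.add hs1, hs2, (LipschitzWith.const _).add hL1, hL2, fun y => ?_, ?_, ?_, ?_⟩
  · by_cases hy : y ∈ W
    · simp [hℓ y hy, hℓ x₀ hx₀]
    · have : χ y = 0 := image_eq_zero_of_notMem_tsupport fun h => hy (hsub h)
      simp [this, hℓ x₀ hx₀]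
  · filter_upwards [h1] with y hy
    simp only [Pi.one_apply] at hy
    simp [hy]
  · filter_upwards [hκ1] with z hz
    simp only [Pi.one_apply] at hz
    simp [hz]
  · intro z hz
    simp [hz]

/-- Local solvability of the transport equation `Dg · v = w(·, g)` with zero data on a
transversal affine hyperplane. -/
theorem exists_transport [FiniteDimensional ℝ E] [FiniteDimensional ℝ F] {W : Set E}
    (hW : IsOpen W) {x₀ : E} (hx₀ : x₀ ∈ W) {v : E → E} (hv : ContDiffOn ℝ ∞ v W) {w : E × F → F}
    (hw : ContDiffOn ℝ ∞ w (W ×ˢ univ)) {ℓ : E →L[ℝ] ℝ} (hℓ : ∀ y ∈ W, ℓ (v y) = 1) :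
    ∃ W' ⊆ W, IsOpen W' ∧ x₀ ∈ W' ∧ ∃ g : E → F, ContDiffOn ℝ ∞ g W' ∧
      (∀ x ∈ W', ℓ x = ℓ x₀ → g x = 0) ∧ ∀ x ∈ W', fderiv ℝ g x (v x) = w (x, g x) := by
  have := FiniteDimensional.complete ℝ E
  have := FiniteDimensional.complete ℝ F
  obtain ⟨v', w', Lv, Lw, hv', hw', hLv, hLw, hℓ', hvv, hww, -⟩ :=
    exists_cutoff_data hW hx₀ hv hw hℓ
  obtain ⟨ε, hε, g, hg, hg0, hgd⟩ := exists_transport_global hv' hw' hLv hLw hℓ' x₀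
  have hopen : IsOpen {x | |ℓ x - ℓ x₀| < ε} := isOpen_lt (by fun_prop) continuous_const
  have hmem : x₀ ∈ {x | |ℓ x - ℓ x₀| < ε} := by simpa using hε
  have hcont : ContinuousAt (fun x => (x, g x)) x₀ :=
    continuousAt_id.prodMk (hg.contDiffAt (hopen.mem_nhds hmem)).continuousAt
  -- As `g` vanishes at `x₀`, its graph stays close to `(x₀, 0)`, where the cutoff has not altered
  -- `w`.
  have hww' : ∀ᶠ x in 𝓝 x₀, w' (x, g x) = w (x, g x) :=
    hcont.tendsto.eventually (p := fun z => w' z = w z) (by simp only [hg0 x₀ rfl]; exact hww)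
  obtain ⟨W', hW'sub, hW'o, hxW'⟩ := eventually_nhds_iff.1
    ((Filter.Eventually.and (hopen.mem_nhds hmem) (hW.mem_nhds hx₀)).and (hvv.and hww'))
  refine ⟨W', fun x hx => (hW'sub x hx).1.2, hW'o, hxW', g,
    hg.mono fun x hx => (hW'sub x hx).1.1, fun x _ h => hg0 x h, fun x hx => ?_⟩
  obtain ⟨⟨h1, -⟩, h2, h3⟩ := hW'sub x hx
  rw [← h2, ← h3]
  exact hgd x h1

/-- Along an integral curve `ρ` of the field, `(ρ, g ∘ ρ)` and `(ρ, 0)` solve the same ordinary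
differential equation and agree where the curve meets the hyperplane; hence they also agree at time
zero. -/
theorem transport_unique [FiniteDimensional ℝ E] [FiniteDimensional ℝ F] {W : Set E}
    (hW : IsOpen W) {x₀ : E} (hx₀ : x₀ ∈ W) {v : E → E} (hv : ContDiffOn ℝ ∞ v W) {w : E × F → F}
    (hw : ContDiffOn ℝ ∞ w (W ×ˢ univ)) {ℓ : E →L[ℝ] ℝ} (hℓ : ∀ y ∈ W, ℓ (v y) = 1)
    (hw0 : ∀ y, w (y, 0) = 0) {g : E → F} (hg : DifferentiableOn ℝ g W)
    (hg0 : ∀ x ∈ W, ℓ x = ℓ x₀ → g x = 0) (hgd : ∀ x ∈ W, fderiv ℝ g x (v x) = w (x, g x)) :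
    ∀ᶠ x in 𝓝 x₀, g x = 0 := by
  have := FiniteDimensional.complete ℝ E
  have := FiniteDimensional.complete ℝ F
  obtain ⟨v', w', Lv, Lw, hv', hw', hLv, hLw, hℓ', hvv, hww, hw'0⟩ :=
    exists_cutoff_data hW hx₀ hv hw hℓ
  obtain ⟨ε, hε, ρ, hρ, hρ0, hρd⟩ := exists_smooth_flow hv' hLv
  have hVL : LipschitzWith (max (Lv * 1) Lw) (fun z : E × F => (v' z.1, w' z)) :=
    (hLv.comp LipschitzWith.prod_fst).prodMk hLw
  have hcont : ContinuousAt (fun x => (x, g x)) x₀ :=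
    continuousAt_id.prodMk (hg.continuousOn.continuousAt (hW.mem_nhds hx₀))
  have hww' : ∀ᶠ x in 𝓝 x₀, w' (x, g x) = w (x, g x) :=
    hcont.tendsto.eventually (p := fun z => w' z = w z) (by simp only [hg0 x₀ hx₀ rfl]; exact hww)
  have hgood : ∀ᶠ x in 𝓝 x₀, x ∈ W ∧ v' x = v x ∧ w' (x, g x) = w (x, g x) :=
    Filter.Eventually.and (hW.mem_nhds hx₀) (hvv.and hww')
  have hρc : ContinuousAt ρ (0, x₀) :=
    (hρ.contDiffAt ((isOpen_Ioo.prod isOpen_univ).mem_nhds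
      (show ((0 : ℝ), x₀) ∈ Ioo (-ε) ε ×ˢ univ from ⟨by simpa using hε, trivial⟩))).continuousAt
  have hnear : ∀ᶠ z : ℝ × E in 𝓝 (0, x₀), ρ z ∈ W ∧ v' (ρ z) = v (ρ z) ∧
      w' (ρ z, g (ρ z)) = w (ρ z, g (ρ z)) :=
    hρc.tendsto.eventually
      (p := fun y => y ∈ W ∧ v' y = v y ∧ w' (y, g y) = w (y, g y)) (by rw [hρ0]; exact hgood)
  rw [nhds_prod_eq] at hnear
  obtain ⟨pa, hpa, pb, hpb, hprod⟩ := eventually_prod_iff.1 hnear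
  obtain ⟨δ, hδ, hball⟩ := Metric.eventually_nhds_iff_ball.1 hpa
  set η := min δ ε with hη
  have hη0 : 0 < η := lt_min hδ hε
  have hτ : ∀ᶠ x in 𝓝 x₀, |ℓ x - ℓ x₀| < η := by
    have hc : ContinuousAt (fun x => |ℓ x - ℓ x₀|) x₀ := by fun_prop
    exact hc.eventually (gt_mem_nhds (by simpa using hη0))
  filter_upwards [hpb, hτ] with x hx hxτ
  have hsub : ∀ s ∈ Ioo (-η) η, s ∈ Ioo (-ε) ε := fun s hs =>
    ⟨by linarith [hs.1, min_le_right δ ε], by linarith [hs.2, min_le_right δ ε]⟩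
  have hin : ∀ s ∈ Ioo (-η) η, ρ (s, x) ∈ W ∧ v' (ρ (s, x)) = v (ρ (s, x)) ∧
      w' (ρ (s, x), g (ρ (s, x))) = w (ρ (s, x), g (ρ (s, x))) := fun s hs =>
    hprod (hball s (by
      rw [Metric.mem_ball, Real.dist_eq, sub_zero]
      exact (abs_lt.2 hs).trans_le (min_le_left _ _))) hx
  have h0 : (0 : ℝ) ∈ Ioo (-η) η := by simpa using hη0
  -- This is the time at which the integral curve through `x` crosses the hyperplane. For times
  -- below `η` the curve stays where `v'` and `w'` agree with the original data.
  have hs₀ : -(ℓ x - ℓ x₀) ∈ Ioo (-η) η := by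
    rw [mem_Ioo, ← abs_lt, abs_neg]; exact hxτ
  have hflow : ∀ s ∈ Ioo (-η) η, HasDerivAt (fun s => ρ (s, x)) (v' (ρ (s, x))) s := fun s hs =>
    hρd x s (hsub s hs)
  have hkey := integralCurve_unique hVL (f := fun s => (ρ (s, x), g (ρ (s, x))))
    (g := fun s => (ρ (s, x), (0 : F))) hs₀ (fun s hs => ?_) (fun s hs => ?_) ?_ h0
  · have := congrArg Prod.snd hkey
    simpa [hρ0] using this
  · obtain ⟨i1, i2, i3⟩ := hin s hs
    refine (hflow s hs).prodMk ?_
    have h2 := (hg.differentiableAt (hW.mem_nhds i1)).hasFDerivAt.comp_hasDerivAt s (hflow s hs)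
    rw [i2, hgd _ i1, ← i3] at h2
    exact h2
  · simp only
    rw [hw'0 _ (hw0 _)]
    exact (hflow s hs).prodMk (hasDerivAt_const _ _)
  · have h1 := hasDerivAt_clm_unit_speed hℓ' h0 hflow hs₀
    rw [hρ0] at h1
    simp only [Prod.mk.injEq, true_and]
    exact hg0 _ (hin _ hs₀).1 (by rw [h1]; ring)

end Transport

/-! ### Smooth functions and their extensions by zero -/

namespace smoothFun

variable {p : ℕ} {W W' : Opens (Fin p → ℝ)}

/-- The extension by zero of a smooth function. -/
noncomputable def ext0 (f : smoothFun W) : (Fin p → ℝ) → ℝ := Function.extend Subtype.val f.1 0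

theorem ext0_apply (f : smoothFun W) {y : Fin p → ℝ} (hy : y ∈ W) : ext0 f y = f.1 ⟨y, hy⟩ :=
  Subtype.val_injective.extend_apply f.1 (0 : (Fin p → ℝ) → ℝ) (⟨y, hy⟩ : W)

theorem contDiffOn_ext0 (f : smoothFun W) : ContDiffOn ℝ ∞ (ext0 f) W := f.2

theorem ext_of_ext0 {f g : smoothFun W} (h : ∀ y ∈ W, ext0 f y = ext0 g y) : f = g := by
  refine Subtype.ext (funext fun y => ?_)
  have := h y.1 y.2
  rwa [ext0_apply f y.2, ext0_apply g y.2] at this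

/-- The restriction to `W` of a function which is smooth on `W`. -/
def ofFun (g : (Fin p → ℝ) → ℝ) (hg : ContDiffOn ℝ ∞ g W) : smoothFun W :=
  ⟨fun y => g y, hg.congr fun y hy =>
    Subtype.val_injective.extend_apply _ (0 : (Fin p → ℝ) → ℝ) (⟨y, hy⟩ : W)⟩

theorem ext0_ofFun {g : (Fin p → ℝ) → ℝ} (hg : ContDiffOn ℝ ∞ g W) {y : Fin p → ℝ} (hy : y ∈ W) :
    ext0 (ofFun g hg) y = g y := ext0_apply _ hy

theorem ext0_add (f g : smoothFun W) {y : Fin p → ℝ} (hy : y ∈ W) :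
    ext0 (f + g) y = ext0 f y + ext0 g y := by
  simp only [ext0_apply _ hy]; rfl

theorem ext0_mul (f g : smoothFun W) {y : Fin p → ℝ} (hy : y ∈ W) :
    ext0 (f * g) y = ext0 f y * ext0 g y := by
  simp only [ext0_apply _ hy]; rfl

theorem ext0_smul (a : ℝ) (f : smoothFun W) {y : Fin p → ℝ} (hy : y ∈ W) :
    ext0 (a • f) y = a * ext0 f y := by
  simp only [ext0_apply _ hy]; rfl

theorem ext0_zero (y : Fin p → ℝ) : ext0 (0 : smoothFun W) y = 0 := by
  by_cases hy : y ∈ W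
  · rw [ext0_apply _ hy]; rfl
  · exact Function.extend_apply' _ _ _ (by rintro ⟨a, rfl⟩; exact hy a.2)

theorem ext0_one {y : Fin p → ℝ} (hy : y ∈ W) : ext0 (1 : smoothFun W) y = 1 := by
  rw [ext0_apply _ hy]; rfl

theorem ext0_res (h : W' ≤ W) (f : smoothFun W) {y : Fin p → ℝ} (hy : y ∈ W') :
    ext0 (smoothFun.res h f) y = ext0 f y := by
  rw [ext0_apply _ hy, ext0_apply _ (h hy)]; rfl

/-- Evaluation at a point. -/
def evalHom (y : W) : smoothFun W →+* ℝ :=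
  (Pi.evalRingHom (fun _ : W => ℝ) y).comp (smoothFun W).toSubring.subtype

theorem evalHom_apply (y : W) (f : smoothFun W) : evalHom y f = ext0 f y := by
  rw [ext0_apply _ y.2]; rfl

theorem isUnit_of_ne_zero (f : smoothFun W) (h : ∀ y ∈ W, ext0 f y ≠ 0) : IsUnit f := by
  refine IsUnit.of_mul_eq_one (ofFun (fun y => (ext0 f y)⁻¹) ((contDiffOn_ext0 f).inv h)) ?_
  refine ext_of_ext0 fun y hy => ?_
  rw [ext0_mul _ _ hy, ext0_ofFun _ hy, ext0_one hy, mul_inv_cancel₀ (h y hy)]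

end smoothFun

/-! ### Restriction, parity and supercommutativity of sections -/

namespace SuperRingedSpace

section Basic

variable {M : SuperRingedSpace.{u}} {U V W : Opens M.carrier}

theorem res_res (h : V ≤ U) (h' : W ≤ V) (f : M.Sec U) :
    M.res h' (M.res h f) = M.res (h'.trans h) f := by
  have := M.sheaf.presheaf.map_comp (homOfLE h).op (homOfLE h').op
  exact (congrArg (fun g => g.hom f) this).symm

theorem res_self (h : U ≤ U) (f : M.Sec U) : M.res h f = f := by
  have := M.sheaf.presheaf.map_id (op U)
  exact congrArg (fun g => g.hom f) this

theorem res_mem_parity (h : V ≤ U) {d : ZMod 2} {f : M.Sec U} (hf : f ∈ M.parity U d) :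
    M.res h f ∈ M.parity V d := M.parity_map (homOfLE h) d f hf

theorem mul_mem_parity {d e : ZMod 2} {f g : M.Sec U} (hf : f ∈ M.parity U d)
    (hg : g ∈ M.parity U e) : f * g ∈ M.parity U (d + e) :=
  (M.parity_graded U).mul_mem hf hg

theorem one_mem_parity : (1 : M.Sec U) ∈ M.parity U 0 := (M.parity_graded U).one_mem

theorem exists_parity_add (f : M.Sec U) :
    ∃ f₀ ∈ M.parity U 0, ∃ f₁ ∈ M.parity U 1, f = f₀ + f₁ := by
  classical
  obtain ⟨g, hg⟩ := (M.parity_internal U).2 f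
  refine ⟨g 0, (g 0).2, g 1, (g 1).2, ?_⟩
  rw [← hg, DirectSum.coeAddMonoidHom_eq_dfinsuppSum,
    DFinsupp.sum_eq_sum_fintype _ (fun _ => rfl)]
  exact Fin.sum_univ_two (fun i : Fin 2 => ((g i : M.parity U i) : M.Sec U))

theorem eq_zero_of_mem_parity {f : M.Sec U} (h₀ : f ∈ M.parity U 0) (h₁ : f ∈ M.parity U 1) :
    f = 0 := by
  have h := (M.parity_internal U).submodule_iSupIndep.pairwiseDisjoint
    (show (0 : ZMod 2) ≠ 1 by decide)
  exact Submodule.disjoint_def.1 h f h₀ h₁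

theorem superSign_zero_left (e : ZMod 2) : superSign 0 e = 1 := by
  simp [superSign]

theorem superSign_zero_right (d : ZMod 2) : superSign d 0 = 1 := by
  simp [superSign]

theorem superSign_one_one : superSign 1 1 = -1 := by simp [superSign]

theorem even_mul_comm {f : M.Sec U} (hf : f ∈ M.parity U 0) (g : M.Sec U) : f * g = g * f := by
  obtain ⟨g₀, h₀, g₁, h₁, rfl⟩ := exists_parity_add g
  rw [mul_add, add_mul, M.supercomm U 0 0 f hf g₀ h₀, M.supercomm U 0 1 f hf g₁ h₁]
  simp [superSign_zero_left]

theorem odd_mul_comm {f g : M.Sec U} (hf : f ∈ M.parity U 1) (hg : g ∈ M.parity U 1) :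
    f * g = -(g * f) := by
  rw [M.supercomm U 1 1 f hf g hg, superSign_one_one, neg_one_smul]

theorem odd_mul_self {f : M.Sec U} (hf : f ∈ M.parity U 1) : f * f = 0 := by
  have h : (2 : ℝ) • (f * f) = 0 := by
    rw [two_smul]
    nth_rewrite 1 [odd_mul_comm hf hf]
    exact neg_add_cancel _
  exact (smul_eq_zero.1 h).resolve_left two_ne_zero

end Basic

/-! ### Expansion of sections in a chart -/

namespace Chart

variable {M : SuperRingedSpace.{u}} {p q : ℕ} (c : M.Chart p q) {U V : Opens M.carrier}

/-- The image in `ℝ^p` of (the part in the domain of) an open set. -/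
def img (U : Opens M.carrier) : Opens (Fin p → ℝ) :=
  ⟨c.φ.target ∩ c.φ.symm ⁻¹' U, c.φ.isOpen_inter_preimage_symm U.2⟩

theorem img_subset_target (U : Opens M.carrier) : (c.img U : Set (Fin p → ℝ)) ⊆ c.φ.target :=
  fun _ hy => hy.1

theorem img_mono (h : V ≤ U) : c.img V ≤ c.img U := fun _ hy => ⟨hy.1, h hy.2⟩

theorem mem_img {x : M.carrier} (hx : x ∈ c.domain) (hxU : x ∈ U) : c.φ x ∈ c.img U :=
  ⟨c.φ.map_source hx, by simpa [c.φ.left_inv hx] using hxU⟩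

theorem preimage_img_le (U : Opens M.carrier) : chartPreimage c.φ (c.img U) ≤ U := by
  rintro x ⟨hx, -, hx'⟩
  simpa [c.φ.left_inv hx] using hx'

theorem le_preimage_img (hU : U ≤ c.domain) : U ≤ chartPreimage c.φ (c.img U) :=
  fun _ hx => ⟨hU hx, c.mem_img (hU hx) hx⟩

/-- Pullback of smooth functions from the image of an open subset of the domain. -/
noncomputable def pullTo (hU : U ≤ c.domain) : smoothFun (c.img U) →ₐ[ℝ] M.Sec U :=
  (M.res (c.le_preimage_img hU)).comp (c.pull (c.img U))

/-- The odd coordinates. -/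
def thetaDom (j : Fin q) : M.Sec c.domain := c.θ j

/-- The product of a list of odd coordinates on an open subset of the domain. -/
noncomputable def thetaProd (hU : U ≤ c.domain) (L : List (Fin q)) : M.Sec U :=
  M.res hU (L.map c.thetaDom).prod

theorem domain_preimage_le (W : Opens (Fin p → ℝ)) : chartPreimage c.φ W ≤ c.domain :=
  chartPreimage_le c.φ W

/-- `(f_I) ↦ ∑ f_I θ^I` as a linear map. -/
noncomputable def assemble (W : Opens (Fin p → ℝ)) :
    (Finset (Fin q) → smoothFun W) →ₗ[ℝ] M.Sec (chartPreimage c.φ W) where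
  toFun f := ∑ I : Finset (Fin q), c.pull W (f I) * c.thetaProd (c.domain_preimage_le W) I.sort
  map_add' f g := by simp [add_mul, Finset.sum_add_distrib]
  map_smul' a f := by simp [Finset.smul_sum]

/-- The coefficients `f_I` of a section. -/
noncomputable def coef (U : Opens M.carrier) :
    M.Sec U →ₗ[ℝ] (Finset (Fin q) → smoothFun (c.img U)) :=
  (LinearEquiv.ofBijective (c.assemble (c.img U))
    (c.bijective _ (c.img_subset_target U))).symm.toLinearMap ∘ₗ
      (M.res (c.preimage_img_le U)).toLinearMap

theorem assemble_coef (f : M.Sec U) :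
    c.assemble (c.img U) (c.coef U f) = M.res (c.preimage_img_le U) f :=
  (LinearEquiv.ofBijective (c.assemble (c.img U))
    (c.bijective _ (c.img_subset_target U))).apply_symm_apply _

theorem assemble_injective (U : Opens M.carrier) : Function.Injective (c.assemble (c.img U)) :=
  (c.bijective _ (c.img_subset_target U)).1

theorem res_pullTo (h : V ≤ U) (hU : U ≤ c.domain) (f : smoothFun (c.img U)) :
    M.res h (c.pullTo hU f) = c.pullTo (h.trans hU) (smoothFun.res (c.img_mono h) f) := by
  simp only [pullTo, AlgHom.comp_apply, res_res]
  rw [← c.pull_res (c.img_mono h), res_res]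

theorem res_thetaProd (h : V ≤ U) (hU : U ≤ c.domain) (L : List (Fin q)) :
    M.res h (c.thetaProd hU L) = c.thetaProd (h.trans hU) L := res_res _ _ _

theorem assemble_apply (W : Opens (Fin p → ℝ)) (f : Finset (Fin q) → smoothFun W) :
    c.assemble W f = ∑ I : Finset (Fin q),
      c.pull W (f I) * c.thetaProd (c.domain_preimage_le W) I.sort := rfl

theorem eq_sum (hU : U ≤ c.domain) (f : M.Sec U) :
    f = ∑ I, c.pullTo hU (c.coef U f I) * c.thetaProd hU I.sort := by
  have h := congrArg (M.res (c.le_preimage_img hU)) (c.assemble_coef f)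
  rw [res_res, res_self] at h
  refine h.symm.trans ?_
  rw [assemble_apply, map_sum]
  refine Finset.sum_congr rfl fun I _ => ?_
  rw [map_mul, res_thetaProd]
  rfl

theorem coef_sum (hU : U ≤ c.domain) (F : Finset (Fin q) → smoothFun (c.img U)) :
    c.coef U (∑ I, c.pullTo hU (F I) * c.thetaProd hU I.sort) = F := by
  apply c.assemble_injective U
  rw [assemble_coef, assemble_apply, map_sum]
  refine Finset.sum_congr rfl fun I _ => ?_
  rw [map_mul, res_thetaProd, pullTo, AlgHom.comp_apply, res_res, res_self]

theorem coef_res (h : V ≤ U) (f : M.Sec U) (I : Finset (Fin q)) :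
    c.coef V (M.res h f) I = smoothFun.res (c.img_mono h) (c.coef U f I) := by
  suffices c.coef V (M.res h f) = fun I => smoothFun.res (c.img_mono h) (c.coef U f I) from
    congrFun this I
  apply c.assemble_injective V
  rw [assemble_coef, res_res]
  have h2 := congrArg (M.res (chartPreimage_mono c.φ (c.img_mono h))) (c.assemble_coef f)
  rw [res_res] at h2
  rw [← h2, assemble_apply, assemble_apply, map_sum]
  refine Finset.sum_congr rfl fun I _ => ?_
  rw [map_mul, res_thetaProd, c.pull_res]

/-- The coefficient functions of a section, as functions on `ℝ^p`. -/
noncomputable def cf (f : M.Sec U) (I : Finset (Fin q)) : (Fin p → ℝ) → ℝ :=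
  smoothFun.ext0 (c.coef U f I)

theorem contDiffOn_cf (f : M.Sec U) (I : Finset (Fin q)) : ContDiffOn ℝ ∞ (c.cf f I) (c.img U) :=
  smoothFun.contDiffOn_ext0 (c.coef U f I)

theorem cf_add (f g : M.Sec U) (I : Finset (Fin q)) {y : Fin p → ℝ} (hy : y ∈ c.img U) :
    c.cf (f + g) I y = c.cf f I y + c.cf g I y := by
  rw [cf, map_add]; exact smoothFun.ext0_add _ _ hy

theorem cf_smul (a : ℝ) (f : M.Sec U) (I : Finset (Fin q)) {y : Fin p → ℝ} (hy : y ∈ c.img U) :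
    c.cf (a • f) I y = a * c.cf f I y := by
  rw [cf, map_smul]; exact smoothFun.ext0_smul _ _ hy

theorem cf_zero (I : Finset (Fin q)) (y : Fin p → ℝ) : c.cf (0 : M.Sec U) I y = 0 := by
  rw [cf, map_zero]; exact smoothFun.ext0_zero y

theorem cf_sub (f g : M.Sec U) (I : Finset (Fin q)) {y : Fin p → ℝ} (hy : y ∈ c.img U) :
    c.cf (f - g) I y = c.cf f I y - c.cf g I y := by
  have := c.cf_add (f - g) g I hy
  rw [sub_add_cancel] at this
  linarith

theorem cf_sum {ι : Type*} (s : Finset ι) (f : ι → M.Sec U) (I : Finset (Fin q))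
    {y : Fin p → ℝ} (hy : y ∈ c.img U) : c.cf (∑ i ∈ s, f i) I y = ∑ i ∈ s, c.cf (f i) I y := by
  classical
  induction s using Finset.induction_on with
  | empty => simp [cf_zero]
  | insert a s ha ih => rw [Finset.sum_insert ha, Finset.sum_insert ha, c.cf_add _ _ _ hy, ih]

theorem cf_res (h : V ≤ U) (f : M.Sec U) (I : Finset (Fin q)) {y : Fin p → ℝ} (hy : y ∈ c.img V) :
    c.cf (M.res h f) I y = c.cf f I y := by
  rw [cf, coef_res]; exact smoothFun.ext0_res _ _ hy

theorem ext_cf (hU : U ≤ c.domain) {f g : M.Sec U}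
    (h : ∀ I, ∀ y ∈ c.img U, c.cf f I y = c.cf g I y) : f = g := by
  rw [c.eq_sum hU f, c.eq_sum hU g]
  refine Finset.sum_congr rfl fun I _ => ?_
  rw [smoothFun.ext_of_ext0 (h I)]

/-- The section with prescribed coefficient functions. -/
noncomputable def ofCf (hU : U ≤ c.domain) (F : Finset (Fin q) → (Fin p → ℝ) → ℝ)
    (hF : ∀ I, ContDiffOn ℝ ∞ (F I) (c.img U)) : M.Sec U :=
  ∑ I : Finset (Fin q), c.pullTo hU (smoothFun.ofFun (F I) (hF I)) * c.thetaProd hU I.sort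

theorem cf_ofCf (hU : U ≤ c.domain) (F : Finset (Fin q) → (Fin p → ℝ) → ℝ)
    (hF : ∀ I, ContDiffOn ℝ ∞ (F I) (c.img U)) (I : Finset (Fin q)) {y : Fin p → ℝ}
    (hy : y ∈ c.img U) : c.cf (c.ofCf hU F hF) I y = F I y := by
  rw [cf, ofCf, c.coef_sum hU]; exact smoothFun.ext0_ofFun _ hy

theorem coef_monomial (hU : U ≤ c.domain) (g : smoothFun (c.img U)) (I J : Finset (Fin q)) :
    c.coef U (c.pullTo hU g * c.thetaProd hU I.sort) J = if I = J then g else 0 := by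
  classical
  have h := congrFun (c.coef_sum hU (Pi.single I g)) J
  rw [Finset.sum_eq_single I (fun K _ hK => by rw [Pi.single_eq_of_ne hK]; simp)
    (fun h => absurd (Finset.mem_univ I) h), Pi.single_eq_same] at h
  rw [h, Pi.single_apply]
  simp [eq_comm]

theorem thetaProd_nil (hU : U ≤ c.domain) : c.thetaProd hU [] = 1 := by
  rw [thetaProd, List.map_nil, List.prod_nil, map_one]

theorem thetaProd_append (hU : U ≤ c.domain) (L L' : List (Fin q)) :
    c.thetaProd hU (L ++ L') = c.thetaProd hU L * c.thetaProd hU L' := by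
  rw [thetaProd, List.map_append, List.prod_append, map_mul]; rfl

theorem thetaProd_cons (hU : U ≤ c.domain) (j : Fin q) (L : List (Fin q)) :
    c.thetaProd hU (j :: L) = c.thetaProd hU [j] * c.thetaProd hU L :=
  c.thetaProd_append hU [j] L

theorem pullTo_even (hU : U ≤ c.domain) (g : smoothFun (c.img U)) :
    c.pullTo hU g ∈ M.parity U 0 := res_mem_parity _ (c.pull_even _ _)

theorem thetaProd_mem_parity (hU : U ≤ c.domain) (L : List (Fin q)) :
    c.thetaProd hU L ∈ M.parity U (L.length : ZMod 2) := by
  refine res_mem_parity _ ?_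
  induction L with
  | nil =>
    rw [List.map_nil, List.prod_nil, List.length_nil, Nat.cast_zero]
    exact one_mem_parity
  | cons j L ih =>
    rw [List.map_cons, List.prod_cons, List.length_cons, Nat.cast_succ, add_comm]
    exact mul_mem_parity (c.θ_odd j) ih

theorem thetaProd_perm (hU : U ≤ c.domain) {L L' : List (Fin q)} (h : L.Perm L') :
    ∃ ε : ℝ, (ε = 1 ∨ ε = -1) ∧ c.thetaProd hU L = ε • c.thetaProd hU L' := by
  induction h with
  | nil => exact ⟨1, Or.inl rfl, by simp⟩
  | @cons j l₁ l₂ _ ih =>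
    obtain ⟨ε, hε, h⟩ := ih
    exact ⟨ε, hε, by rw [c.thetaProd_cons, h, c.thetaProd_cons hU j l₂, mul_smul_comm]⟩
  | swap j k L =>
    refine ⟨-1, Or.inr rfl, ?_⟩
    have hk : c.thetaProd hU [k] ∈ M.parity U 1 := by
      simpa using c.thetaProd_mem_parity hU [k]
    have hj : c.thetaProd hU [j] ∈ M.parity U 1 := by
      simpa using c.thetaProd_mem_parity hU [j]
    rw [c.thetaProd_cons hU k (j :: L), c.thetaProd_cons hU j L, c.thetaProd_cons hU j (k :: L),
      c.thetaProd_cons hU k L, ← mul_assoc, ← mul_assoc, odd_mul_comm hk hj, neg_mul,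
      neg_one_smul]
  | trans _ _ ih ih' =>
    obtain ⟨ε, hε, h⟩ := ih
    obtain ⟨δ, hδ, h'⟩ := ih'
    refine ⟨ε * δ, ?_, by rw [h, h', smul_smul]⟩
    rcases hε with rfl | rfl <;> rcases hδ with rfl | rfl <;> simp

/-- Up to sign, two copies of a repeated index can be moved to the front, and an odd element has
square zero. -/
theorem thetaProd_eq_zero (hU : U ≤ c.domain) {L : List (Fin q)} (h : ¬ L.Nodup) :
    c.thetaProd hU L = 0 := by
  obtain ⟨j, hj⟩ := List.exists_duplicate_iff_not_nodup.2 h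
  obtain ⟨L', hL'⟩ := (List.duplicate_iff_sublist.1 hj).exists_perm_append
  obtain ⟨ε, -, h⟩ := c.thetaProd_perm hU hL'
  have h2 : c.thetaProd hU [j, j] = 0 := by
    rw [c.thetaProd_cons]
    exact odd_mul_self (by simpa using c.thetaProd_mem_parity hU [j])
  rw [h, c.thetaProd_append, h2, zero_mul, smul_zero]

/-- Sorting the concatenated lists produces the sign, and a common index makes the product vanish.
Over an empty domain the product formula does not determine the sign, so the other properties are
made part of the choice. -/
theorem exists_sgn (I J : Finset (Fin q)) : ∃ ε : ℝ, (¬ Disjoint I J → ε = 0) ∧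
    (Disjoint I J → ε * ε = 1) ∧ (I = ∅ → ε = 1) ∧ (J = ∅ → ε = 1) ∧
    c.thetaProd le_rfl I.sort * c.thetaProd le_rfl J.sort =
      ε • c.thetaProd le_rfl (I ∪ J).sort := by
  rcases eq_or_ne I ∅ with rfl | hI
  · exact ⟨1, by simp, by simp, by simp, by simp, by simp [thetaProd_nil]⟩
  rcases eq_or_ne J ∅ with rfl | hJ
  · exact ⟨1, by simp, by simp, by simp, by simp, by simp [thetaProd_nil]⟩
  by_cases hd : Disjoint I J
  · have hn : (I.sort ++ J.sort).Nodup := by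
      rw [List.nodup_append']
      refine ⟨I.sort_nodup _, J.sort_nodup _, fun a ha hb => ?_⟩
      exact Finset.disjoint_left.1 hd (by simpa using ha) (by simpa using hb)
    have hp : (I.sort ++ J.sort).Perm (I ∪ J).sort :=
      List.perm_of_nodup_nodup_toFinset_eq hn (Finset.sort_nodup _ _) (by simp)
    obtain ⟨ε, hε, h⟩ := c.thetaProd_perm le_rfl hp
    refine ⟨ε, fun h => absurd hd h, fun _ => by rcases hε with rfl | rfl <;> norm_num,
      fun h => absurd h hI, fun h => absurd h hJ, ?_⟩
    rw [← c.thetaProd_append, h]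
  · have hn : ¬ (I.sort ++ J.sort).Nodup := by
      intro hn
      rw [List.nodup_append'] at hn
      obtain ⟨a, ha, hb⟩ := Finset.not_disjoint_iff.1 hd
      exact hn.2.2 (by simpa using ha) (by simpa using hb)
    refine ⟨0, fun _ => rfl, fun h => absurd h hd, fun h => absurd h hI, fun h => absurd h hJ, ?_⟩
    rw [← c.thetaProd_append, c.thetaProd_eq_zero le_rfl hn, zero_smul]

/-- The sign in `θ^I θ^J = ± θ^(I ∪ J)`, zero unless `I` and `J` are disjoint. -/
noncomputable def sgn (I J : Finset (Fin q)) : ℝ := (c.exists_sgn I J).choose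

theorem sgn_of_not_disjoint {I J : Finset (Fin q)} (h : ¬ Disjoint I J) : c.sgn I J = 0 :=
  (c.exists_sgn I J).choose_spec.1 h

theorem sgn_mul_self {I J : Finset (Fin q)} (h : Disjoint I J) : c.sgn I J * c.sgn I J = 1 :=
  (c.exists_sgn I J).choose_spec.2.1 h

theorem sgn_empty_left (J : Finset (Fin q)) : c.sgn ∅ J = 1 :=
  (c.exists_sgn ∅ J).choose_spec.2.2.1 rfl

theorem sgn_empty_right (I : Finset (Fin q)) : c.sgn I ∅ = 1 :=
  (c.exists_sgn I ∅).choose_spec.2.2.2.1 rfl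

theorem thetaProd_mul_thetaProd (hU : U ≤ c.domain) (I J : Finset (Fin q)) :
    c.thetaProd hU I.sort * c.thetaProd hU J.sort = c.sgn I J • c.thetaProd hU (I ∪ J).sort := by
  have h := congrArg (M.res hU) (c.exists_sgn I J).choose_spec.2.2.2.2
  rw [map_mul, map_smul, res_thetaProd, res_thetaProd, res_thetaProd] at h
  exact h

/-- Pullbacks are even and commute with the odd monomials; only the sign of the reordering remains.
-/
theorem coef_mul (hU : U ≤ c.domain) (f g : M.Sec U) (K : Finset (Fin q)) :
    c.coef U (f * g) K = ∑ I, ∑ J,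
      if I ∪ J = K then c.sgn I J • (c.coef U f I * c.coef U g J) else 0 := by
  conv_lhs => rw [c.eq_sum hU f, c.eq_sum hU g, Finset.sum_mul_sum]
  simp only [map_sum, Finset.sum_apply]
  refine Finset.sum_congr rfl fun I _ => Finset.sum_congr rfl fun J _ => ?_
  have h : c.pullTo hU (c.coef U f I) * c.thetaProd hU I.sort *
      (c.pullTo hU (c.coef U g J) * c.thetaProd hU J.sort) =
      c.pullTo hU (c.sgn I J • (c.coef U f I * c.coef U g J)) * c.thetaProd hU (I ∪ J).sort := by
    rw [map_smul, map_mul, smul_mul_assoc, ← mul_smul_comm, ← c.thetaProd_mul_thetaProd]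
    set a := c.pullTo hU (c.coef U f I)
    set t := c.thetaProd hU I.sort
    have hc := even_mul_comm (c.pullTo_even hU (c.coef U g J)) t
    rw [mul_assoc, ← mul_assoc t, ← hc]
    simp only [mul_assoc]
  rw [h, c.coef_monomial]

theorem cf_mul (hU : U ≤ c.domain) (f g : M.Sec U) (K : Finset (Fin q)) {y : Fin p → ℝ}
    (hy : y ∈ c.img U) : c.cf (f * g) K y = ∑ I, ∑ J,
      if I ∪ J = K then c.sgn I J * (c.cf f I y * c.cf g J y) else 0 := by
  have h := congrArg (fun F => smoothFun.evalHom ⟨y, hy⟩ F) (c.coef_mul hU f g K)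
  simp only [map_sum, smoothFun.evalHom_apply] at h
  rw [cf, h]
  refine Finset.sum_congr rfl fun I _ => Finset.sum_congr rfl fun J _ => ?_
  split_ifs
  · rw [smoothFun.ext0_smul _ _ hy, smoothFun.ext0_mul _ _ hy]; rfl
  · exact smoothFun.ext0_zero y

end Chart

end SuperRingedSpace

namespace SuperRingedSpace

namespace Chart

variable {M : SuperRingedSpace.{u}} {p q : ℕ} (c : M.Chart p q) {U V : Opens M.carrier}

/-! ### Coefficients of special sections -/

theorem cf_monomial (hU : U ≤ c.domain) (g : smoothFun (c.img U)) (I J : Finset (Fin q))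
    {y : Fin p → ℝ} : c.cf (c.pullTo hU g * c.thetaProd hU I.sort) J y =
      if I = J then smoothFun.ext0 g y else 0 := by
  rw [cf, c.coef_monomial]
  split_ifs
  · rfl
  · exact smoothFun.ext0_zero y

theorem cf_pullTo (hU : U ≤ c.domain) (g : smoothFun (c.img U)) (I : Finset (Fin q))
    (y : Fin p → ℝ) : c.cf (c.pullTo hU g) I y = if I = ∅ then smoothFun.ext0 g y else 0 := by
  have h := c.cf_monomial hU g ∅ I (y := y)
  rw [Finset.sort_empty, thetaProd_nil, mul_one] at h
  rw [h]
  simp only [eq_comm]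

theorem cf_thetaProd (hU : U ≤ c.domain) (I J : Finset (Fin q)) {y : Fin p → ℝ}
    (hy : y ∈ c.img U) : c.cf (c.thetaProd hU I.sort) J y = if I = J then 1 else 0 := by
  have h := c.cf_monomial hU 1 I J (y := y)
  rwa [map_one, one_mul, smoothFun.ext0_one hy] at h

theorem cf_one (hU : U ≤ c.domain) (I : Finset (Fin q)) {y : Fin p → ℝ} (hy : y ∈ c.img U) :
    c.cf (1 : M.Sec U) I y = if I = ∅ then 1 else 0 := by
  rw [← map_one (c.pullTo hU), c.cf_pullTo, smoothFun.ext0_one hy]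

theorem cf_pullTo_mul (hU : U ≤ c.domain) (g : smoothFun (c.img U)) (f : M.Sec U)
    (I : Finset (Fin q)) {y : Fin p → ℝ} (hy : y ∈ c.img U) :
    c.cf (c.pullTo hU g * f) I y = smoothFun.ext0 g y * c.cf f I y := by
  rw [c.cf_mul hU _ _ _ hy, Finset.sum_eq_single ∅]
  · simp [c.cf_pullTo, c.sgn_empty_left]
  · intro J _ hJ
    simp [c.cf_pullTo, hJ]
  · simp

theorem cf_mul_empty (hU : U ≤ c.domain) (f g : M.Sec U) {y : Fin p → ℝ} (hy : y ∈ c.img U) :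
    c.cf (f * g) ∅ y = c.cf f ∅ y * c.cf g ∅ y := by
  rw [c.cf_mul hU _ _ _ hy, Finset.sum_eq_single ∅]
  · rw [Finset.sum_eq_single ∅]
    · simp [c.sgn_empty_left]
    · intro J _ hJ
      simp [hJ]
    · simp
  · intro J _ hJ
    exact Finset.sum_eq_zero fun K _ => by simp [Finset.union_eq_empty, hJ]
  · simp

theorem thetaProd_singleton (hU : U ≤ c.domain) (j : Fin q) :
    c.thetaProd hU [j] = c.thetaProd hU ({j} : Finset (Fin q)).sort := by
  rw [Finset.sort_singleton]

theorem cf_theta_mul (hU : U ≤ c.domain) (j : Fin q) (f : M.Sec U) (K : Finset (Fin q))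
    {y : Fin p → ℝ} (hy : y ∈ c.img U) : c.cf (c.thetaProd hU [j] * f) K y =
      if j ∈ K then c.sgn {j} (K.erase j) * c.cf f (K.erase j) y else 0 := by
  rw [c.cf_mul hU _ _ _ hy, Finset.sum_eq_single {j}]
  · split_ifs with hK
    · rw [Finset.sum_eq_single (K.erase j)]
      · rw [if_pos (by ext; simp; grind), c.thetaProd_singleton, c.cf_thetaProd hU _ _ hy]
        simp
      · intro J _ hJ
        split_ifs with h
        · have : j ∈ J := by
            by_contra hj
            apply hJ
            rw [← h]
            ext a
            simp
            grind
          rw [c.sgn_of_not_disjoint (by simpa using this), zero_mul]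
        · rfl
      · simp
    · refine Finset.sum_eq_zero fun J _ => ?_
      rw [if_neg]
      rintro rfl
      simp at hK
  · intro I _ hI
    refine Finset.sum_eq_zero fun J _ => ?_
    rw [c.thetaProd_singleton, c.cf_thetaProd hU _ _ hy, if_neg (Ne.symm hI)]
    simp
  · simp

/-! ### Parities -/

/-- The monomials of the wrong degree add up to an element of parity `d + 1`. It also has parity
`d`, being the difference of `f` and the remaining monomials, so it is zero together with its
coefficients. -/
theorem cf_eq_zero_of_mem_parity (hU : U ≤ c.domain) {d : ZMod 2} {f : M.Sec U}
    (hf : f ∈ M.parity U d) {I : Finset (Fin q)} (hI : (I.card : ZMod 2) ≠ d) {y : Fin p → ℝ}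
    (hy : y ∈ c.img U) : c.cf f I y = 0 := by
  have hmono : ∀ J : Finset (Fin q), c.pullTo hU (c.coef U f J) * c.thetaProd hU J.sort ∈
      M.parity U (J.card : ZMod 2) := by
    intro J
    have := mul_mem_parity (c.pullTo_even hU (c.coef U f J)) (c.thetaProd_mem_parity hU J.sort)
    rwa [zero_add, Finset.length_sort] at this
  set g := ∑ J ∈ Finset.univ.filter (fun J : Finset (Fin q) => (J.card : ZMod 2) = d),
    c.pullTo hU (c.coef U f J) * c.thetaProd hU J.sort
  set h := ∑ J ∈ Finset.univ.filter (fun J : Finset (Fin q) => ¬ (J.card : ZMod 2) = d),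
    c.pullTo hU (c.coef U f J) * c.thetaProd hU J.sort with hh
  have hsum : g + h = f := by
    rw [Finset.sum_filter_add_sum_filter_not]
    exact (c.eq_sum hU f).symm
  have hg : g ∈ M.parity U d := Submodule.sum_mem _ fun J hJ => by
    rw [← (Finset.mem_filter.1 hJ).2]; exact hmono J
  have hd : ∀ a b : ZMod 2, a ≠ b → a = b + 1 := by decide
  have hh' : h ∈ M.parity U (d + 1) := Submodule.sum_mem _ fun J hJ => by
    rw [← hd _ _ (Finset.mem_filter.1 hJ).2]; exact hmono J
  have hh'' : h ∈ M.parity U d := by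
    have : h = f - g := by rw [← hsum]; abel
    rw [this]; exact Submodule.sub_mem _ hf hg
  have h0 : h = 0 := by
    have hcase : ∀ d : ZMod 2, d = 0 ∨ d = 1 := by decide
    rcases hcase d with rfl | rfl
    · exact eq_zero_of_mem_parity hh'' hh'
    · exact eq_zero_of_mem_parity hh' hh''
  have h1 := c.cf_sum (Finset.univ.filter (fun J : Finset (Fin q) => ¬ (J.card : ZMod 2) = d))
    (fun J => c.pullTo hU (c.coef U f J) * c.thetaProd hU J.sort) I hy
  rw [← hh, h0, cf_zero] at h1
  simp only [c.cf_monomial, Finset.sum_ite_eq', Finset.mem_filter, Finset.mem_univ, true_and] at h1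
  rw [if_pos hI] at h1
  exact h1.symm

theorem mem_parity_of_cf (hU : U ≤ c.domain) {d : ZMod 2} {f : M.Sec U}
    (h : ∀ I : Finset (Fin q), (I.card : ZMod 2) ≠ d → ∀ y ∈ c.img U, c.cf f I y = 0) :
    f ∈ M.parity U d := by
  rw [c.eq_sum hU f]
  refine Submodule.sum_mem _ fun I _ => ?_
  by_cases hI : (I.card : ZMod 2) = d
  · have := mul_mem_parity (c.pullTo_even hU (c.coef U f I)) (c.thetaProd_mem_parity hU I.sort)
    rwa [zero_add, Finset.length_sort, hI] at this
  · have : c.coef U f I = 0 := smoothFun.ext_of_ext0 fun y hy => by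
      rw [smoothFun.ext0_zero]; exact h I hI y hy
    rw [this, map_zero, zero_mul]
    exact Submodule.zero_mem _

/-! ### The coordinate vector fields -/

theorem differentiableAt_cf (f : M.Sec U) (I : Finset (Fin q)) {y : Fin p → ℝ}
    (hy : y ∈ c.img U) : DifferentiableAt ℝ (c.cf f I) y :=
  ((c.contDiffOn_cf f I).contDiffAt ((c.img U).2.mem_nhds hy)).differentiableAt (by simp)

theorem fderiv_congr_img {F G : (Fin p → ℝ) → ℝ} (h : ∀ y ∈ c.img U, F y = G y)
    {y : Fin p → ℝ} (hy : y ∈ c.img U) : fderiv ℝ F y = fderiv ℝ G y :=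
  Filter.EventuallyEq.fderiv_eq (Filter.eventuallyEq_of_mem ((c.img U).2.mem_nhds hy) h)

theorem contDiffOn_fderiv_cf (f : M.Sec U) (I : Finset (Fin q)) (v : Fin p → ℝ) :
    ContDiffOn ℝ ∞ (fun y => fderiv ℝ (c.cf f I) y v) (c.img U) :=
  ((c.contDiffOn_cf f I).fderiv_of_isOpen (m := ∞) (c.img U).2 (by simp)).clm_apply
    contDiffOn_const

/-- The coordinate vector field `∂/∂t^i`. -/
noncomputable def partialT (i : Fin p) : M.EndFamily c.domain := fun W =>
  { toFun := fun f => c.ofCf W.2 (fun I y => fderiv ℝ (c.cf f I) y (Pi.single i 1))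
      (fun I => c.contDiffOn_fderiv_cf f I _)
    map_add' := fun f g => c.ext_cf W.2 fun I y hy => by
      rw [c.cf_add _ _ _ hy, c.cf_ofCf _ _ _ _ hy, c.cf_ofCf _ _ _ _ hy, c.cf_ofCf _ _ _ _ hy,
        c.fderiv_congr_img (fun y hy => c.cf_add f g I hy) hy,
        fderiv_fun_add (c.differentiableAt_cf f I hy) (c.differentiableAt_cf g I hy)]
      rfl
    map_smul' := fun a f => c.ext_cf W.2 fun I y hy => by
      rw [RingHom.id_apply, c.cf_smul _ _ _ hy, c.cf_ofCf _ _ _ _ hy, c.cf_ofCf _ _ _ _ hy,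
        c.fderiv_congr_img (fun y hy => c.cf_smul a f I hy) hy,
        fderiv_const_mul (c.differentiableAt_cf f I hy)]
      rfl }

theorem cf_partialT (i : Fin p) (W : {W : Opens M.carrier // W ≤ c.domain}) (f : M.Sec W.1)
    (I : Finset (Fin q)) {y : Fin p → ℝ} (hy : y ∈ c.img W.1) :
    c.cf (c.partialT i W f) I y = fderiv ℝ (c.cf f I) y (Pi.single i 1) :=
  c.cf_ofCf W.2 _ _ I hy

/-- The coordinate vector field `∂/∂θ^j`. -/
noncomputable def partialTheta (j : Fin q) : M.EndFamily c.domain := fun W =>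
  { toFun := fun f => c.ofCf W.2
      (fun I y => if j ∈ I then 0 else c.sgn {j} I * c.cf f (insert j I) y) (fun I => by
        by_cases h : j ∈ I
        · simp only [h, if_true]; exact contDiffOn_const
        · simp only [h, if_false]; exact contDiffOn_const.mul (c.contDiffOn_cf f _))
    map_add' := fun f g => c.ext_cf W.2 fun I y hy => by
      rw [c.cf_add _ _ _ hy, c.cf_ofCf _ _ _ _ hy, c.cf_ofCf _ _ _ _ hy, c.cf_ofCf _ _ _ _ hy,
        c.cf_add _ _ _ hy]
      split_ifs <;> ring
    map_smul' := fun a f => c.ext_cf W.2 fun I y hy => by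
      rw [RingHom.id_apply, c.cf_smul _ _ _ hy, c.cf_ofCf _ _ _ _ hy, c.cf_ofCf _ _ _ _ hy,
        c.cf_smul _ _ _ hy]
      split_ifs <;> ring }

theorem cf_partialTheta (j : Fin q) (W : {W : Opens M.carrier // W ≤ c.domain}) (f : M.Sec W.1)
    (I : Finset (Fin q)) {y : Fin p → ℝ} (hy : y ∈ c.img W.1) :
    c.cf (c.partialTheta j W f) I y =
      if j ∈ I then 0 else c.sgn {j} I * c.cf f (insert j I) y :=
  c.cf_ofCf W.2 _ _ I hy

/-- The signs in `cf_mul` are constants, so the Leibniz rule for sections reduces to the one for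
coefficient functions. -/
theorem partialT_mem (i : Fin p) : c.partialT i ∈ M.vecParity c.domain 0 := by
  refine ⟨fun W W' h f => c.ext_cf W'.2 fun I y hy => ?_,
    fun W e f hf => c.mem_parity_of_cf W.2 fun I hI y hy => ?_,
    fun W e f _ g => c.ext_cf W.2 fun K y hy => ?_⟩
  · rw [c.cf_res h _ _ hy, c.cf_partialT i W f I (c.img_mono h hy), c.cf_partialT i W' _ I hy,
      c.fderiv_congr_img (fun y hy => c.cf_res h f I hy) hy]
  · rw [c.cf_partialT i W f I hy, c.fderiv_congr_img (G := fun _ => 0)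
      (fun y hy => c.cf_eq_zero_of_mem_parity W.2 hf (by simpa using hI) hy) hy]
    simp
  · rw [superSign_zero_left, one_smul, c.cf_add _ _ _ hy, c.cf_partialT i W _ K hy,
      c.cf_mul W.2 _ _ _ hy, c.cf_mul W.2 _ _ _ hy,
      c.fderiv_congr_img (fun y hy => c.cf_mul W.2 f g K hy) hy]
    have hd : ∀ I J : Finset (Fin q), DifferentiableAt ℝ (fun y =>
        if I ∪ J = K then c.sgn I J * (c.cf f I y * c.cf g J y) else 0) y := by
      intro I J
      by_cases h : I ∪ J = K
      · simp only [h, if_true]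
        exact ((c.differentiableAt_cf f I hy).mul (c.differentiableAt_cf g J hy)).const_mul _
      · simp only [h, if_false]
        exact differentiableAt_const _
    rw [fderiv_fun_sum fun I _ => DifferentiableAt.fun_sum fun J _ => hd I J,
      _root_.sum_apply, ← Finset.sum_add_distrib]
    refine Finset.sum_congr rfl fun I _ => ?_
    rw [fderiv_fun_sum fun J _ => hd I J, _root_.sum_apply, ← Finset.sum_add_distrib]
    refine Finset.sum_congr rfl fun J _ => ?_
    by_cases h : I ∪ J = K
    · simp only [h, if_true]
      rw [fderiv_const_mul ((c.differentiableAt_cf f I hy).fun_mul (c.differentiableAt_cf g J hy)),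
        fderiv_fun_mul (c.differentiableAt_cf f I hy) (c.differentiableAt_cf g J hy),
        c.cf_partialT i W f I hy, c.cf_partialT i W g J hy]
      simp only [_root_.smul_apply, _root_.add_apply, smul_eq_mul]
      ring
    · simp [h]

/-- The two orders of multiplying `θ^I` by `θ^j` and `θ^k` differ by a sign; one compares
coefficients. A point `y` is needed, as over an empty set the comparison says nothing. -/
theorem sgn_singleton_comm {j k : Fin q} (hjk : j ≠ k) {I : Finset (Fin q)} (hj : j ∉ I)
    (hk : k ∉ I) (hU : U ≤ c.domain) {y : Fin p → ℝ} (hy : y ∈ c.img U) :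
    c.sgn {j} (insert k I) * c.sgn {k} (insert j I) = -(c.sgn {k} I * c.sgn {j} I) := by
  have hodd : ∀ i : Fin q, c.thetaProd hU [i] ∈ M.parity U 1 := fun i => by
    simpa using c.thetaProd_mem_parity hU [i]
  have h1 : c.thetaProd hU [j] * (c.thetaProd hU [k] * c.thetaProd hU I.sort) =
      -(c.thetaProd hU [k] * (c.thetaProd hU [j] * c.thetaProd hU I.sort)) := by
    rw [← mul_assoc, ← mul_assoc, odd_mul_comm (hodd j) (hodd k), neg_mul]
  have h2 := congrArg (fun f => c.cf f (insert j (insert k I)) y) h1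
  rw [← neg_one_smul ℝ, c.cf_smul _ _ _ hy] at h2
  simp only [c.cf_theta_mul hU _ _ _ hy] at h2
  have e1 : (insert j (insert k I)).erase j = insert k I :=
    Finset.erase_insert (by simp [hjk, hj])
  have e2 : (insert j (insert k I)).erase k = insert j I := by
    rw [Finset.insert_comm]; exact Finset.erase_insert (by simp [hjk.symm, hk])
  rw [e1, e2, if_pos (by simp), if_pos (by simp), if_pos (by simp), if_pos (by simp),
    Finset.erase_insert hk, Finset.erase_insert hj, c.cf_thetaProd hU _ _ hy] at h2
  simp only [if_true, mul_one] at h2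
  have s1 := c.sgn_mul_self (I := {k}) (J := I) (by simpa using hk)
  have s2 := c.sgn_mul_self (I := {k}) (J := insert j I) (by simp [hk, hjk.symm])
  linear_combination (c.sgn {k} I * c.sgn {k} (insert j I)) * h2
    - c.sgn {j} (insert k I) * c.sgn {k} (insert j I) * s1
    - c.sgn {k} I * c.sgn {j} I * s2

/-- Checked on coefficients, by cases on which of the two indices occur; the mixed case is
`sgn_singleton_comm`. This relation drives the Leibniz rule for odd derivatives. -/
theorem partialTheta_theta_mul (j k : Fin q) (W : {W : Opens M.carrier // W ≤ c.domain})
    (f : M.Sec W.1) : c.partialTheta j W (c.thetaProd W.2 [k] * f) =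
      (if j = k then f else 0) - c.thetaProd W.2 [k] * c.partialTheta j W f := by
  refine c.ext_cf W.2 fun I y hy => ?_
  rw [c.cf_sub _ _ _ hy, c.cf_partialTheta j W _ I hy, c.cf_theta_mul W.2 _ _ _ hy,
    c.cf_theta_mul W.2 _ _ _ hy, c.cf_partialTheta j W _ _ hy]
  by_cases hjk : j = k
  · subst hjk
    by_cases hj : j ∈ I
    · have := c.sgn_mul_self (I := {j}) (J := I.erase j) (by simp)
      simp only [hj, if_true, Finset.mem_erase, ne_eq, not_true_eq_false, false_and, if_false,
        Finset.insert_erase]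
      linear_combination (c.cf f I y) * this
    · have := c.sgn_mul_self (I := {j}) (J := I) (by simpa using hj)
      simp only [hj, if_true, if_false, Finset.mem_insert, true_or, Finset.erase_insert hj]
      linear_combination (c.cf f I y) * this
  · simp only [hjk, if_false, cf_zero]
    by_cases hj : j ∈ I
    · simp [hj, hjk]
    · by_cases hk : k ∈ I
      · have hke : k ∉ I.erase k := by simp
        have hje : j ∉ I.erase k := by simp [hj]
        have := c.sgn_singleton_comm hjk hje hke W.2 hy
        rw [Finset.insert_erase hk] at this
        have e : (insert j I).erase k = insert j (I.erase k) := by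
          ext a; simp; grind
        simp only [hj, hk, if_true, if_false, Finset.mem_insert, or_true, hje, e]
        linear_combination (c.cf f (insert j (I.erase k)) y) * this
      · simp [hj, hk, Ne.symm hjk]

theorem partialTheta_pullTo_mul (j : Fin q) (W : {W : Opens M.carrier // W ≤ c.domain})
    (g : smoothFun (c.img W.1)) (f : M.Sec W.1) :
    c.partialTheta j W (c.pullTo W.2 g * f) = c.pullTo W.2 g * c.partialTheta j W f := by
  refine c.ext_cf W.2 fun I y hy => ?_
  rw [c.cf_pullTo_mul W.2 _ _ _ hy, c.cf_partialTheta j W _ I hy, c.cf_partialTheta j W _ I hy,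
    c.cf_pullTo_mul W.2 _ _ _ hy]
  split_ifs <;> ring

theorem partialTheta_thetaProd_mul (j : Fin q) (W : {W : Opens M.carrier // W ≤ c.domain})
    (L : List (Fin q)) (g : M.Sec W.1) : c.partialTheta j W (c.thetaProd W.2 L * g) =
      c.partialTheta j W (c.thetaProd W.2 L) * g +
        superSign 1 (L.length : ZMod 2) • (c.thetaProd W.2 L * c.partialTheta j W g) := by
  induction L with
  | nil =>
    have h0 : c.partialTheta j W 1 = 0 := by
      refine c.ext_cf W.2 fun I y hy => ?_
      rw [c.cf_partialTheta j W _ I hy, c.cf_one W.2 _ hy, cf_zero]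
      simp
    rw [thetaProd_nil, h0]
    simp [superSign]
  | cons k L ih =>
    have hs : ∀ e : ZMod 2, superSign 1 (e + 1) = -superSign 1 e := by
      have hc : ∀ e : ZMod 2, e = 0 ∨ e = 1 := by decide
      have h2 : (1 : ZMod 2) + 1 = 0 := by decide
      intro e
      rcases hc e with rfl | rfl
      · simp [superSign]
      · rw [h2]; simp [superSign]
    rw [c.thetaProd_cons, mul_assoc, partialTheta_theta_mul, ih, partialTheta_theta_mul,
      List.length_cons, Nat.cast_succ, hs]
    split_ifs
    · simp only [sub_mul, mul_add, mul_assoc, mul_smul_comm, neg_smul]; abel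
    · simp only [zero_sub, neg_mul, mul_add, mul_assoc, mul_smul_comm, neg_smul]; abel

theorem partialTheta_mem (j : Fin q) : c.partialTheta j ∈ M.vecParity c.domain 1 := by
  refine ⟨fun W W' h f => c.ext_cf W'.2 fun I y hy => ?_,
    fun W e f hf => c.mem_parity_of_cf W.2 fun I hI y hy => ?_,
    fun W e f hf g => ?_⟩
  · rw [c.cf_res h _ _ hy, c.cf_partialTheta j W f I (c.img_mono h hy),
      c.cf_partialTheta j W' _ I hy, c.cf_res h _ _ hy]
  · rw [c.cf_partialTheta j W f I hy]
    split_ifs with hj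
    · rfl
    · rw [c.cf_eq_zero_of_mem_parity W.2 hf _ hy, mul_zero]
      rw [Finset.card_insert_of_notMem hj, Nat.cast_succ]
      have : ∀ a b : ZMod 2, a ≠ 1 + b → a + 1 ≠ b := by decide
      exact this _ _ hI
  -- Only the monomials of `f` have to be treated: those of degree parity `e` obey the rule with the
  -- sign of `e`, and the others have coefficient zero.
  · have key : ∀ I : Finset (Fin q),
        c.partialTheta j W (c.pullTo W.2 (c.coef W.1 f I) * c.thetaProd W.2 I.sort * g) =
        c.partialTheta j W (c.pullTo W.2 (c.coef W.1 f I) * c.thetaProd W.2 I.sort) * g +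
        superSign 1 e •
          (c.pullTo W.2 (c.coef W.1 f I) * c.thetaProd W.2 I.sort * c.partialTheta j W g) := by
      intro I
      by_cases hI : (I.card : ZMod 2) = e
      · rw [mul_assoc, partialTheta_pullTo_mul, partialTheta_thetaProd_mul,
          partialTheta_pullTo_mul, Finset.length_sort, hI, mul_add, mul_assoc, mul_assoc,
          mul_smul_comm]
      · have : c.coef W.1 f I = 0 := smoothFun.ext_of_ext0 fun y hy => by
          rw [smoothFun.ext0_zero]; exact c.cf_eq_zero_of_mem_parity W.2 hf hI hy
        rw [this]
        simp
    conv_lhs => rw [c.eq_sum W.2 f, Finset.sum_mul, map_sum]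
    rw [Finset.sum_congr rfl fun I _ => key I, Finset.sum_add_distrib, ← Finset.sum_mul, ← map_sum,
      ← Finset.smul_sum, ← Finset.sum_mul, ← c.eq_sum W.2 f]

end Chart

end SuperRingedSpace

/-! ### Module operations and Leibniz rules for vector fields -/

namespace SuperRingedSpace

section VectorFields

variable {M : SuperRingedSpace.{u}} {U V W : Opens M.carrier}

theorem superSign_add_left (d e f : ZMod 2) :
    superSign (d + e) f = superSign d f * superSign e f := by
  have hc : ∀ e : ZMod 2, e = 0 ∨ e = 1 := by decide
  have h2 : (1 : ZMod 2) + 1 = 0 := by decide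
  rcases hc d with rfl | rfl <;> rcases hc e with rfl | rfl <;> rcases hc f with rfl | rfl <;>
    simp [superSign, h2]

theorem funMul_apply (a : M.Sec U) (X : M.EndFamily U) (W : {W : Opens M.carrier // W ≤ U})
    (f : M.Sec W.1) : funMul a X W f = M.res W.2 a * X W f := rfl

theorem resVec_apply (h : V ≤ U) (X : M.EndFamily U) (W : {W : Opens M.carrier // W ≤ V})
    (f : M.Sec W.1) : resVec h X W f = X ⟨W.1, W.2.trans h⟩ f := rfl

theorem endFamily_ext {X Y : M.EndFamily U} (h : ∀ W f, X W f = Y W f) : X = Y :=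
  funext fun W => LinearMap.ext fun f => h W f

theorem sum_endFamily_apply {ι : Type*} (s : Finset ι) (X : ι → M.EndFamily U)
    (W : {W : Opens M.carrier // W ≤ U}) (f : M.Sec W.1) :
    (∑ i ∈ s, X i) W f = ∑ i ∈ s, X i W f := by
  rw [Finset.sum_apply, LinearMap.sum_apply]

theorem funMul_sum {ι : Type*} (s : Finset ι) (a : M.Sec U) (X : ι → M.EndFamily U) :
    funMul a (∑ i ∈ s, X i) = ∑ i ∈ s, funMul a (X i) :=
  endFamily_ext fun W f => by
    rw [funMul_apply, sum_endFamily_apply, sum_endFamily_apply, Finset.mul_sum]; rfl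

theorem add_funMul (a b : M.Sec U) (X : M.EndFamily U) :
    funMul (a + b) X = funMul a X + funMul b X :=
  endFamily_ext fun W f => by simp [funMul_apply, add_mul]

theorem sum_funMul {ι : Type*} (s : Finset ι) (a : ι → M.Sec U) (X : M.EndFamily U) :
    funMul (∑ i ∈ s, a i) X = ∑ i ∈ s, funMul (a i) X :=
  endFamily_ext fun W f => by
    rw [funMul_apply, sum_endFamily_apply, map_sum, Finset.sum_mul]; rfl

theorem funMul_funMul (a b : M.Sec U) (X : M.EndFamily U) :
    funMul a (funMul b X) = funMul (a * b) X :=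
  endFamily_ext fun W f => by simp [funMul_apply, mul_assoc]

theorem one_funMul (X : M.EndFamily U) : funMul 1 X = X :=
  endFamily_ext fun W f => by simp [funMul_apply]

theorem zero_funMul (X : M.EndFamily U) : funMul 0 X = 0 :=
  endFamily_ext fun W f => by simp [funMul_apply]

theorem resVec_funMul (h : V ≤ U) (a : M.Sec U) (X : M.EndFamily U) :
    resVec h (funMul a X) = funMul (M.res h a) (resVec h X) :=
  endFamily_ext fun W f => by rw [funMul_apply, resVec_apply, resVec_apply, funMul_apply, res_res]

theorem resVec_sum {ι : Type*} (s : Finset ι) (h : V ≤ U) (X : ι → M.EndFamily U) :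
    resVec h (∑ i ∈ s, X i) = ∑ i ∈ s, resVec h (X i) :=
  endFamily_ext fun W f => by
    rw [resVec_apply, sum_endFamily_apply, sum_endFamily_apply]; rfl

theorem resVec_resVec (h : V ≤ U) (h' : W ≤ V) (X : M.EndFamily U) :
    resVec h' (resVec h X) = resVec (h'.trans h) X := rfl

theorem resVec_mem_vecParity (h : V ≤ U) {d : ZMod 2} {X : M.EndFamily U}
    (hX : X ∈ M.vecParity U d) : resVec h X ∈ M.vecParity V d :=
  ⟨fun W W' hW f => hX.1 ⟨W.1, W.2.trans h⟩ ⟨W'.1, W'.2.trans h⟩ hW f,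
    fun W e f hf => hX.2.1 ⟨W.1, W.2.trans h⟩ e f hf,
    fun W e f hf g => hX.2.2 ⟨W.1, W.2.trans h⟩ e f hf g⟩

theorem funMul_mem_vecParity {d e : ZMod 2} {a : M.Sec U} (ha : a ∈ M.parity U e)
    {X : M.EndFamily U} (hX : X ∈ M.vecParity U d) : funMul a X ∈ M.vecParity U (e + d) := by
  refine ⟨fun W W' h f => ?_, fun W e' f hf => ?_, fun W e' f hf g => ?_⟩
  · rw [funMul_apply, funMul_apply, map_mul, res_res, hX.1 W W' h f]
  · rw [funMul_apply, add_assoc]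
    exact mul_mem_parity (res_mem_parity _ ha) (hX.2.1 W e' f hf)
  · rw [funMul_apply, funMul_apply, funMul_apply, hX.2.2 W e' f hf g, mul_add, mul_smul_comm,
      ← mul_assoc, ← mul_assoc, M.supercomm W.1 e e' _ (res_mem_parity W.2 ha) f hf,
      superSign_add_left, smul_mul_assoc, smul_smul, mul_assoc f, mul_comm (superSign d e')]

theorem vecParity_le_vec (d : ZMod 2) : M.vecParity U d ≤ M.vec U := by
  have hc : ∀ e : ZMod 2, e = 0 ∨ e = 1 := by decide
  rcases hc d with rfl | rfl
  · exact le_sup_left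
  · exact le_sup_right

theorem exists_vecParity_add {X : M.EndFamily U} (hX : X ∈ M.vec U) :
    ∃ X₀ ∈ M.vecParity U 0, ∃ X₁ ∈ M.vecParity U 1, X₀ + X₁ = X :=
  Submodule.mem_sup.1 hX

theorem vec_res {X : M.EndFamily U} (hX : X ∈ M.vec U) (W W' : {W : Opens M.carrier // W ≤ U})
    (h : W'.1 ≤ W.1) (f : M.Sec W.1) : M.res h (X W f) = X W' (M.res h f) := by
  obtain ⟨X₀, h₀, X₁, h₁, rfl⟩ := exists_vecParity_add hX
  simp only [Pi.add_apply, LinearMap.add_apply, map_add, h₀.1 W W' h, h₁.1 W W' h]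

theorem resVec_mem_vec (h : V ≤ U) {X : M.EndFamily U} (hX : X ∈ M.vec U) :
    resVec h X ∈ M.vec V := by
  obtain ⟨X₀, h₀, X₁, h₁, rfl⟩ := exists_vecParity_add hX
  exact Submodule.add_mem_sup (resVec_mem_vecParity h h₀) (resVec_mem_vecParity h h₁)

theorem vecParity_one {d : ZMod 2} {X : M.EndFamily U} (hX : X ∈ M.vecParity U d)
    (W : {W : Opens M.carrier // W ≤ U}) : X W 1 = 0 := by
  have h := hX.2.2 W 0 1 one_mem_parity 1
  rw [superSign_zero_right] at h
  simpa using h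

theorem vecParity_even_mul {d : ZMod 2} {X : M.EndFamily U} (hX : X ∈ M.vecParity U d)
    (W : {W : Opens M.carrier // W ≤ U}) {f : M.Sec W.1} (hf : f ∈ M.parity W.1 0)
    (g : M.Sec W.1) : X W (f * g) = X W f * g + f * X W g := by
  rw [hX.2.2 W 0 f hf g, superSign_zero_right, one_smul]

theorem evenField_mul {X : M.EndFamily U} (hX : X ∈ M.vecParity U 0)
    (W : {W : Opens M.carrier // W ≤ U}) (f g : M.Sec W.1) :
    X W (f * g) = X W f * g + f * X W g := by
  obtain ⟨f₀, h₀, f₁, h₁, rfl⟩ := exists_parity_add f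
  rw [add_mul, map_add, hX.2.2 W 0 f₀ h₀, hX.2.2 W 1 f₁ h₁, map_add, superSign_zero_left,
    superSign_zero_left]
  simp only [add_mul, one_smul]
  abel

theorem oddField_odd_mul {X : M.EndFamily U} (hX : X ∈ M.vecParity U 1)
    (W : {W : Opens M.carrier // W ≤ U}) {f : M.Sec W.1} (hf : f ∈ M.parity W.1 1)
    (g : M.Sec W.1) : X W (f * g) = X W f * g - f * X W g := by
  rw [hX.2.2 W 1 f hf g, superSign_one_one, neg_one_smul, sub_eq_add_neg]

end VectorFields

/-! ### Vector fields in coordinates -/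

/-- The parities of the coordinates. -/
def coordParity {m n : Type*} : m ⊕ n → ZMod 2 := Sum.elim (fun _ => 0) (fun _ => 1)

namespace Chart

variable {M : SuperRingedSpace.{u}} {p q : ℕ} (c : M.Chart p q) {U V : Opens M.carrier}

/-- The coordinates `t^i`, `θ^j` on an open subset of the domain. -/
noncomputable def coord (hU : U ≤ c.domain) : Fin p ⊕ Fin q → M.Sec U :=
  Sum.elim (fun i => c.pullTo hU (smoothFun.ofFun (fun y => y i) (contDiff_apply ℝ ℝ i).contDiffOn))
    (fun j => c.thetaProd hU [j])

/-- The coordinate vector fields. -/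
noncomputable def coordField : Fin p ⊕ Fin q → M.EndFamily c.domain :=
  Sum.elim c.partialT c.partialTheta

theorem coordField_mem (a : Fin p ⊕ Fin q) :
    c.coordField a ∈ M.vecParity c.domain (coordParity a) := by
  rcases a with i | j
  · exact c.partialT_mem i
  · exact c.partialTheta_mem j

theorem thetaProd_odd (hU : U ≤ c.domain) (j : Fin q) : c.thetaProd hU [j] ∈ M.parity U 1 := by
  simpa using c.thetaProd_mem_parity hU [j]

theorem coord_mem_parity (hU : U ≤ c.domain) (a : Fin p ⊕ Fin q) :
    c.coord hU a ∈ M.parity U (coordParity a) := by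
  rcases a with i | j
  · exact c.pullTo_even hU _
  · exact c.thetaProd_odd hU j

theorem res_coord (h : V ≤ U) (hU : U ≤ c.domain) (a : Fin p ⊕ Fin q) :
    M.res h (c.coord hU a) = c.coord (h.trans hU) a := by
  rcases a with i | j
  · exact c.res_pullTo h hU _
  · exact c.res_thetaProd h hU _

theorem cf_coord_inl (hU : U ≤ c.domain) (i : Fin p) (I : Finset (Fin q)) {y : Fin p → ℝ}
    (hy : y ∈ c.img U) : c.cf (c.coord hU (Sum.inl i)) I y = if I = ∅ then y i else 0 := by
  rw [coord, Sum.elim_inl, c.cf_pullTo, smoothFun.ext0_ofFun _ hy]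

theorem cf_coord_inr (hU : U ≤ c.domain) (j : Fin q) (I : Finset (Fin q)) {y : Fin p → ℝ}
    (hy : y ∈ c.img U) : c.cf (c.coord hU (Sum.inr j)) I y = if I = {j} then 1 else 0 := by
  rw [coord, Sum.elim_inr, c.thetaProd_singleton, c.cf_thetaProd hU _ _ hy]
  simp only [eq_comm]

theorem coordField_coord (a b : Fin p ⊕ Fin q) (W : {W : Opens M.carrier // W ≤ c.domain}) :
    c.coordField a W (c.coord W.2 b) = if a = b then 1 else 0 := by
  refine c.ext_cf W.2 fun I y hy => ?_
  have h01 : c.cf (if a = b then (1 : M.Sec W.1) else 0) I y = if a = b ∧ I = ∅ then 1 else 0 := by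
    split_ifs with h1 h2 h3
    · rw [c.cf_one W.2 _ hy, if_pos h2.2]
    · rw [c.cf_one W.2 _ hy, if_neg fun h => h2 ⟨h1, h⟩]
    · exact absurd h3.1 h1
    · exact c.cf_zero _ _
  rw [h01]
  rcases a with i | j
  · change c.cf (c.partialT i W _) I y = _
    rw [c.cf_partialT i W _ I hy]
    rcases b with k | l
    · rw [c.fderiv_congr_img (fun y hy => c.cf_coord_inl W.2 k I hy) hy]
      by_cases hI : I = ∅
      · simp only [hI, if_true, and_true, Sum.inl.injEq]
        rw [(hasFDerivAt_apply k y).fderiv]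
        simp [Pi.single_apply, eq_comm]
      · simp [hI]
    · rw [c.fderiv_congr_img (fun y hy => c.cf_coord_inr W.2 l I hy) hy]
      simp
  · change c.cf (c.partialTheta j W _) I y = _
    rw [c.cf_partialTheta j W _ I hy]
    rcases b with k | l
    · rw [c.cf_coord_inl W.2 k _ hy]
      simp
    · rw [c.cf_coord_inr W.2 l _ hy]
      by_cases hI : I = ∅
      · subst hI
        simp [c.sgn_empty_right]
      · have h2 : ¬ (Sum.inr (α := Fin p) j = Sum.inr l ∧ I = ∅) := fun h => hI h.2
        rw [if_neg h2]
        by_cases h1 : j ∈ I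
        · rw [if_pos h1]
        · have h3 : insert j I ≠ {l} := by
            intro h
            have hc := congrArg Finset.card h
            rw [Finset.card_insert_of_notMem h1, Finset.card_singleton] at hc
            exact hI (Finset.card_eq_zero.1 (by omega))
          rw [if_neg h1, if_neg h3, mul_zero]

theorem mem_img_preimage {N : Opens (Fin p → ℝ)} {y : Fin p → ℝ} (hN : y ∈ N)
    (hy : y ∈ c.φ.target) : y ∈ c.img (chartPreimage c.φ N) :=
  ⟨hy, c.φ.map_target hy, by simpa [c.φ.right_inv hy] using hN⟩

theorem preimage_le_of_le_img {N : Opens (Fin p → ℝ)} (h : N ≤ c.img U) :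
    chartPreimage c.φ N ≤ U :=
  (chartPreimage_mono c.φ h).trans (c.preimage_img_le U)

/-- A vector field annihilating the coordinates annihilates all pullbacks of smooth functions. -/
theorem cf_field_pullTo_eq_zero (hU : U ≤ c.domain) {d : ZMod 2} {Y : M.EndFamily U}
    (hY : Y ∈ M.vecParity U d) (h0 : ∀ a, Y ⟨U, le_rfl⟩ (c.coord hU a) = 0)
    (W : {W : Opens M.carrier // W ≤ U}) (g : smoothFun (c.img W.1)) (J : Finset (Fin q))
    {y₀ : Fin p → ℝ} (hy₀ : y₀ ∈ c.img W.1) :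
    c.cf (Y W (c.pullTo (W.2.trans hU) g)) J y₀ = 0 := by
  -- Near `y₀`, Hadamard's lemma writes `g` as a constant plus products of the `t^i - y₀ i` with
  -- smooth functions. `Y` annihilates the constant and each `t^i - y₀ i`, so every remaining term
  -- carries a factor `t^i - y₀ i`, which is zero at `y₀`.
  obtain ⟨G, hG, hev⟩ := hadamard_local (c.img W.1).2 (smoothFun.contDiffOn_ext0 g) hy₀
  obtain ⟨N, hN, hNo, hyN⟩ := eventually_nhds_iff.1 (hev.and ((c.img W.1).2.mem_nhds hy₀))
  let N' : Opens (Fin p → ℝ) := ⟨N, hNo⟩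
  have hN' : N' ≤ c.img W.1 := fun y hy => (hN y hy).2
  set V := chartPreimage c.φ N' with hV
  have hVW : V ≤ W.1 := c.preimage_le_of_le_img hN'
  have hVd : V ≤ c.domain := hVW.trans (W.2.trans hU)
  have hyV : y₀ ∈ c.img V := c.mem_img_preimage hyN hy₀.1
  let V' : {W : Opens M.carrier // W ≤ U} := ⟨V, hVW.trans W.2⟩
  rw [← c.cf_res hVW _ _ hyV, hY.1 W V' hVW, c.res_pullTo hVW]
  let τ : Fin p → smoothFun (c.img V) := fun i =>
    smoothFun.ofFun (fun y => y i - y₀ i) ((contDiff_apply ℝ ℝ i).sub contDiff_const).contDiffOn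
  have hsub : c.img V ≤ N' := by
    rintro y ⟨hy, -, hy'⟩
    simpa [c.φ.right_inv hy] using hy'
  have hdec : c.pullTo hVd (smoothFun.res (c.img_mono hVW) g) =
      smoothFun.ext0 g y₀ • (1 : M.Sec V) + ∑ i, c.pullTo hVd (τ i) *
        c.pullTo hVd (smoothFun.ofFun (G i) (hG i).contDiffOn) := by
    rw [← map_one (c.pullTo hVd), ← map_smul]
    simp only [← map_mul, ← map_sum, ← map_add]
    congr 1
    refine smoothFun.ext_of_ext0 fun y hy => ?_
    rw [smoothFun.ext0_res _ _ hy, (hN y (hsub hy)).1, smoothFun.ext0_add _ _ hy,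
      smoothFun.ext0_smul _ _ hy, smoothFun.ext0_one hy, mul_one]
    congr 1
    rw [← smoothFun.evalHom_apply ⟨y, hy⟩, map_sum]
    refine Finset.sum_congr rfl fun i _ => ?_
    rw [smoothFun.evalHom_apply, smoothFun.ext0_mul _ _ hy, smoothFun.ext0_ofFun _ hy,
      smoothFun.ext0_ofFun _ hy]
  have hτ0 : ∀ i, Y V' (c.pullTo hVd (τ i)) = 0 := by
    intro i
    have h1 : c.pullTo hVd (τ i) = c.coord hVd (Sum.inl i) - y₀ i • (1 : M.Sec V) := by
      rw [← map_one (c.pullTo hVd), ← map_smul, coord, Sum.elim_inl, ← map_sub]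
      congr 1
      refine smoothFun.ext_of_ext0 fun y hy => ?_
      rw [sub_eq_add_neg, smoothFun.ext0_add _ _ hy, ← neg_one_smul ℝ,
        smoothFun.ext0_smul _ _ hy, smoothFun.ext0_smul _ _ hy, smoothFun.ext0_one hy,
        smoothFun.ext0_ofFun _ hy, smoothFun.ext0_ofFun _ hy]
      ring
    have h2 : Y V' (c.coord hVd (Sum.inl i)) = 0 := by
      rw [← c.res_coord V'.2 hU, ← hY.1 ⟨U, le_rfl⟩ V' V'.2, h0, map_zero]
    rw [h1, map_sub, h2, map_smul, vecParity_one hY V']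
    simp
  have hY1 : Y V' (1 : M.Sec V) = 0 := vecParity_one hY V'
  rw [hdec, map_add, map_smul, hY1, smul_zero, zero_add, map_sum, c.cf_sum _ _ _ hyV]
  refine Finset.sum_eq_zero fun i _ => ?_
  rw [vecParity_even_mul hY V' (c.pullTo_even hVd _), hτ0, zero_mul, zero_add,
    c.cf_pullTo_mul hVd _ _ _ hyV, smoothFun.ext0_ofFun _ hyV, sub_self, zero_mul]

theorem vecParity_thetaProd_eq_zero (hU : U ≤ c.domain) {d : ZMod 2} {Y : M.EndFamily U}
    (hY : Y ∈ M.vecParity U d) (W : {W : Opens M.carrier // W ≤ U})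
    (h0 : ∀ j, Y W (c.thetaProd (W.2.trans hU) [j]) = 0) (L : List (Fin q)) :
    Y W (c.thetaProd (W.2.trans hU) L) = 0 := by
  induction L with
  | nil => rw [thetaProd_nil]; exact vecParity_one hY W
  | cons j L ih =>
    rw [c.thetaProd_cons, hY.2.2 W 1 _ (c.thetaProd_odd _ j), h0, ih]
    simp

/-- A vector field is determined by its values on the coordinates. -/
theorem vecParity_eq_zero (hU : U ≤ c.domain) {d : ZMod 2} {Y : M.EndFamily U}
    (hY : Y ∈ M.vecParity U d) (h0 : ∀ a, Y ⟨U, le_rfl⟩ (c.coord hU a) = 0) : Y = 0 := by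
  refine endFamily_ext fun W f => ?_
  have hWd := W.2.trans hU
  have hcoord : ∀ a, Y W (c.coord hWd a) = 0 := fun a => by
    rw [← c.res_coord W.2 hU, ← hY.1 ⟨U, le_rfl⟩ W W.2, h0, map_zero]
  change Y W f = 0
  refine c.ext_cf hWd fun K y hy => ?_
  rw [cf_zero]
  conv_lhs => rw [c.eq_sum hWd f]
  rw [map_sum, c.cf_sum _ _ _ hy]
  refine Finset.sum_eq_zero fun I _ => ?_
  rw [vecParity_even_mul hY W (c.pullTo_even hWd _),
    c.vecParity_thetaProd_eq_zero hU hY W (fun j => hcoord (Sum.inr j)), mul_zero, add_zero,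
    c.cf_mul hWd _ _ _ hy]
  refine Finset.sum_eq_zero fun I' _ => Finset.sum_eq_zero fun J' _ => ?_
  rw [c.cf_field_pullTo_eq_zero hU hY h0 W _ _ hy]
  simp

/-- The two sides differ by a field of parity `d` that annihilates the coordinates. -/
theorem vecParity_eq_sum (hU : U ≤ c.domain) {d : ZMod 2} {X : M.EndFamily U}
    (hX : X ∈ M.vecParity U d) : X = ∑ a, funMul (X ⟨U, le_rfl⟩ (c.coord hU a))
      (resVec hU (c.coordField a)) := by
  rw [← sub_eq_zero]
  refine c.vecParity_eq_zero hU (d := d) ?_ fun b => ?_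
  · refine Submodule.sub_mem _ hX (Submodule.sum_mem _ fun a _ => ?_)
    have h1 := funMul_mem_vecParity (hX.2.1 ⟨U, le_rfl⟩ _ _ (c.coord_mem_parity hU a))
      (resVec_mem_vecParity hU (c.coordField_mem a))
    have h2 : ∀ d e : ZMod 2, d + e + e = d := by decide
    rwa [h2] at h1
  · rw [Pi.sub_apply, LinearMap.sub_apply, sum_endFamily_apply, sub_eq_zero, Finset.sum_eq_single b]
    · rw [funMul_apply, resVec_apply, c.coordField_coord b b ⟨U, hU⟩, if_pos rfl, mul_one, res_self]
    · intro a _ hab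
      rw [funMul_apply, resVec_apply, c.coordField_coord a b ⟨U, hU⟩, if_neg hab, mul_zero]
    · simp

/-- Every vector field is `∑ X(x^a) ∂/∂x^a`. -/
theorem vec_eq_sum (hU : U ≤ c.domain) {X : M.EndFamily U} (hX : X ∈ M.vec U) :
    X = ∑ a, funMul (X ⟨U, le_rfl⟩ (c.coord hU a)) (resVec hU (c.coordField a)) := by
  obtain ⟨X₀, h₀, X₁, h₁, rfl⟩ := exists_vecParity_add hX
  conv_lhs => rw [c.vecParity_eq_sum hU h₀, c.vecParity_eq_sum hU h₁, ← Finset.sum_add_distrib]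
  refine Finset.sum_congr rfl fun a _ => ?_
  rw [← add_funMul]
  rfl

theorem vec_ext (hU : U ≤ c.domain) {X Y : M.EndFamily U} (hX : X ∈ M.vec U) (hY : Y ∈ M.vec U)
    (h : ∀ a, X ⟨U, le_rfl⟩ (c.coord hU a) = Y ⟨U, le_rfl⟩ (c.coord hU a)) : X = Y := by
  rw [c.vec_eq_sum hU hX, c.vec_eq_sum hU hY]
  exact Finset.sum_congr rfl fun a _ => by rw [h a]

/-! ### The coordinate fields satisfy their defining properties -/

theorem img_preimage_le (W : Opens (Fin p → ℝ)) : c.img (chartPreimage c.φ W) ≤ W := by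
  rintro y ⟨hy, -, hy'⟩
  simpa [c.φ.right_inv hy] using hy'

theorem pull_eq_pullTo (W : Opens (Fin p → ℝ)) (f : smoothFun W) :
    c.pull W f = c.pullTo (c.domain_preimage_le W) (smoothFun.res (c.img_preimage_le W) f) := by
  rw [pullTo, AlgHom.comp_apply, ← c.pull_res (c.img_preimage_le W), res_res, res_self]

theorem monomial_eq {W : Opens (Fin p → ℝ)} (f : smoothFun W) (L : List (Fin q)) :
    c.monomial f L = c.pullTo (c.domain_preimage_le W) (smoothFun.res (c.img_preimage_le W) f) *
      c.thetaProd (c.domain_preimage_le W) L := by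
  rw [monomial, pull_eq_pullTo]; rfl

theorem isPartialT_partialT (i : Fin p) : c.IsPartialT i (c.partialT i) := by
  refine ⟨vecParity_le_vec 0 (c.partialT_mem i), fun W hW f I => ?_⟩
  have hd := c.domain_preimage_le W
  rw [c.monomial_eq, c.monomial_eq]
  refine c.ext_cf hd fun J y hy => ?_
  have hyW := c.img_preimage_le W hy
  refine (c.cf_partialT i ⟨_, hd⟩ _ J hy).trans ?_
  rw [c.cf_monomial, c.fderiv_congr_img (fun y _ => c.cf_monomial hd _ I J) hy]
  by_cases hIJ : I = J
  · simp only [hIJ, if_true]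
    rw [smoothFun.ext0_res _ _ hy, smoothFun.ext0_apply _ hyW,
      c.fderiv_congr_img (fun y hy => smoothFun.ext0_res (c.img_preimage_le W) f hy) hy]
    rfl
  · simp [hIJ]

theorem isPartialTheta_partialTheta (j : Fin q) : c.IsPartialTheta j (c.partialTheta j) := by
  refine ⟨vecParity_le_vec 1 (c.partialTheta_mem j), fun W hW f I hj => ?_⟩
  have hd := c.domain_preimage_le W
  have h0 : c.partialTheta j ⟨chartPreimage c.φ W, hd⟩ (c.thetaProd hd I.sort) = 0 := by
    refine c.ext_cf hd fun J y hy => ?_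
    refine (c.cf_partialTheta j ⟨_, hd⟩ _ J hy).trans ?_
    rw [c.cf_thetaProd hd _ _ hy, cf_zero]
    have : I ≠ insert j J := by
      rintro rfl
      exact hj (Finset.mem_insert_self j J)
    simp [this]
  rw [c.monomial_eq, c.monomial_eq]
  constructor
  · refine (c.partialTheta_pullTo_mul j ⟨_, hd⟩ _ _).trans ?_
    exact (congrArg (fun z => _ * z) h0).trans (mul_zero _)
  · refine (c.partialTheta_pullTo_mul j ⟨_, hd⟩ _ _).trans ?_
    refine congrArg (fun z => _ * z) ?_
    rw [c.thetaProd_cons]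
    refine (c.partialTheta_theta_mul j j ⟨_, hd⟩ _).trans ?_
    rw [if_pos rfl]
    refine (congrArg (fun z => _ - _ * z) h0).trans ?_
    rw [mul_zero, sub_zero]

end Chart

end SuperRingedSpace

namespace SuperRingedSpace

namespace Chart

variable {M : SuperRingedSpace.{u}} {p q : ℕ} (c : M.Chart p q) {U V : Opens M.carrier}

/-! ### The filtration by powers of the odd ideal -/

/-- `f` has no coefficients in degrees `< k`. -/
def InFil (k : ℕ) (f : M.Sec U) : Prop :=
  ∀ I : Finset (Fin q), I.card < k → ∀ y ∈ c.img U, c.cf f I y = 0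

variable {c} in
theorem InFil.add {k : ℕ} {f g : M.Sec U} (hf : c.InFil k f) (hg : c.InFil k g) :
    c.InFil k (f + g) := fun I hI y hy => by
  rw [c.cf_add _ _ _ hy, hf I hI y hy, hg I hI y hy, add_zero]

variable {c} in
theorem InFil.smul {k : ℕ} {f : M.Sec U} (a : ℝ) (hf : c.InFil k f) :
    c.InFil k (a • f) := fun I hI y hy => by
  rw [c.cf_smul _ _ _ hy, hf I hI y hy, mul_zero]

theorem inFil_zero_section (k : ℕ) : c.InFil k (0 : M.Sec U) := fun I _ y _ => c.cf_zero I y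

theorem inFil_zero (f : M.Sec U) : c.InFil 0 f := fun I hI => by simp at hI

theorem inFil_sum {ι : Type*} {s : Finset ι} {k : ℕ} {f : ι → M.Sec U}
    (h : ∀ i ∈ s, c.InFil k (f i)) : c.InFil k (∑ i ∈ s, f i) := fun I hI y hy => by
  rw [c.cf_sum _ _ _ hy]
  exact Finset.sum_eq_zero fun i hi => h i hi I hI y hy

variable {c} in
theorem InFil.mono {k l : ℕ} (h : l ≤ k) {f : M.Sec U} (hf : c.InFil k f) : c.InFil l f :=
  fun I hI => hf I (hI.trans_le h)

variable {c} in
theorem InFil.mul (hU : U ≤ c.domain) {k l : ℕ} {f g : M.Sec U} (hf : c.InFil k f)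
    (hg : c.InFil l g) : c.InFil (k + l) (f * g) := fun K hK y hy => by
  rw [c.cf_mul hU _ _ _ hy]
  refine Finset.sum_eq_zero fun I _ => Finset.sum_eq_zero fun J _ => ?_
  split_ifs with h
  · by_cases hd : Disjoint I J
    · subst h
      rw [Finset.card_union_of_disjoint hd] at hK
      by_cases hI : I.card < k
      · rw [hf I hI y hy]; ring
      · rw [hg J (by omega) y hy]; ring
    · rw [c.sgn_of_not_disjoint hd, zero_mul]
  · rfl

variable {c} in
theorem InFil.eq_zero (hU : U ≤ c.domain) {k : ℕ} (hk : q < k) {f : M.Sec U}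
    (hf : c.InFil k f) : f = 0 :=
  c.ext_cf hU fun I y hy => by
    rw [hf I ((card_finset_fin_le I).trans_lt hk) y hy, cf_zero]

theorem inFil_thetaProd (hU : U ≤ c.domain) (L : List (Fin q)) :
    c.InFil L.length (c.thetaProd hU L) := by
  induction L with
  | nil => exact c.inFil_zero _
  | cons j L ih =>
    rw [c.thetaProd_cons, List.length_cons, add_comm]
    refine InFil.mul hU (fun I hI y hy => ?_) ih
    rw [c.thetaProd_singleton, c.cf_thetaProd hU _ _ hy, if_neg]
    rintro rfl
    simp at hI

theorem inFil_one_of_odd (hU : U ≤ c.domain) {f : M.Sec U} (hf : f ∈ M.parity U 1) :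
    c.InFil 1 f := fun I hI y hy => by
  refine c.cf_eq_zero_of_mem_parity hU hf ?_ hy
  rw [Nat.lt_one_iff.1 hI]
  simp

theorem inFil_one_iff {f : M.Sec U} : c.InFil 1 f ↔ ∀ y ∈ c.img U, c.cf f ∅ y = 0 := by
  constructor
  · exact fun h => h ∅ (by simp)
  · intro h I hI
    rw [Finset.card_eq_zero.1 (Nat.lt_one_iff.1 hI)]
    exact h

/-! ### Invertible matrices -/

/-- The body of a section. -/
noncomputable def bodyHom (hU : U ≤ c.domain) : M.Sec U →+* smoothFun (c.img U) where
  toFun f := c.coef U f ∅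
  map_one' := smoothFun.ext_of_ext0 fun y hy => by
    rw [smoothFun.ext0_one hy]
    exact (c.cf_one hU ∅ hy).trans (if_pos rfl)
  map_mul' f g := smoothFun.ext_of_ext0 fun y hy => by
    rw [smoothFun.ext0_mul _ _ hy]
    exact c.cf_mul_empty hU f g hy
  map_zero' := by rw [map_zero]; rfl
  map_add' f g := by rw [map_add]; rfl

theorem ext0_bodyHom (hU : U ≤ c.domain) (f : M.Sec U) :
    smoothFun.ext0 (c.bodyHom hU f) = c.cf f ∅ := rfl

theorem bodyHom_pullTo (hU : U ≤ c.domain) (g : smoothFun (c.img U)) :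
    c.bodyHom hU (c.pullTo hU g) = g :=
  smoothFun.ext_of_ext0 fun y _ => by rw [ext0_bodyHom, c.cf_pullTo, if_pos rfl]

theorem inFil_one_of_bodyHom (hU : U ≤ c.domain) {f : M.Sec U} (h : c.bodyHom hU f = 0) :
    c.InFil 1 f := c.inFil_one_iff.2 fun y _ => by
  rw [← c.ext0_bodyHom hU, h, smoothFun.ext0_zero]

/-- The entries of the `n`-th power lie in the `n`-th step of the filtration, and no monomial has
degree `q + 1`. -/
theorem isNilpotent_matrix {ι : Type*} [Fintype ι] [DecidableEq ι] (hU : U ≤ c.domain)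
    {A : Matrix ι ι (M.Sec U)} (hA : ∀ i j, c.InFil 1 (A i j)) : IsNilpotent A := by
  have h : ∀ n : ℕ, ∀ i j, c.InFil n ((A ^ n) i j) := by
    intro n
    induction n with
    | zero => exact fun i j => c.inFil_zero _
    | succ n ih =>
      intro i j
      rw [pow_succ, Matrix.mul_apply]
      exact c.inFil_sum fun k _ => InFil.mul hU (ih i k) (hA k j)
  exact ⟨q + 1, Matrix.ext fun i j => (h (q + 1) i j).eq_zero hU (Nat.lt_succ_self q)⟩

theorem isUnit_of_isUnit_mul {R : Type*} [Monoid R] {a b : R} (h : IsUnit (a * b))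
    (h' : IsUnit (b * a)) : IsUnit a := by
  obtain ⟨v, hv⟩ := h
  obtain ⟨w, hw⟩ := h'
  have h1 : a * (b * ↑v⁻¹) = 1 := by rw [← mul_assoc, ← hv, Units.mul_inv]
  have h2 : ↑w⁻¹ * b * a = 1 := by rw [mul_assoc, ← hw, Units.inv_mul]
  have h3 : ↑w⁻¹ * b = b * ↑v⁻¹ := left_inv_eq_right_inv h2 h1
  exact ⟨⟨a, b * ↑v⁻¹, h1, by rw [← h3, h2]⟩, rfl⟩

/-- Sections do not commute, so the determinant is used for the body only. The inverse of the body,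
lifted by pullback, inverts `A` on either side up to a nilpotent matrix. -/
theorem isUnit_matrix {ι : Type*} [Fintype ι] [DecidableEq ι] (hU : U ≤ c.domain)
    {A : Matrix ι ι (M.Sec U)} (hA : ∀ y ∈ c.img U, (A.map fun f => c.cf f ∅ y).det ≠ 0) :
    IsUnit A := by
  set A₀ := (c.bodyHom hU).mapMatrix A with hA₀
  have hdet : IsUnit A₀.det := by
    refine smoothFun.isUnit_of_ne_zero _ fun y hy => ?_
    rw [← smoothFun.evalHom_apply ⟨y, hy⟩, RingHom.map_det]
    convert! hA y hy using 2
    ext i j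
    simp only [hA₀, RingHom.mapMatrix_apply, Matrix.map_apply, smoothFun.evalHom_apply]
    rfl
  have hu := (Matrix.isUnit_iff_isUnit_det _).2 hdet
  obtain ⟨T, hT⟩ := hu
  set B : Matrix ι ι (M.Sec U) := (c.pullTo hU).toRingHom.mapMatrix (↑T⁻¹ : Matrix ι ι _) with hB
  have hB₀ : (c.bodyHom hU).mapMatrix B = (↑T⁻¹ : Matrix ι ι _) := by
    ext1 i j
    exact c.bodyHom_pullTo hU _
  have key : ∀ N : Matrix ι ι (M.Sec U), (c.bodyHom hU).mapMatrix N = 1 → IsUnit N := by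
    intro N hN
    have h1 : IsNilpotent (N - 1) := by
      refine c.isNilpotent_matrix hU fun i j => c.inFil_one_of_bodyHom hU ?_
      have h2 : (c.bodyHom hU).mapMatrix (N - 1) = 0 := by rw [map_sub, hN, map_one, sub_self]
      exact congrFun (congrFun h2 i) j
    have := h1.isUnit_one_add
    rwa [add_sub_cancel] at this
  refine isUnit_of_isUnit_mul (b := B) (key _ ?_) (key _ ?_)
  · rw [map_mul, hB₀, ← hA₀, ← hT, Units.mul_inv]
  · rw [map_mul, hB₀, ← hA₀, ← hT, Units.inv_mul]

/-- The determinant of the body is continuous, so its nonvanishing at `x` persists nearby. -/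
theorem exists_isUnit_matrix {ι : Type*} [Fintype ι] [DecidableEq ι] (hU : U ≤ c.domain)
    {x : M.carrier} (hx : x ∈ U) (A : Matrix ι ι (M.Sec U))
    (hA : (A.map fun f => c.cf f ∅ (c.φ x)).det ≠ 0) :
    ∃ (V : Opens M.carrier) (hV : V ≤ U), x ∈ V ∧ IsUnit (A.map (M.res hV)) := by
  set A₀ := (c.bodyHom hU).mapMatrix A with hA₀
  have hev : ∀ y ∈ c.img U, smoothFun.ext0 A₀.det y = (A.map fun f => c.cf f ∅ y).det := by
    intro y hy
    rw [← smoothFun.evalHom_apply ⟨y, hy⟩, RingHom.map_det]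
    congr 1
    ext i j
    simp only [hA₀, RingHom.mapMatrix_apply, Matrix.map_apply, smoothFun.evalHom_apply]
    rfl
  have hcont := (smoothFun.contDiffOn_ext0 A₀.det).continuousOn
  have hNo := hcont.isOpen_inter_preimage (c.img U).2 (isOpen_compl_singleton (x := (0 : ℝ)))
  let N : Opens (Fin p → ℝ) := ⟨_, hNo⟩
  have hN : N ≤ c.img U := fun y hy => hy.1
  have hV := c.preimage_le_of_le_img hN
  have hxU := c.mem_img (hU hx) hx
  refine ⟨chartPreimage c.φ N, hV, ⟨hU hx, hxU, ?_⟩, c.isUnit_matrix (hV.trans hU) ?_⟩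
  · rw [Set.mem_preimage, hev _ hxU]
    exact hA
  · intro y hy
    have hyN := c.img_preimage_le N hy
    have h1 : ((A.map (M.res hV)).map fun f => c.cf f ∅ y) = A.map fun f => c.cf f ∅ y := by
      ext i j
      exact c.cf_res hV _ _ hy
    rw [h1, ← hev y (hN hyN)]
    exact hyN.2

theorem exists_isUnit_res (hU : U ≤ c.domain) {x : M.carrier} (hx : x ∈ U) {f : M.Sec U}
    (hf : c.cf f ∅ (c.φ x) ≠ 0) :
    ∃ (V : Opens M.carrier) (hV : V ≤ U), x ∈ V ∧ IsUnit (M.res hV f) := by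
  obtain ⟨V, hV, hxV, h⟩ := c.exists_isUnit_matrix hU hx (Matrix.of fun _ _ : Unit => f)
    (by simpa using hf)
  exact ⟨V, hV, hxV, by simpa using h.map (Matrix.uniqueRingEquiv (m := Unit))⟩

/-! ### Values and tangent vectors -/

/-- A section is invertible near `x` if its body is nonzero at `x`, and on no neighbourhood of `x`
if its body vanishes there. Hence the choice made in `value` is forced. -/
theorem value_eq {x : M.carrier} (hx : x ∈ c.domain) (hxU : x ∈ U) (f : M.Sec U) :
    value x f = c.cf f ∅ (c.φ x) := by
  have hcf : ∀ (a : ℝ) (W : Opens M.carrier) (h : W ≤ U), x ∈ W → W ≤ c.domain →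
      c.cf (M.res h (f - algebraMap ℝ (M.Sec U) a)) ∅ (c.φ x) = c.cf f ∅ (c.φ x) - a := by
    intro a W h hxW hW
    have hxi := c.mem_img hx hxW
    rw [map_sub, AlgHom.commutes, Algebra.algebraMap_eq_smul_one, c.cf_sub _ _ _ hxi,
      c.cf_smul _ _ _ hxi, c.cf_one hW _ hxi, c.cf_res h _ _ hxi]
    simp
  have hP : ∃ a : ℝ, ∀ (W : Opens M.carrier) (h : W ≤ U), x ∈ W →
      ¬ IsUnit (M.res h (f - algebraMap ℝ (M.Sec U) a)) := by
    refine ⟨c.cf f ∅ (c.φ x), fun W h hxW hu => ?_⟩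
    have hW' : W ⊓ c.domain ≤ c.domain := inf_le_right
    have hxW' : x ∈ W ⊓ c.domain := ⟨hxW, hx⟩
    have h2 := hu.map (M.res (inf_le_left : W ⊓ c.domain ≤ W))
    rw [res_res] at h2
    obtain ⟨g, hg⟩ := h2.exists_right_inv
    have h3 := congrArg (fun k => c.cf k ∅ (c.φ x)) hg
    rw [c.cf_mul_empty hW' _ _ (c.mem_img hx hxW'), hcf _ _ _ hxW' hW',
      c.cf_one hW' _ (c.mem_img hx hxW')] at h3
    simp at h3
  have hspec := Classical.epsilon_spec hP
  by_contra hne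
  have hU' : U ⊓ c.domain ≤ c.domain := inf_le_right
  have hxU' : x ∈ U ⊓ c.domain := ⟨hxU, hx⟩
  obtain ⟨V, hV, hxV, h⟩ := c.exists_isUnit_res hU' hxU'
    (f := M.res inf_le_left (f - algebraMap ℝ (M.Sec U) (value x f)))
    (by rw [hcf _ _ _ hxU' hU']; exact sub_ne_zero.2 (Ne.symm hne))
  rw [res_res] at h
  exact hspec V (hV.trans inf_le_left) hxV h

/-- The components at `x` of a vector field. -/
noncomputable def comp (x : M.carrier) (X : M.EndFamily U) (a : Fin p ⊕ Fin q) : ℝ :=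
  c.cf (X ⟨U ⊓ c.domain, inf_le_left⟩ (c.coord inf_le_right a)) ∅ (c.φ x)

/-- The components at `x` of the differential of a function. -/
noncomputable def dAt (x : M.carrier) (f : M.Sec U) : Fin p ⊕ Fin q → ℝ :=
  Sum.elim (fun i => fderiv ℝ (c.cf f ∅) (c.φ x) (Pi.single i 1)) (fun j => c.cf f {j} (c.φ x))

theorem cf_coordField_empty {x : M.carrier} (W : {W : Opens M.carrier // W ≤ c.domain})
    (hx : x ∈ W.1) (f : M.Sec W.1) (a : Fin p ⊕ Fin q) :
    c.cf (c.coordField a W f) ∅ (c.φ x) = c.dAt x f a := by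
  have hxi := c.mem_img (W.2 hx) hx
  rcases a with i | j
  · exact c.cf_partialT i W f ∅ hxi
  · refine (c.cf_partialTheta j W f ∅ hxi).trans ?_
    simp [c.sgn_empty_right, dAt]

theorem dAt_res {x : M.carrier} (h : V ≤ U) (hx : x ∈ c.domain) (hxV : x ∈ V) (f : M.Sec U) :
    c.dAt x (M.res h f) = c.dAt x f := by
  have hxi := c.mem_img hx hxV
  ext a
  rcases a with i | j
  · change fderiv ℝ _ _ _ = fderiv ℝ _ _ _
    rw [c.fderiv_congr_img (fun y hy => c.cf_res h f ∅ hy) hxi]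
  · exact c.cf_res h f _ hxi

theorem comp_res {x : M.carrier} (h : V ≤ U) (hx : x ∈ c.domain) (hxV : x ∈ V)
    {X : M.EndFamily U} (hX : X ∈ M.vec U) (a : Fin p ⊕ Fin q) :
    c.comp x (resVec h X) a = c.comp x X a := by
  have hle : V ⊓ c.domain ≤ U ⊓ c.domain := inf_le_inf_right _ h
  have hxi := c.mem_img hx (show x ∈ V ⊓ c.domain from ⟨hxV, hx⟩)
  rw [comp, comp, ← c.cf_res hle _ _ hxi,
    vec_res hX ⟨U ⊓ c.domain, inf_le_left⟩ ⟨V ⊓ c.domain, inf_le_left.trans h⟩ hle, c.res_coord]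
  rfl

theorem comp_eq (hU : U ≤ c.domain) {x : M.carrier} (hx : x ∈ U)
    {X : M.EndFamily U} (hX : X ∈ M.vec U) (a : Fin p ⊕ Fin q) :
    c.comp x X a = c.cf (X ⟨U, le_rfl⟩ (c.coord hU a)) ∅ (c.φ x) := by
  have hle : U ⊓ c.domain ≤ U := inf_le_left
  have hxi := c.mem_img (hU hx) (show x ∈ U ⊓ c.domain from ⟨hx, hU hx⟩)
  rw [comp, ← c.cf_res hle _ _ hxi,
    vec_res hX ⟨U, le_rfl⟩ ⟨U ⊓ c.domain, inf_le_left⟩ hle, c.res_coord]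

/-- Taking the body at `x` is multiplicative, so the expansion of `X` in coordinate fields can be
evaluated factor by factor. -/
theorem cf_vec_empty (hU : U ≤ c.domain) {x : M.carrier} (hx : x ∈ U)
    {X : M.EndFamily U} (hX : X ∈ M.vec U) (f : M.Sec U) :
    c.cf (X ⟨U, le_rfl⟩ f) ∅ (c.φ x) = ∑ a, c.comp x X a * c.dAt x f a := by
  have hxi := c.mem_img (hU hx) hx
  conv_lhs => rw [c.vec_eq_sum hU hX]
  rw [sum_endFamily_apply, c.cf_sum _ _ _ hxi]
  refine Finset.sum_congr rfl fun a _ => ?_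
  rw [funMul_apply, resVec_apply, c.cf_mul_empty hU _ _ hxi, res_self,
    c.cf_coordField_empty ⟨U, hU⟩ hx, c.comp_eq hU hx hX]

theorem tangentAt_eq {x : M.carrier} (hx : x ∈ c.domain) (hxU : x ∈ U) {X : M.EndFamily U}
    (hX : X ∈ M.vec U) (f : Σ W : {W : Opens M.carrier // x ∈ W}, M.Sec W.1) :
    tangentAt x X f = ∑ a, c.comp x X a * c.dAt x f.2 a := by
  obtain ⟨⟨W, hxW⟩, f⟩ := f
  have hxWU : x ∈ W ⊓ U := ⟨hxW, hxU⟩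
  rw [tangentAt, c.value_eq hx hxWU]
  set V := W ⊓ U ⊓ c.domain with hV
  have hxV : x ∈ V := ⟨hxWU, hx⟩
  have hVd : V ≤ c.domain := inf_le_right
  have hVU : V ≤ U := inf_le_left.trans inf_le_right
  rw [← c.cf_res (inf_le_left : V ≤ W ⊓ U) _ _ (c.mem_img hx hxV),
    vec_res hX ⟨W ⊓ U, inf_le_right⟩ ⟨V, hVU⟩ inf_le_left, res_res]
  have h := c.cf_vec_empty hVd hxV (resVec_mem_vec hVU hX) (M.res (inf_le_left.trans inf_le_left) f)
  rw [c.dAt_res _ hx hxV] at h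
  simp only [c.comp_res hVU hx hxV hX] at h
  exact h

theorem dAt_coord (hU : U ≤ c.domain) {x : M.carrier} (hx : x ∈ U) (a b : Fin p ⊕ Fin q) :
    c.dAt x (c.coord hU b) a = if a = b then 1 else 0 := by
  have hxi := c.mem_img (hU hx) hx
  rw [← c.cf_coordField_empty ⟨U, hU⟩ hx, c.coordField_coord a b ⟨U, hU⟩]
  split_ifs
  · rw [c.cf_one hU _ hxi, if_pos rfl]
  · exact c.cf_zero _ _

theorem comp_eq_zero_of_parity {x : M.carrier} (hx : x ∈ c.domain) (hxU : x ∈ U) {d : ZMod 2}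
    {X : M.EndFamily U} (hX : X ∈ M.vecParity U d) {a : Fin p ⊕ Fin q} (ha : coordParity a ≠ d) :
    c.comp x X a = 0 := by
  have hxi := c.mem_img hx (show x ∈ U ⊓ c.domain from ⟨hxU, hx⟩)
  have h := hX.2.1 ⟨U ⊓ c.domain, inf_le_left⟩ _ _ (c.coord_mem_parity inf_le_right a)
  have hne : ∀ d e : ZMod 2, e ≠ d → 0 ≠ d + e := by decide
  exact c.cf_eq_zero_of_mem_parity inf_le_right h (by simpa using hne _ _ ha) hxi

/-- The tangent vector with given components, as a functional on functions near `x`. -/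
noncomputable def tangentOf (x : M.carrier) : (Fin p ⊕ Fin q → ℝ) →ₗ[ℝ]
    ((Σ W : {W : Opens M.carrier // x ∈ W}, M.Sec W.1) → ℝ) where
  toFun v f := ∑ a, v a * c.dAt x f.2 a
  map_add' v w := by ext f; simp [add_mul, Finset.sum_add_distrib]
  map_smul' r v := by 
    ext f
    simp only [Pi.smul_apply, smul_eq_mul, mul_assoc, Finset.mul_sum, RingHom.id_apply]

theorem tangentOf_injective {x : M.carrier} (hx : x ∈ c.domain) :
    Function.Injective (c.tangentOf x) := by
  rw [injective_iff_map_eq_zero]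
  intro v hv
  ext b
  have h := congrFun hv ⟨⟨c.domain, hx⟩, c.coord le_rfl b⟩
  simp only [tangentOf, LinearMap.coe_mk, AddHom.coe_mk, Pi.zero_apply] at h
  simpa [c.dAt_coord le_rfl hx] using h

/-- Tangent vectors act through the differential of a function. This replaces the fibre, a space of
functionals, by a space of component vectors, in which ranks can be counted. -/
theorem fibre_eq_map (D : M.Distribution) {x : M.carrier} (hx : x ∈ c.domain) (d : ZMod 2) :
    D.fibre x d = (Submodule.span ℝ {v | ∃ U : Opens M.carrier, x ∈ U ∧
      ∃ X ∈ D.sec U ⊓ M.vecParity U d, v = c.comp x X}).map (c.tangentOf x) := by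
  rw [Submodule.map_span, Distribution.fibre]
  congr 1
  ext f
  constructor
  · rintro ⟨U, hxU, X, hX, rfl⟩
    exact ⟨_, ⟨U, hxU, X, hX, rfl⟩,
      funext fun f => (c.tangentAt_eq hx hxU (vecParity_le_vec d hX.2) f).symm⟩
  · rintro ⟨_, ⟨U, hxU, X, hX, rfl⟩, rfl⟩
    exact ⟨U, hxU, X, hX,
      funext fun f => (c.tangentAt_eq hx hxU (vecParity_le_vec d hX.2) f).symm⟩

theorem finrank_span_comp (D : M.Distribution) {x : M.carrier} (hx : x ∈ c.domain) (d : ZMod 2)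
    {n : ℕ} (h : Module.rank ℝ (D.fibre x d) = n) :
    Module.finrank ℝ (Submodule.span ℝ {v | ∃ U : Opens M.carrier, x ∈ U ∧
      ∃ X ∈ D.sec U ⊓ M.vecParity U d, v = c.comp x X}) = n := by
  rw [c.fibre_eq_map D hx d] at h
  rw [← Module.finrank_eq_of_rank_eq h]
  exact LinearEquiv.finrank_eq (Submodule.equivMapOfInjective _ (c.tangentOf_injective hx) _)

end Chart

end SuperRingedSpace

/-! ### Change of the odd coordinates -/

namespace smoothFun

variable {p : ℕ} {W W' : Opens (Fin p → ℝ)}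

theorem res_bijective (h : W' ≤ W) (h' : W ≤ W') : Function.Bijective (smoothFun.res h) := by
  obtain rfl := le_antisymm h h'
  exact Function.bijective_id

end smoothFun

namespace SuperRingedSpace

section OddProducts

variable {M : SuperRingedSpace.{u}} {U : Opens M.carrier} {q : ℕ} {η : Fin q → M.Sec U}

theorem oddProd_perm (hη : ∀ j, η j ∈ M.parity U 1) {L L' : List (Fin q)} (h : L.Perm L') :
    ∃ ε : ℝ, (L.map η).prod = ε • (L'.map η).prod := by
  induction h with
  | nil => exact ⟨1, by simp⟩
  | @cons j l₁ l₂ _ ih =>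
    obtain ⟨ε, h⟩ := ih
    exact ⟨ε, by rw [List.map_cons, List.prod_cons, h, List.map_cons, List.prod_cons,
      mul_smul_comm]⟩
  | swap j k L =>
    refine ⟨-1, ?_⟩
    simp only [List.map_cons, List.prod_cons]
    rw [← mul_assoc, ← mul_assoc, odd_mul_comm (hη k) (hη j), neg_mul, neg_one_smul]
  | trans _ _ ih ih' =>
    obtain ⟨ε, h⟩ := ih
    obtain ⟨δ, h'⟩ := ih'
    exact ⟨ε * δ, by rw [h, h', smul_smul]⟩

theorem oddProd_eq_zero (hη : ∀ j, η j ∈ M.parity U 1) {L : List (Fin q)} (h : ¬ L.Nodup) :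
    (L.map η).prod = 0 := by
  obtain ⟨j, hj⟩ := List.exists_duplicate_iff_not_nodup.2 h
  obtain ⟨L', hL'⟩ := (List.duplicate_iff_sublist.1 hj).exists_perm_append
  obtain ⟨ε, h⟩ := oddProd_perm hη hL'
  have h2 : ([j, j].map η).prod = 0 := by
    simpa using odd_mul_self (hη j)
  rw [h, List.map_append, List.prod_append, h2, zero_mul, smul_zero]

end OddProducts

namespace Chart

variable {M : SuperRingedSpace.{u}} {p q : ℕ} (c : M.Chart p q) {U V : Opens M.carrier}

/-- `f` is a combination of ordered products of the `η j` with coefficients depending on the even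
coordinates only. -/
def InOddSpan (hU : U ≤ c.domain) (η : Fin q → M.Sec U) (f : M.Sec U) : Prop :=
  ∃ g : Finset (Fin q) → smoothFun (c.img U), f = ∑ J, c.pullTo hU (g J) * (J.sort.map η).prod

variable {c} {hU : U ≤ c.domain} {η : Fin q → M.Sec U}

theorem InOddSpan.add {f g : M.Sec U} (hf : c.InOddSpan hU η f) (hg : c.InOddSpan hU η g) :
    c.InOddSpan hU η (f + g) := by
  obtain ⟨a, rfl⟩ := hf
  obtain ⟨b, rfl⟩ := hg
  exact ⟨fun J => a J + b J, by simp only [map_add, add_mul, Finset.sum_add_distrib]⟩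

theorem inOddSpan_zero : c.InOddSpan hU η 0 := ⟨fun _ => 0, by simp⟩

theorem inOddSpan_sum {ι : Type*} {s : Finset ι} {f : ι → M.Sec U}
    (h : ∀ i ∈ s, c.InOddSpan hU η (f i)) : c.InOddSpan hU η (∑ i ∈ s, f i) := by
  classical
  induction s using Finset.induction_on with
  | empty => simpa using inOddSpan_zero
  | insert a s ha ih =>
    rw [Finset.sum_insert ha]
    exact (h a (Finset.mem_insert_self a s)).add
      (ih fun i hi => h i (Finset.mem_insert_of_mem hi))

theorem InOddSpan.pullTo_mul {f : M.Sec U} (hf : c.InOddSpan hU η f) (b : smoothFun (c.img U)) :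
    c.InOddSpan hU η (c.pullTo hU b * f) := by
  obtain ⟨a, rfl⟩ := hf
  exact ⟨fun J => b * a J, by simp only [map_mul, Finset.mul_sum, mul_assoc]⟩

theorem inOddSpan_prod (hη : ∀ j, η j ∈ M.parity U 1) (L : List (Fin q)) :
    c.InOddSpan hU η (L.map η).prod := by
  classical
  by_cases h : L.Nodup
  · obtain ⟨ε, hε⟩ := oddProd_perm hη (List.perm_of_nodup_nodup_toFinset_eq h
      (Finset.sort_nodup L.toFinset (· ≤ ·)) (by simp) : L.Perm L.toFinset.sort)
    refine ⟨Pi.single L.toFinset (algebraMap ℝ _ ε), ?_⟩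
    rw [Finset.sum_eq_single L.toFinset (fun K _ hK => by rw [Pi.single_eq_of_ne hK]; simp)
      (fun h => absurd (Finset.mem_univ _) h), Pi.single_eq_same, AlgHom.commutes, hε,
      Algebra.algebraMap_eq_smul_one, smul_one_mul]
  · rw [oddProd_eq_zero hη h]
    exact inOddSpan_zero

theorem InOddSpan.odd_mul (hη : ∀ j, η j ∈ M.parity U 1) {f : M.Sec U}
    (hf : c.InOddSpan hU η f) (j : Fin q) : c.InOddSpan hU η (η j * f) := by
  obtain ⟨a, rfl⟩ := hf
  rw [Finset.mul_sum]
  refine inOddSpan_sum fun J _ => ?_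
  rw [← mul_assoc, ← even_mul_comm (c.pullTo_even hU (a J)), mul_assoc]
  exact (inOddSpan_prod hη (j :: J.sort)).pullTo_mul (a J)

variable (c)

/-- The coefficients come from the inverse of the matrix of linear parts: degree zero is absent by
oddness, and degree one cancels. -/
theorem exists_theta_sub_inFil (hU : U ≤ c.domain) (hη : ∀ j, η j ∈ M.parity U 1)
    (hE : IsUnit (Matrix.of fun j l => c.coef U (η j) {l})) (l : Fin q) :
    ∃ G : Fin q → smoothFun (c.img U),
      c.InFil 2 (c.thetaProd hU [l] - ∑ j, c.pullTo hU (G j) * η j) := by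
  obtain ⟨T, hT⟩ := hE
  refine ⟨fun j => (↑T⁻¹ : Matrix _ _ _) l j, fun I hI y hy => ?_⟩
  have hc : I.card = 0 ∨ I.card = 1 := by omega
  rw [c.cf_sub _ _ _ hy, c.cf_sum _ _ _ hy, c.thetaProd_singleton, c.cf_thetaProd hU _ _ hy]
  simp only [c.cf_pullTo_mul hU _ _ _ hy]
  rcases hc with h0 | h1
  · rw [Finset.card_eq_zero.1 h0]
    have : ∀ j, c.cf (η j) ∅ y = 0 := fun j =>
      c.cf_eq_zero_of_mem_parity hU (hη j) (by simp) hy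
    simp [this]
  · obtain ⟨m, rfl⟩ := Finset.card_eq_one.1 h1
    have h2 : (↑T⁻¹ : Matrix _ _ _) * (Matrix.of fun j l => c.coef U (η j) {l}) = 1 := by
      rw [← hT, Units.inv_mul]
    have h3 := congrFun (congrFun h2 l) m
    rw [Matrix.mul_apply] at h3
    have h4 := congrArg (smoothFun.evalHom ⟨y, hy⟩) h3
    simp only [map_sum, map_mul, smoothFun.evalHom_apply, Matrix.of_apply] at h4
    rw [sub_eq_zero]
    refine Eq.trans ?_ h4.symm
    rw [Matrix.one_apply]
    by_cases hlm : l = m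
    · subst hlm
      simp [smoothFun.ext0_one hy]
    · rw [if_neg hlm, if_neg (by simpa using hlm), smoothFun.ext0_zero]

/-- Factors are replaced one at a time. Each error lies a degree above the factor it replaces while
the other factors keep their degree, so the total error lies above the degree of the monomial. -/
theorem exists_thetaProd_sub_inFil (hU : U ≤ c.domain) (hη : ∀ j, η j ∈ M.parity U 1)
    (hE : IsUnit (Matrix.of fun j l => c.coef U (η j) {l})) (L : List (Fin q)) :
    ∃ f, c.InOddSpan hU η f ∧ c.InFil (L.length + 1) (c.thetaProd hU L - f) := by
  induction L with
  | nil =>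
    refine ⟨1, by simpa using inOddSpan_prod (hU := hU) hη [], ?_⟩
    rw [thetaProd_nil, sub_self]
    exact c.inFil_zero_section _
  | cons l L ih =>
    obtain ⟨f, hf, hL⟩ := ih
    obtain ⟨G, hG⟩ := c.exists_theta_sub_inFil hU hη hE l
    refine ⟨(∑ j, c.pullTo hU (G j) * η j) * f, ?_, ?_⟩
    · rw [Finset.sum_mul]
      refine inOddSpan_sum fun j _ => ?_
      rw [mul_assoc]
      exact (hf.odd_mul hη j).pullTo_mul (G j)
    · have h1 : c.thetaProd hU (l :: L) - (∑ j, c.pullTo hU (G j) * η j) * f =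
          (c.thetaProd hU [l] - ∑ j, c.pullTo hU (G j) * η j) * c.thetaProd hU L +
            (∑ j, c.pullTo hU (G j) * η j) * (c.thetaProd hU L - f) := by
        rw [c.thetaProd_cons]
        noncomm_ring
      rw [h1]
      refine InFil.add ?_ ?_
      · exact (hG.mul hU (c.inFil_thetaProd hU L)).mono (by simp; omega)
      · have h2 : c.InFil 1 (∑ j, c.pullTo hU (G j) * η j) := c.inFil_sum fun j _ => by
          simpa using (c.inFil_zero (c.pullTo hU (G j))).mul hU (c.inFil_one_of_odd hU (hη j))
        exact (h2.mul hU hL).mono (by simp)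

/-- Successive approximation: rewriting the monomials of `f` in the `η j` leaves a remainder one
step further in the filtration, and nothing is left beyond degree `q`. The number `m` bounds the
steps still to be made. -/
theorem inOddSpan_of_isUnit (hU : U ≤ c.domain) (hη : ∀ j, η j ∈ M.parity U 1)
    (hE : IsUnit (Matrix.of fun j l => c.coef U (η j) {l})) (f : M.Sec U) :
    c.InOddSpan hU η f := by
  suffices H : ∀ m k, q + 1 ≤ k + m → ∀ f : M.Sec U, c.InFil k f → c.InOddSpan hU η f from
    H (q + 1) 0 (by omega) f (c.inFil_zero f)
  intro m
  induction m with
  | zero =>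
    intro k hk f hf
    rw [hf.eq_zero hU (by omega)]
    exact inOddSpan_zero
  | succ m ih =>
    intro k hk f hf
    rw [c.eq_sum hU f]
    refine inOddSpan_sum fun I _ => ?_
    by_cases hI : I.card < k
    · have : c.coef U f I = 0 := smoothFun.ext_of_ext0 fun y hy => by
        rw [smoothFun.ext0_zero]; exact hf I hI y hy
      rw [this, map_zero, zero_mul]
      exact inOddSpan_zero
    · obtain ⟨g, hg, hI'⟩ := c.exists_thetaProd_sub_inFil hU hη hE I.sort
      have h1 : c.thetaProd hU I.sort = g + (c.thetaProd hU I.sort - g) := by abel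
      rw [h1]
      refine InOddSpan.pullTo_mul (hg.add (ih (k + 1) (by omega) _ (hI'.mono ?_))) _
      rw [Finset.length_sort]
      omega

/-- Surjectivity is `inOddSpan_of_isUnit`, and injectivity follows from it: the matrices passing
between monomials in `θ` and in `η` are square with entries in the commutative ring of smooth
functions, where a one-sided inverse is two-sided. -/
theorem oddProd_bijective (hU : U ≤ c.domain) (hη : ∀ j, η j ∈ M.parity U 1)
    (hE : IsUnit (Matrix.of fun j l => c.coef U (η j) {l})) :
    Function.Bijective fun g : Finset (Fin q) → smoothFun (c.img U) =>
      ∑ J, c.pullTo hU (g J) * (J.sort.map η).prod := by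
  classical
  constructor
  · choose B hB using fun K : Finset (Fin q) =>
      c.inOddSpan_of_isUnit hU hη hE (c.thetaProd hU K.sort)
    let C : Matrix (Finset (Fin q)) (Finset (Fin q)) (smoothFun (c.img U)) :=
      Matrix.of fun J K => c.coef U (J.sort.map η).prod K
    have hexp : ∀ g : Finset (Fin q) → smoothFun (c.img U),
        ∑ J, c.pullTo hU (g J) * (J.sort.map η).prod =
          ∑ K, c.pullTo hU ((Matrix.vecMul g C) K) * c.thetaProd hU K.sort := by
      intro g
      have : ∀ J : Finset (Fin q), c.pullTo hU (g J) * (J.sort.map η).prod =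
          ∑ K, c.pullTo hU (g J * C J K) * c.thetaProd hU K.sort := by
        intro J
        refine (congrArg _ (c.eq_sum hU (J.sort.map η).prod)).trans ?_
        rw [Finset.mul_sum]
        refine Finset.sum_congr rfl fun K _ => ?_
        rw [map_mul, mul_assoc]
        rfl
      simp only [this]
      rw [Finset.sum_comm]
      refine Finset.sum_congr rfl fun K _ => ?_
      rw [Matrix.vecMul, dotProduct, map_sum, Finset.sum_mul]
    have hBC : (Matrix.of B) * C = 1 := by
      ext1 K L
      have h1 := hB K
      rw [hexp] at h1
      have h2 := c.coef_sum hU (Matrix.vecMul (B K) C)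
      rw [← h1] at h2
      have h3 := congrFun h2 L
      have h4 := c.coef_monomial hU 1 K L
      rw [map_one, one_mul] at h4
      rw [Matrix.one_apply, ← h4, h3]
      rfl
    have hCB := mul_eq_one_comm.1 hBC
    intro g g' h
    simp only [hexp] at h
    have h1 := c.coef_sum hU (Matrix.vecMul g C)
    rw [h, c.coef_sum hU] at h1
    have h2 := congrArg (fun v => Matrix.vecMul v (Matrix.of B)) h1
    simpa only [Matrix.vecMul_vecMul, hCB, Matrix.vecMul_one] using h2.symm
  · intro f
    obtain ⟨g, hg⟩ := c.inOddSpan_of_isUnit hU hη hE f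
    exact ⟨g, hg.symm⟩

/-- One neighbourhood serves all smaller open sets, since units restrict to units. The matrix of
functions is turned into a matrix of sections by pullback, so that `exists_isUnit_matrix` applies,
and is recovered as its body. -/
theorem exists_isUnit_odd (hU : U ≤ c.domain) {x : M.carrier} (hx : x ∈ U) (η : Fin q → M.Sec U)
    (hdet : (Matrix.of fun j l => c.cf (η j) {l} (c.φ x)).det ≠ 0) :
    ∃ (V : Opens M.carrier) (hV : V ≤ U), x ∈ V ∧ ∀ (V' : Opens M.carrier) (h : V' ≤ V),
      IsUnit (Matrix.of fun j l => c.coef V' (M.res (h.trans hV) (η j)) {l}) := by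
  obtain ⟨V, hV, hxV, hu⟩ := c.exists_isUnit_matrix hU hx
    (Matrix.of fun j l => c.pullTo hU (c.coef U (η j) {l})) (by
      convert! hdet using 2
      ext j l
      simp only [Matrix.map_apply, Matrix.of_apply, c.cf_pullTo, if_true]
      rfl)
  refine ⟨V, hV, hxV, fun V' h => ?_⟩
  have h1 := hu.map (((c.bodyHom (h.trans (hV.trans hU))).comp (M.res h).toRingHom).mapMatrix)
  convert! h1 using 1
  ext1 j l
  simp only [RingHom.mapMatrix_apply, Matrix.map_apply, Matrix.of_apply, RingHom.comp_apply]
  change _ = c.bodyHom _ (M.res h (M.res hV (c.pullTo hU (c.coef U (η j) {l}))))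
  rw [res_res, c.res_pullTo, c.bodyHom_pullTo, c.coef_res]

/-- Nonempty products of odd functions have zero body. Therefore bodies do not change when only the
odd coordinates are replaced. -/
theorem cf_oddProd_empty (hU : U ≤ c.domain) (hη : ∀ j, η j ∈ M.parity U 1)
    (g : Finset (Fin q) → smoothFun (c.img U)) {y : Fin p → ℝ} (hy : y ∈ c.img U) :
    c.cf (∑ J, c.pullTo hU (g J) * (J.sort.map η).prod) ∅ y = smoothFun.ext0 (g ∅) y := by
  have hnil : ∀ L : List (Fin q), L ≠ [] → c.cf (L.map η).prod ∅ y = 0 := by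
    intro L hL
    cases L with
    | nil => exact absurd rfl hL
    | cons j L =>
      rw [List.map_cons, List.prod_cons, c.cf_mul_empty hU _ _ hy,
        c.cf_eq_zero_of_mem_parity hU (hη j) (by simp) hy, zero_mul]
  rw [c.cf_sum _ _ _ hy, Finset.sum_eq_single ∅]
  · rw [Finset.sort_empty, List.map_nil, List.prod_nil, mul_one, c.cf_pullTo, if_pos rfl]
  · intro J _ hJ
    rw [c.cf_mul_empty hU _ _ hy, hnil _ ?_, mul_zero]
    intro h
    apply hJ
    have := congrArg List.length h
    rw [Finset.length_sort] at this
    exact Finset.card_eq_zero.1 this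
  · simp

/-- Odd functions with linearly independent differentials are the odd coordinates of a chart with
the same even coordinates. -/
theorem exists_chart_odd (hU : U ≤ c.domain) {x : M.carrier} (hx : x ∈ U) {η : Fin q → M.Sec U}
    (hη : ∀ j, η j ∈ M.parity U 1)
    (hdet : (Matrix.of fun j l => c.cf (η j) {l} (c.φ x)).det ≠ 0) :
    ∃ (c' : M.Chart p q) (h' : c'.domain ≤ U), x ∈ c'.domain ∧ c'.φ x = c.φ x ∧
      (∀ j, c'.thetaDom j = M.res h' (η j)) ∧
      ∀ (V : Opens M.carrier), V ≤ c'.domain → ∀ (f : M.Sec V), c'.img V = c.img V ∧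
        ∀ y ∈ c.img V, c'.cf f ∅ y = c.cf f ∅ y := by
  obtain ⟨V, hV, hxV, hu⟩ := c.exists_isUnit_odd hU hx η hdet
  let φ' := c.φ.restrOpen V V.2
  have hsrc : (⟨φ'.source, φ'.open_source⟩ : Opens M.carrier) ≤ V := fun _ hz => hz.2
  have hle : ∀ W, chartPreimage φ' W ≤ chartPreimage c.φ W := fun W z hz => ⟨hz.1.1, hz.2⟩
  have hleU : ∀ W, chartPreimage φ' W ≤ U := fun W =>
    (chartPreimage_le φ' W).trans (hsrc.trans hV)
  have himg : ∀ W, c.img (chartPreimage φ' W) ≤ W := fun W =>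
    (c.img_mono (hle W)).trans (c.img_preimage_le W)
  have hpt : ∀ (W) (f : smoothFun W), M.res (hle W) (c.pull W f) =
      c.pullTo ((hleU W).trans hU) (smoothFun.res (himg W) f) := by
    intro W f
    rw [c.pull_eq_pullTo, c.res_pullTo]
    rfl
  let c' : M.Chart p q :=
    { φ := φ'
      pull := fun W => (M.res (hle W)).comp (c.pull W)
      pull_even := fun W f => res_mem_parity _ (c.pull_even W f)
      pull_res := fun {W W'} h f => by
        rw [AlgHom.comp_apply, AlgHom.comp_apply, res_res, ← c.pull_res h, res_res]
      θ := fun j => M.res (hsrc.trans hV) (η j)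
      θ_odd := fun j => res_mem_parity _ (hη j)
      bijective := by
        intro W hW
        have hWi : W ≤ c.img (chartPreimage φ' W) := by
          intro y hy
          have hy1 : y ∈ φ'.target := hW hy
          have h2 := φ'.map_target hy1
          have h3 : φ'.symm y = c.φ.symm y := rfl
          have h4 : y ∈ c.φ.target := by
            have := c.φ.map_source h2.1
            rwa [h3, c.φ.right_inv] at this
            exact hy1.1
          refine ⟨h4, h2, ?_⟩
          change c.φ (c.φ.symm y) ∈ W
          rwa [c.φ.right_inv h4]
        have hb := c.oddProd_bijective ((hleU W).trans hU)
          (fun j => res_mem_parity (hleU W) (hη j))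
          (hu (chartPreimage φ' W) ((chartPreimage_le φ' W).trans hsrc))
        -- The image of the preimage of `W` is `W` itself, as `W` lies in the target; the
        -- coefficient functions change only their nominal domain.
        have hb2 : Function.Bijective fun (f : Finset (Fin q) → smoothFun W) (I : Finset (Fin q)) =>
            smoothFun.res (himg W) (f I) := by
          have h := smoothFun.res_bijective (himg W) hWi
          exact ⟨fun f g hfg => funext fun I => h.1 (congrFun hfg I),
            fun g => ⟨fun I => (h.2 (g I)).choose, funext fun I => (h.2 (g I)).choose_spec⟩⟩
        convert! hb.comp hb2 using 1
        funext f
        simp only [Function.comp_apply, AlgHom.comp_apply, hpt]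
        refine Finset.sum_congr rfl fun I _ => ?_
        rw [map_list_prod, List.map_map]
        congr 3
        funext j
        exact res_res _ _ _ }
  have hdom : c'.domain ≤ U := hsrc.trans hV
  have himg' : ∀ V, V ≤ c'.domain → c'.img V = c.img V := by
    intro V hV'
    ext y
    constructor
    · intro hy
      exact ⟨hy.1.1, hy.2⟩
    · intro hy
      exact ⟨⟨hy.1, (hV' hy.2).2⟩, hy.2⟩
  refine ⟨c', hdom, ⟨hU hx, hxV⟩, rfl, fun j => rfl, fun V hVc f => ⟨himg' V hVc, ?_⟩⟩
  intro y hy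
  have hVU := hVc.trans hdom
  have hle2 : c.img V ≤ c'.img V := (himg' V hVc).ge
  -- Both charts pull smooth functions back in the same way, so the expansion in the new chart reads
  -- in the old one as an expansion in products of the `η j`, whose body is known.
  have hsum : f = ∑ J, c.pullTo (hVU.trans hU) (smoothFun.res hle2 (c'.coef V f J)) *
      (J.sort.map fun j => M.res hVU (η j)).prod := by
    conv_lhs => rw [c'.eq_sum hVc f]
    refine Finset.sum_congr rfl fun J _ => ?_
    congr 1
    · change M.res _ (M.res _ (c.pull _ _)) = M.res _ (c.pull _ _)
      rw [res_res, ← c.pull_res hle2, res_res]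
    · rw [thetaProd, map_list_prod, List.map_map]
      congr 2
      funext j
      exact res_res _ _ _
  conv_rhs => rw [hsum]
  rw [c.cf_oddProd_empty (hVU.trans hU) (fun j => res_mem_parity _ (hη j)) _ hy,
    smoothFun.ext0_res hle2 _ hy]
  rfl

end Chart

end SuperRingedSpace

/-! ### Change of the even coordinates -/

namespace smoothFun

variable {p : ℕ} {W W' : Opens (Fin p → ℝ)}

theorem ext0_pderiv (i : Fin p) (f : smoothFun W) {y : Fin p → ℝ} (hy : y ∈ W) :
    ext0 (smoothFun.pderiv i f) y = fderiv ℝ (ext0 f) y (Pi.single i 1) := ext0_apply _ hy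

theorem differentiableAt_ext0 (f : smoothFun W) {y : Fin p → ℝ} (hy : y ∈ W) :
    DifferentiableAt ℝ (ext0 f) y :=
  ((contDiffOn_ext0 f).contDiffAt (W.2.mem_nhds hy)).differentiableAt (by simp)

theorem fderiv_congr {F G : (Fin p → ℝ) → ℝ} (h : ∀ y ∈ W, F y = G y) {y : Fin p → ℝ}
    (hy : y ∈ W) : fderiv ℝ F y = fderiv ℝ G y :=
  Filter.EventuallyEq.fderiv_eq (Filter.eventually_of_mem (W.2.mem_nhds hy) h)

/-- The partial derivative as a linear map. -/
noncomputable def pderivLin (i : Fin p) : smoothFun W →ₗ[ℝ] smoothFun W where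
  toFun := smoothFun.pderiv i
  map_add' f g := ext_of_ext0 fun y hy => by
    rw [ext0_add _ _ hy, ext0_pderiv _ _ hy, ext0_pderiv _ _ hy, ext0_pderiv _ _ hy,
      fderiv_congr (G := ext0 f + ext0 g) (fun z hz => ext0_add f g hz) hy,
      fderiv_add (differentiableAt_ext0 f hy) (differentiableAt_ext0 g hy)]
    rfl
  map_smul' a f := ext_of_ext0 fun y hy => by
    rw [RingHom.id_apply, ext0_smul _ _ hy, ext0_pderiv _ _ hy, ext0_pderiv _ _ hy,
      fderiv_congr (G := a • ext0 f) (fun z hz => ext0_smul a f hz) hy, fderiv_const_smul_field]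
    rfl

theorem pderivLin_mul (i : Fin p) (f g : smoothFun W) :
    pderivLin i (f * g) = pderivLin i f * g + f * pderivLin i g := ext_of_ext0 fun y hy => by
  change ext0 (smoothFun.pderiv i (f * g)) y =
    ext0 (smoothFun.pderiv i f * g + f * smoothFun.pderiv i g) y
  rw [ext0_add _ _ hy, ext0_mul _ _ hy, ext0_mul _ _ hy, ext0_pderiv _ _ hy, ext0_pderiv _ _ hy,
    ext0_pderiv _ _ hy, fderiv_congr (G := ext0 f * ext0 g) (fun z hz => ext0_mul f g hz) hy,
    fderiv_mul (differentiableAt_ext0 f hy) (differentiableAt_ext0 g hy)]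
  simp only [add_apply, smul_apply, smul_eq_mul]
  ring

theorem res_pderivLin (h : W' ≤ W) (i : Fin p) (f : smoothFun W) :
    smoothFun.res h (pderivLin i f) = pderivLin i (smoothFun.res h f) :=
  ext_of_ext0 fun y hy => by
    change ext0 (smoothFun.res h (smoothFun.pderiv i f)) y =
      ext0 (smoothFun.pderiv i (smoothFun.res h f)) y
    rw [ext0_res h _ hy, ext0_pderiv _ _ (h hy), ext0_pderiv _ _ hy,
      fderiv_congr (fun z hz => ext0_res h f hz) hy]

theorem pderivLin_const (i : Fin p) (a : ℝ) :
    pderivLin i (algebraMap ℝ (smoothFun W) a) = 0 := ext_of_ext0 fun y hy => by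
  change ext0 (smoothFun.pderiv i _) y = _
  rw [ext0_pderiv _ _ hy, ext0_zero, fderiv_congr (G := fun _ => a)
    (fun z hz => by rw [ext0_apply _ hz]; rfl) hy]
  simp

/-- The coordinate functions. -/
def coordFun (i : Fin p) : smoothFun W :=
  ofFun (fun y => y i) (contDiff_apply ℝ ℝ i).contDiffOn

theorem pderivLin_coordFun (i j : Fin p) :
    pderivLin i (coordFun j : smoothFun W) = algebraMap ℝ _ (if i = j then 1 else 0) :=
  ext_of_ext0 fun y hy => by
    change ext0 (smoothFun.pderiv i _) y = _
    rw [ext0_pderiv _ _ hy, fderiv_congr (G := fun y => y j)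
      (fun z hz => ext0_ofFun _ hz) hy, ext0_apply _ hy]
    have : (fun y : Fin p → ℝ => y j) = ContinuousLinearMap.proj (R := ℝ) (φ := fun _ => ℝ) j := rfl
    rw [this, ContinuousLinearMap.fderiv]
    change (Pi.single i (1 : ℝ) : Fin p → ℝ) j = if i = j then 1 else 0
    simp [Pi.single_apply, eq_comm]

/-- Composition with a smooth map. -/
def compHom (G : (Fin p → ℝ) → Fin p → ℝ) (hG : ContDiffOn ℝ ∞ G W') (h : Set.MapsTo G W' W) :
    smoothFun W →ₐ[ℝ] smoothFun W' where
  toFun f := ⟨fun y => f.1 ⟨G y, h y.2⟩, by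
    refine ((contDiffOn_ext0 f).comp hG h).congr fun y hy => ?_
    rw [Function.comp_apply, ext0_apply f (h hy)]
    exact Subtype.val_injective.extend_apply _ (0 : (Fin p → ℝ) → ℝ) (⟨y, hy⟩ : W')⟩
  map_one' := rfl
  map_mul' _ _ := rfl
  map_zero' := rfl
  map_add' _ _ := rfl
  commutes' _ := rfl

theorem ext0_compHom {G : (Fin p → ℝ) → Fin p → ℝ} (hG : ContDiffOn ℝ ∞ G W')
    (h : Set.MapsTo G W' W) (f : smoothFun W) {y : Fin p → ℝ} (hy : y ∈ W') :
    ext0 (compHom G hG h f) y = ext0 f (G y) := by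
  rw [ext0_apply _ hy, ext0_apply _ (h hy)]; rfl

section Taylor

variable {A B : Type*} [Ring A] [Algebra ℝ A] [Ring B] [Algebra ℝ B]

/-- The homogeneous terms of the Taylor expansion of `f(t + n)`. -/
noncomputable def taylorTerm (T : smoothFun W →ₐ[ℝ] A) (n : Fin p → A) :
    ℕ → smoothFun W →ₗ[ℝ] A
  | 0 => T.toLinearMap
  | k + 1 => ((k : ℝ) + 1)⁻¹ • ∑ i, LinearMap.mulLeft ℝ (n i) ∘ₗ taylorTerm T n k ∘ₗ pderivLin i

variable (T : smoothFun W →ₐ[ℝ] A) (n : Fin p → A)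

theorem taylorTerm_zero (f : smoothFun W) : taylorTerm T n 0 f = T f := rfl

theorem taylorTerm_succ (k : ℕ) (f : smoothFun W) :
    taylorTerm T n (k + 1) f = ((k : ℝ) + 1)⁻¹ • ∑ i, n i * taylorTerm T n k (pderivLin i f) := by
  simp [taylorTerm]

theorem smul_taylorTerm_succ (k : ℕ) (f : smoothFun W) :
    ((k : ℝ) + 1) • taylorTerm T n (k + 1) f = ∑ i, n i * taylorTerm T n k (pderivLin i f) := by
  rw [taylorTerm_succ, smul_smul, mul_inv_cancel₀ (by positivity), one_smul]

/-- The product rule for `f(t + n)`, order by order. The factor `k + 1` is written as the sum of the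
two indices on the antidiagonal, which lets the recursion act on either factor; `n i` can be moved
across because it is central. -/
theorem taylorTerm_mul (hn : ∀ i a, n i * a = a * n i) (k : ℕ) (f g : smoothFun W) :
    taylorTerm T n k (f * g) =
      ∑ ab ∈ Finset.HasAntidiagonal.antidiagonal k, taylorTerm T n ab.1 f * taylorTerm T n ab.2 g := by
  induction k generalizing f g with
  | zero => simp [taylorTerm_zero]
  | succ k ih =>
    have hk : ((k : ℝ) + 1) ≠ 0 := by positivity
    apply smul_right_injective A hk
    change ((k : ℝ) + 1) • taylorTerm T n (k + 1) (f * g) = ((k : ℝ) + 1) • _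
    have h1 : ((k : ℝ) + 1) • ∑ ab ∈ Finset.HasAntidiagonal.antidiagonal (k + 1),
        taylorTerm T n ab.1 f * taylorTerm T n ab.2 g =
        ∑ ab ∈ Finset.HasAntidiagonal.antidiagonal (k + 1),
          (ab.1 : ℝ) • (taylorTerm T n ab.1 f * taylorTerm T n ab.2 g) +
        ∑ ab ∈ Finset.HasAntidiagonal.antidiagonal (k + 1),
          (ab.2 : ℝ) • (taylorTerm T n ab.1 f * taylorTerm T n ab.2 g) := by
      rw [Finset.smul_sum, ← Finset.sum_add_distrib]
      refine Finset.sum_congr rfl fun ab hab => ?_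
      rw [← add_smul, ← Nat.cast_add, Finset.HasAntidiagonal.mem_antidiagonal.1 hab]
      push_cast
      rfl
    rw [h1, Finset.Nat.sum_antidiagonal_succ, Finset.Nat.sum_antidiagonal_succ', smul_taylorTerm_succ]
    simp only [Nat.cast_zero, zero_smul, zero_add, Nat.cast_add, Nat.cast_one]
    simp only [← smul_mul_assoc, smul_taylorTerm_succ]
    simp only [smul_mul_assoc, ← mul_smul_comm, smul_taylorTerm_succ]
    simp only [pderivLin_mul, map_add, ih, mul_add, Finset.sum_add_distrib]
    congr 1
    · simp only [Finset.mul_sum, Finset.sum_mul]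
      rw [Finset.sum_comm]
      simp only [mul_assoc]
    · simp only [Finset.mul_sum]
      rw [Finset.sum_comm]
      refine Finset.sum_congr rfl fun ab _ => Finset.sum_congr rfl fun i _ => ?_
      rw [← mul_assoc, hn, mul_assoc]

theorem taylorTerm_const (k : ℕ) (a : ℝ) :
    taylorTerm T n (k + 1) (algebraMap ℝ _ a) = 0 := by
  rw [taylorTerm_succ]
  simp [pderivLin_const]

/-- The algebra homomorphism `f ↦ f(t + n)` given by the Taylor expansion. -/
noncomputable def taylorHom (hn : ∀ i a, n i * a = a * n i) (N : ℕ)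
    (h0 : ∀ a b f g, N < a + b → taylorTerm T n a f * taylorTerm T n b g = 0) :
    smoothFun W →ₐ[ℝ] A :=
  AlgHom.ofLinearMap (∑ k ∈ Finset.range (N + 1), taylorTerm T n k)
    (by
      rw [LinearMap.sum_apply, Finset.sum_range_succ', taylorTerm_zero, map_one]
      simp [← map_one (algebraMap ℝ (smoothFun W)), taylorTerm_const, -map_one])
    (by
      intro f g
      simp only [LinearMap.sum_apply, taylorTerm_mul T n hn]
      -- The truncated sum is multiplicative because pairs of total order above `N` contribute zero;
      -- the remaining pairs are grouped by total order.
      rw [Finset.sum_mul_sum, ← Finset.sum_product',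
        ← Finset.sum_filter_of_ne (p := fun ab : ℕ × ℕ => ab.1 + ab.2 < N + 1)
          (fun ab _ h => by
            by_contra h'
            exact h (h0 _ _ _ _ (by omega))),
        ← Finset.sum_fiberwise_of_maps_to (g := fun ab : ℕ × ℕ => ab.1 + ab.2)
          (t := Finset.range (N + 1)) (fun ab hab => by
            rw [Finset.mem_range]; exact (Finset.mem_filter.1 hab).2)]
      refine Finset.sum_congr rfl fun k hk => Finset.sum_congr ?_ fun _ _ => rfl
      ext ⟨a, b⟩
      simp only [Finset.HasAntidiagonal.mem_antidiagonal, Finset.mem_filter, Finset.mem_product,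
        Finset.mem_range] at hk ⊢
      omega)

theorem taylorHom_apply (hn : ∀ i a, n i * a = a * n i) (N : ℕ)
    (h0 : ∀ a b f g, N < a + b → taylorTerm T n a f * taylorTerm T n b g = 0)
    (f : smoothFun W) :
    taylorHom T n hn N h0 f = ∑ k ∈ Finset.range (N + 1), taylorTerm T n k f := by
  simp [taylorHom]

/-- Second derivatives of a coordinate vanish, so the expansion stops after the linear term. The
order `N + 1` guarantees that this term is present. -/
theorem taylorHom_coordFun (hn : ∀ i a, n i * a = a * n i) (N : ℕ)
    (h0 : ∀ a b f g, N + 1 < a + b → taylorTerm T n a f * taylorTerm T n b g = 0) (i : Fin p) :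
    taylorHom T n hn (N + 1) h0 (coordFun i) = T (coordFun i) + n i := by
  rw [taylorHom_apply, Finset.sum_range_succ', Finset.sum_range_succ', taylorTerm_zero, add_comm,
    Finset.sum_eq_zero, zero_add, taylorTerm_succ]
  · simp [pderivLin_coordFun, taylorTerm_zero]
  · intro k _
    rw [taylorTerm_succ]
    simp only [pderivLin_coordFun, taylorTerm_const, mul_zero, Finset.sum_const_zero, smul_zero]

theorem map_taylorTerm (ρ : A →ₐ[ℝ] B) (h : W' ≤ W) (T' : smoothFun W' →ₐ[ℝ] B)
    (hT : ∀ f, ρ (T f) = T' (smoothFun.res h f)) (k : ℕ) (f : smoothFun W) :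
    ρ (taylorTerm T n k f) = taylorTerm T' (fun i => ρ (n i)) k (smoothFun.res h f) := by
  induction k generalizing f with
  | zero => exact hT f
  | succ k ih => simp only [taylorTerm_succ, map_smul, map_sum, map_mul, ih, res_pderivLin]

end Taylor

end smoothFun

/-- A smooth map with invertible differential is a local diffeomorphism. -/
theorem exists_local_diffeo {E : Type*} [NormedAddCommGroup E] [NormedSpace ℝ E]
    [FiniteDimensional ℝ E] {G : E → E} {N : Set E} (hN : IsOpen N) (hG : ContDiffOn ℝ ∞ G N)
    {y : E} (hy : y ∈ N) (hdet : (fderiv ℝ G y).det ≠ 0) :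
    ∃ ψ : OpenPartialHomeomorph E E, (ψ : E → E) = G ∧ y ∈ ψ.source ∧ ψ.source ⊆ N ∧
      ContDiffOn ℝ ∞ ψ.symm ψ.target := by
  have : CompleteSpace E := FiniteDimensional.complete ℝ E
  have hGat : ∀ z ∈ N, ContDiffAt ℝ ∞ G z := fun z hz => hG.contDiffAt (hN.mem_nhds hz)
  have hder : ∀ z ∈ N, (h : (fderiv ℝ G z).det ≠ 0) →
      HasFDerivAt G (((fderiv ℝ G z).toContinuousLinearEquivOfDetNeZero h : E ≃L[ℝ] E) :
        E →L[ℝ] E) z := by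
    intro z hz h
    rw [ContinuousLinearMap.coe_toContinuousLinearEquivOfDetNeZero]
    exact ((hGat z hz).differentiableAt (by simp)).hasFDerivAt
  let ψ₀ := (hGat y hy).toOpenPartialHomeomorph G (hder y hy hdet) (by simp)
  -- Shrinking to the points with invertible differential makes the inverse smooth on its whole
  -- domain, not only at the image of `y`.
  have hN' : IsOpen (N ∩ (fun z => (fderiv ℝ G z).det) ⁻¹' {0}ᶜ) := by
    refine ContinuousOn.isOpen_inter_preimage ?_ hN isOpen_compl_singleton
    exact ContinuousLinearMap.continuous_det.comp_continuousOn
      (hG.continuousOn_fderiv_of_isOpen hN (by simp))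
  refine ⟨ψ₀.restrOpen _ hN', rfl, ⟨(hGat y hy).mem_toOpenPartialHomeomorph_source _ _, hy, hdet⟩,
    fun z hz => hz.2.1, ?_⟩
  intro w hw
  have hz := (ψ₀.restrOpen _ hN').map_target hw
  exact (OpenPartialHomeomorph.contDiffAt_symm _ hw (hder _ hz.2.1 hz.2.2)
    (hGat _ hz.2.1)).contDiffWithinAt

namespace SuperRingedSpace

namespace Chart

variable {M : SuperRingedSpace.{u}} {p q : ℕ} (c : M.Chart p q) {U V : Opens M.carrier}

theorem coord_inr (hU : U ≤ c.domain) (j : Fin q) :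
    c.coord hU (Sum.inr j) = M.res hU (c.thetaDom j) := by
  change c.thetaProd hU [j] = _
  rw [thetaProd, List.map_singleton, List.prod_singleton]

/-- The nilpotent part of `f` raises the degree above that of `θ^J`; up to that degree only the body
`g` matters. -/
theorem cf_mul_thetaProd_of_inFil (hV : V ≤ c.domain) {f : M.Sec V} {g : smoothFun (c.img V)}
    (h : c.InFil 1 (f - c.pullTo hV g)) {I J : Finset (Fin q)} (hIJ : I.card ≤ J.card)
    {y : Fin p → ℝ} (hy : y ∈ c.img V) : c.cf (f * c.thetaProd hV J.sort) I y =
      if J = I then smoothFun.ext0 g y else 0 := by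
  have h1 : f * c.thetaProd hV J.sort = c.pullTo hV g * c.thetaProd hV J.sort +
      (f - c.pullTo hV g) * c.thetaProd hV J.sort := by rw [sub_mul, add_sub_cancel]
  have h2 := h.mul hV (c.inFil_thetaProd hV J.sort) I
    (by rw [Finset.length_sort]; omega) y hy
  rw [h1, c.cf_add _ _ _ hy, h2, add_zero, c.cf_monomial]

/-- Modulo nilpotents `P` is pullback composed with `κ`, so the map is triangular with respect to
the degree, with `κ` on the diagonal. Injectivity proceeds upward in the degree; surjectivity is
successive approximation ending at `q + 1`. -/
theorem bijective_of_inFil {W : Opens (Fin p → ℝ)} (hV : V ≤ c.domain)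
    (P : smoothFun W →ₗ[ℝ] M.Sec V) (κ : smoothFun W → smoothFun (c.img V))
    (hκ : Function.Surjective κ) (hκ0 : ∀ f, κ f = 0 → f = 0)
    (hP : ∀ f, c.InFil 1 (P f - c.pullTo hV (κ f))) :
    Function.Bijective fun f : Finset (Fin q) → smoothFun W =>
      ∑ I, P (f I) * c.thetaProd hV I.sort := by
  constructor
  · intro f g hfg
    rw [← sub_eq_zero]
    have h0 : ∑ I, P ((f - g) I) * c.thetaProd hV I.sort = 0 := by
      simp only [Pi.sub_apply, map_sub, sub_mul, Finset.sum_sub_distrib]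
      exact sub_eq_zero.2 hfg
    generalize f - g = d at h0 ⊢
    have H : ∀ m, ∀ I : Finset (Fin q), I.card = m → d I = 0 := by
      intro m
      induction m using Nat.strong_induction_on with
      | _ m ih =>
        intro I hI
        refine hκ0 _ (smoothFun.ext_of_ext0 fun y hy => ?_)
        have h1 := congrArg (fun F => c.cf F I y) h0
        rw [c.cf_sum _ _ _ hy, c.cf_zero, Finset.sum_eq_single I] at h1
        · rwa [c.cf_mul_thetaProd_of_inFil hV (hP _) le_rfl hy, if_pos rfl,
            ← smoothFun.ext0_zero (W := c.img V) y] at h1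
        · intro J _ hJ
          by_cases hJI : J.card < m
          · rw [ih _ hJI J rfl, map_zero, zero_mul, c.cf_zero]
          · rw [c.cf_mul_thetaProd_of_inFil hV (hP _) (by omega) hy, if_neg hJ]
        · simp
    exact funext fun I => H _ I rfl
  · suffices H : ∀ m k, q + 1 ≤ k + m → ∀ f : M.Sec V, c.InFil k f →
        ∃ F : Finset (Fin q) → smoothFun W, ∑ I, P (F I) * c.thetaProd hV I.sort = f from
      fun f => H (q + 1) 0 (by omega) f (c.inFil_zero f)
    intro m
    induction m with
    | zero =>
      intro k hk f hf
      exact ⟨fun _ => 0, by rw [hf.eq_zero hV (by omega)]; simp⟩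
    | succ m ih =>
      intro k hk f hf
      choose F hF using fun I => hκ (c.coef V f I)
      have hr : c.InFil (k + 1) (f - ∑ I, P (F I) * c.thetaProd hV I.sort) := by
        intro K hK y hy
        rw [c.cf_sub _ _ _ hy, c.cf_sum _ _ _ hy, Finset.sum_eq_single K]
        · rw [c.cf_mul_thetaProd_of_inFil hV (hP _) le_rfl hy, if_pos rfl, hF]
          exact sub_self _
        · intro J _ hJ
          by_cases hJK : J.card < K.card
          · have h0 : c.coef V f J = 0 := smoothFun.ext_of_ext0 fun z hz => by
              rw [smoothFun.ext0_zero]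
              exact hf J (by omega) z hz
            rw [hκ0 (F J) (by rw [hF, h0]), map_zero, zero_mul, c.cf_zero]
          · rw [c.cf_mul_thetaProd_of_inFil hV (hP _) (by omega) hy, if_neg hJ]
        · simp
      obtain ⟨F', hF'⟩ := ih (k + 1) (by omega) _ hr
      refine ⟨fun I => F I + F' I, ?_⟩
      simp only [map_add, add_mul, Finset.sum_add_distrib, hF']
      abel

/-- The nilpotent part `f - f_∅` of a function. -/
noncomputable def nilPart (hU : U ≤ c.domain) (f : M.Sec U) : M.Sec U :=
  f - c.pullTo hU (c.coef U f ∅)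

theorem inFil_nilPart (hU : U ≤ c.domain) (f : M.Sec U) : c.InFil 1 (c.nilPart hU f) :=
  c.inFil_one_iff.2 fun y hy => by
    rw [nilPart, c.cf_sub _ _ _ hy, c.cf_pullTo, if_pos rfl]
    exact sub_self _

theorem nilPart_even (hU : U ≤ c.domain) {f : M.Sec U} (hf : f ∈ M.parity U 0) :
    c.nilPart hU f ∈ M.parity U 0 := Submodule.sub_mem _ hf (c.pullTo_even hU _)

theorem res_nilPart (h : V ≤ U) (hU : U ≤ c.domain) (f : M.Sec U) :
    M.res h (c.nilPart hU f) = c.nilPart (h.trans hU) (M.res h f) := by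
  rw [nilPart, map_sub, c.res_pullTo, nilPart, c.coef_res]

theorem inFil_taylorTerm {W : Opens (Fin p → ℝ)} (hU : U ≤ c.domain)
    (T : smoothFun W →ₐ[ℝ] M.Sec U) {n : Fin p → M.Sec U} (hn : ∀ i, c.InFil 1 (n i)) (k : ℕ)
    (f : smoothFun W) : c.InFil k (smoothFun.taylorTerm T n k f) := by
  induction k generalizing f with
  | zero => exact c.inFil_zero _
  | succ k ih =>
    rw [smoothFun.taylorTerm_succ]
    refine InFil.smul _ (c.inFil_sum fun i _ => ?_)
    rw [add_comm]
    exact (hn i).mul hU (ih _)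

theorem taylorTerm_even {W : Opens (Fin p → ℝ)} {T : smoothFun W →ₐ[ℝ] M.Sec U}
    (hT : ∀ f, T f ∈ M.parity U 0) {n : Fin p → M.Sec U} (hn : ∀ i, n i ∈ M.parity U 0) (k : ℕ)
    (f : smoothFun W) : smoothFun.taylorTerm T n k f ∈ M.parity U 0 := by
  induction k generalizing f with
  | zero => exact hT f
  | succ k ih =>
    rw [smoothFun.taylorTerm_succ]
    refine Submodule.smul_mem (M.parity U 0) _ (Submodule.sum_mem _ fun i _ => ?_)
    simpa using mul_mem_parity (hn i) (ih (smoothFun.pderivLin i f))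

/-- Even functions with linearly independent differentials are the even coordinates of a chart with
the same odd coordinates. -/
theorem exists_chart_even (hU : U ≤ c.domain) {x : M.carrier} (hx : x ∈ U) {w : Fin p → M.Sec U}
    (hw : ∀ i, w i ∈ M.parity U 0)
    (hdet : (fderiv ℝ (fun y i => c.cf (w i) ∅ y) (c.φ x)).det ≠ 0) :
    ∃ (c' : M.Chart p q) (h' : c'.domain ≤ U), x ∈ c'.domain ∧
      (∀ i, c'.coord le_rfl (Sum.inl i) = M.res h' (w i)) ∧
      ∀ j, c'.thetaDom j = M.res (h'.trans hU) (c.thetaDom j) := by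
  set G : (Fin p → ℝ) → Fin p → ℝ := fun y i => c.cf (w i) ∅ y with hGdef
  have hG : ContDiffOn ℝ ∞ G (c.img U) := contDiffOn_pi.2 fun i => c.contDiffOn_cf (w i) ∅
  obtain ⟨ψ, hψ, hxψ, hψU, hψs⟩ :=
    exists_local_diffeo (c.img U).2 hG (c.mem_img (hU hx) hx) hdet
  -- The map underlying the new chart is given by the bodies of the new even functions.
  let φ' := c.φ.trans ψ
  have hφ' : ∀ z, φ' z = G (c.φ z) := fun z => by rw [← hψ]; rfl
  have hsrc : (⟨φ'.source, φ'.open_source⟩ : Opens M.carrier) ≤ U := by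
    intro z hz
    have h1 : z ∈ c.φ.source ∩ c.φ ⁻¹' ψ.source := hz
    have h2 := (hψU h1.2).2
    rwa [Set.mem_preimage, c.φ.left_inv h1.1] at h2
  have hle : ∀ W, chartPreimage φ' W ≤ U := fun W => (chartPreimage_le φ' W).trans hsrc
  have hled : ∀ W, chartPreimage φ' W ≤ c.domain := fun W => (hle W).trans hU
  have himgψ : ∀ W, ∀ y ∈ c.img (chartPreimage φ' W), y ∈ ψ.source ∧ G y ∈ W := by
    rintro W y ⟨hy, ⟨hy1, hy2⟩⟩
    have h1 : c.φ.symm y ∈ c.φ.source ∩ c.φ ⁻¹' ψ.source := hy1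
    have h2 := h1.2
    rw [Set.mem_preimage, c.φ.right_inv hy] at h2
    rw [Set.mem_preimage, hφ', c.φ.right_inv hy] at hy2
    exact ⟨h2, hy2⟩
  have hmaps : ∀ W : Opens (Fin p → ℝ), Set.MapsTo G (c.img (chartPreimage φ' W)) W :=
    fun W y hy => (himgψ W y hy).2
  have hGW : ∀ W, ContDiffOn ℝ ∞ G (c.img (chartPreimage φ' W)) := fun W =>
    hG.mono (c.img_mono (hle W))
  -- The pullback of `f` will be `f(G + n)`, with `G` the body of `w` and `n` its nilpotent part,
  -- defined by Taylor expansion in `n`.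
  let T : ∀ W, smoothFun W →ₐ[ℝ] M.Sec (chartPreimage φ' W) := fun W =>
    (c.pullTo (hled W)).comp (smoothFun.compHom G (hGW W) (hmaps W))
  let n : ∀ W, Fin p → M.Sec (chartPreimage φ' W) := fun W i =>
    c.nilPart (hled W) (M.res (hle W) (w i))
  have hT0 : ∀ W f, T W f ∈ M.parity _ 0 := fun W f => c.pullTo_even (hled W) _
  have hn0 : ∀ W i, n W i ∈ M.parity _ 0 := fun W i =>
    c.nilPart_even (hled W) (res_mem_parity _ (hw i))
  have hnc : ∀ W i a, n W i * a = a * n W i := fun W i a => even_mul_comm (hn0 W i) a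
  have hfil := fun W => c.inFil_taylorTerm (hled W) (T W) (n := n W) 
    (fun i => c.inFil_nilPart (hled W) _)
  -- Products of total order above `q` already vanish. One more order is kept so that the linear
  -- term needed in `taylorHom_coordFun` is included for `q = 0` too.
  have hz : ∀ W a b f g, q + 1 < a + b →
      smoothFun.taylorTerm (T W) (n W) a f * smoothFun.taylorTerm (T W) (n W) b g = 0 :=
    fun W a b f g hab => ((hfil W a f).mul (hled W) (hfil W b g)).eq_zero (hled W) (by omega)
  let P : ∀ W, smoothFun W →ₐ[ℝ] M.Sec (chartPreimage φ' W) := fun W =>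
    smoothFun.taylorHom (T W) (n W) (hnc W) (q + 1) (hz W)
  have hP : ∀ W f, P W f = ∑ k ∈ Finset.range (q + 1 + 1), smoothFun.taylorTerm (T W) (n W) k f :=
    fun W f => smoothFun.taylorHom_apply _ _ _ _ _ f
  have hPfil : ∀ W f, c.InFil 1 (P W f -
      c.pullTo (hled W) (smoothFun.compHom G (hGW W) (hmaps W) f)) := by
    intro W f
    rw [hP, Finset.sum_range_succ']
    have : smoothFun.taylorTerm (T W) (n W) 0 f =
      c.pullTo (hled W) (smoothFun.compHom G (hGW W) (hmaps W) f) := rfl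
    rw [this, add_sub_cancel_right]
    exact c.inFil_sum fun k _ => (hfil W (k + 1) f).mono (by omega)
  let c' : M.Chart p q :=
    { φ := φ'
      pull := P
      pull_even := fun W f => by
        rw [hP]
        exact Submodule.sum_mem _ fun k _ => taylorTerm_even (hT0 W) (hn0 W) k f
      pull_res := fun {W W'} h f => by
        rw [hP, hP, map_sum]
        refine Finset.sum_congr rfl fun k _ => ?_
        have hle' := chartPreimage_mono φ' h
        rw [smoothFun.map_taylorTerm (T W) (n W) (M.res hle') h (T W') (fun g => ?_) k f]
        · congr 2
          funext i
          change M.res hle' (c.nilPart _ _) = c.nilPart _ _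
          rw [c.res_nilPart, res_res]
        · change M.res hle' (c.pullTo (hled W) (smoothFun.compHom G (hGW W) (hmaps W) g)) =
            c.pullTo (hled W') (smoothFun.compHom G (hGW W') (hmaps W') (smoothFun.res h g))
          rw [c.res_pullTo]
          congr 1
      θ := fun j => M.res (hsrc.trans hU) (c.thetaDom j)
      θ_odd := fun j => res_mem_parity _ (c.θ_odd j)
      bijective := by
        intro W hW
        have hψt : ∀ y ∈ W, y ∈ ψ.target ∧ ψ.symm y ∈ c.img (chartPreimage φ' W) ∧
            G (ψ.symm y) = y := by
          intro y hy
          have h1 : y ∈ φ'.target := hW hy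
          have h2 : y ∈ ψ.target ∩ ψ.symm ⁻¹' c.φ.target := h1
          have h3 : φ'.symm y = c.φ.symm (ψ.symm y) := rfl
          refine ⟨h2.1, ⟨h2.2, ?_⟩, by rw [← hψ, ψ.right_inv h2.1]⟩
          rw [Set.mem_preimage, ← h3]
          refine ⟨φ'.map_target h1, ?_⟩
          rw [Set.mem_preimage, φ'.right_inv h1]
          exact hy
        have hb := c.bijective_of_inFil (hled W) (P W).toLinearMap
          (smoothFun.compHom G (hGW W) (hmaps W)) ?_ ?_ (hPfil W)
        · convert! hb using 1
          funext f
          refine Finset.sum_congr rfl fun I _ => ?_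
          congr 1
          rw [thetaProd, map_list_prod, map_list_prod, List.map_map, List.map_map]
          congr 2
          funext j
          exact res_res _ _ _
        · intro g
          have hs : ContDiffOn ℝ ∞ (fun y => smoothFun.ext0 g (ψ.symm y)) W :=
            (smoothFun.contDiffOn_ext0 g).comp (hψs.mono fun y hy => (hψt y hy).1)
              fun y hy => (hψt y hy).2.1
          refine ⟨smoothFun.ofFun _ hs, smoothFun.ext_of_ext0 fun y hy => ?_⟩
          rw [smoothFun.ext0_compHom _ _ _ hy, smoothFun.ext0_ofFun _ (hmaps W hy), ← hψ,
            ψ.left_inv (himgψ W y hy).1]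
        · intro f hf
          refine smoothFun.ext_of_ext0 fun y hy => ?_
          have h1 := smoothFun.ext0_compHom (hGW W) (hmaps W) f (hψt y hy).2.1
          rw [hf, (hψt y hy).2.2, smoothFun.ext0_zero] at h1
          rw [← h1, smoothFun.ext0_zero] }
  refine ⟨c', hsrc, ⟨hU hx, hxψ⟩, fun i => ?_, fun j => rfl⟩
  have hcd : c'.domain ≤ chartPreimage φ' (c'.img c'.domain) := c'.le_preimage_img le_rfl
  have h1 : c'.coord le_rfl (Sum.inl i) =
      M.res hcd (P (c'.img c'.domain) (smoothFun.coordFun i)) := rfl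
  have h2 : P (c'.img c'.domain) (smoothFun.coordFun i) =
      T (c'.img c'.domain) (smoothFun.coordFun i) + n (c'.img c'.domain) i :=
    smoothFun.taylorHom_coordFun _ _ _ _ _ i
  have h3 : T (c'.img c'.domain) (smoothFun.coordFun i) =
      c.pullTo (hled _) (c.coef _ (M.res (hle _) (w i)) ∅) := by
    refine congrArg (c.pullTo (hled (c'.img c'.domain))) ?_
    refine smoothFun.ext_of_ext0 fun y hy => ?_
    refine (smoothFun.ext0_compHom (hGW _) (hmaps _) (smoothFun.coordFun i) hy).trans ?_
    rw [smoothFun.coordFun, smoothFun.ext0_ofFun _ (hmaps _ hy)]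
    exact (c.cf_res (hle _) (w i) ∅ hy).symm
  rw [h1, h2, h3]
  change M.res hcd (_ + c.nilPart (hled _) (M.res (hle _) (w i))) = _
  rw [nilPart, add_sub_cancel, res_res]

/-- The inverse function theorem: functions with linearly independent differentials are local
coordinates. -/
theorem exists_chart_of_dAt (hU : U ≤ c.domain) {x : M.carrier} (hx : x ∈ U)
    {w : Fin p ⊕ Fin q → M.Sec U} (hw : ∀ a, w a ∈ M.parity U (coordParity a))
    (hdet : (Matrix.of fun a b => c.dAt x (w a) b).det ≠ 0) :
    ∃ (c' : M.Chart p q) (h' : c'.domain ≤ U), x ∈ c'.domain ∧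
      ∀ a, c'.coord le_rfl a = M.res h' (w a) := by
  have hxi := c.mem_img (hU hx) hx
  -- By parity the mixed derivatives vanish at `x`, so the Jacobian splits into an even and an odd
  -- block, which are treated one after the other.
  have hblock : (Matrix.of fun a b => c.dAt x (w a) b) = Matrix.fromBlocks
      (Matrix.of fun i k => fderiv ℝ (c.cf (w (Sum.inl i)) ∅) (c.φ x) (Pi.single k 1)) 0 0
      (Matrix.of fun j l => c.cf (w (Sum.inr j)) {l} (c.φ x)) := by
    ext a b
    rcases a with i | j <;> rcases b with k | l
    · rfl
    · exact c.cf_eq_zero_of_mem_parity hU (hw (Sum.inl i)) (by simp [coordParity]) hxi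
    · have h0 : fderiv ℝ (c.cf (w (Sum.inr j)) ∅) (c.φ x) = fderiv ℝ (fun _ => (0 : ℝ)) (c.φ x) :=
        c.fderiv_congr_img (fun y hy => c.cf_eq_zero_of_mem_parity hU (hw (Sum.inr j))
          (by simp [coordParity]) hy) hxi
      change fderiv ℝ (c.cf (w (Sum.inr j)) ∅) (c.φ x) (Pi.single k 1) = 0
      rw [h0]
      simp
    · rfl
  rw [hblock, Matrix.det_fromBlocks_zero₂₁] at hdet
  obtain ⟨c₁, h₁, hx₁, hφ₁, hθ₁, hcf₁⟩ := c.exists_chart_odd hU hx (fun j => hw (Sum.inr j))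
    (right_ne_zero_of_mul hdet)
  -- The change of odd coordinates has not touched the bodies of the even functions, so the even
  -- block is invertible in the new chart as well.
  have hd : (fderiv ℝ (fun y i => c₁.cf (M.res h₁ (w (Sum.inl i))) ∅ y) (c₁.φ x)).det ≠ 0 := by
    have hxi₁ := c.mem_img (hU hx) hx₁
    have hev : (fun y i => c₁.cf (M.res h₁ (w (Sum.inl i))) ∅ y) =ᶠ[nhds (c.φ x)]
        fun y i => c.cf (w (Sum.inl i)) ∅ y := by
      refine Filter.eventually_of_mem ((c.img c₁.domain).2.mem_nhds hxi₁) fun y hy => funext fun i => ?_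
      exact ((hcf₁ c₁.domain le_rfl _).2 y hy).trans (c.cf_res h₁ _ _ hy)
    rw [hφ₁, hev.fderiv_eq, fderiv_pi fun i => c.differentiableAt_cf _ _ hxi]
    have h := left_ne_zero_of_mul hdet
    convert! h using 1
    rw [ContinuousLinearMap.det, ← LinearMap.det_toMatrix']
    congr 1
  obtain ⟨c₂, h₂, hx₂, ht₂, hθ₂⟩ := c₁.exists_chart_even le_rfl hx₁
    (w := fun i => M.res h₁ (w (Sum.inl i))) (fun i => res_mem_parity _ (hw (Sum.inl i))) hd
  refine ⟨c₂, h₂.trans h₁, hx₂, fun a => ?_⟩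
  rcases a with i | j
  · rw [ht₂, res_res]
  · rw [coord_inr, res_self, hθ₂, hθ₁, res_res]

end Chart

end SuperRingedSpace

/-! ### Adapted fields and coordinates at a point -/

/-- A basis of `ℝ^n` adapted to two spanning sets. -/
theorem exists_adapted_basis {n m : ℕ} {S S' : Set (Fin n → ℝ)}
    (hm : Module.finrank ℝ (Submodule.span ℝ S) = m) (htop : Submodule.span ℝ (S ∪ S') = ⊤) :
    m ≤ n ∧ ∃ b : Fin n → Fin n → ℝ, LinearIndependent ℝ b ∧ (∀ i, i.1 < m → b i ∈ S) ∧
      ∀ i, m ≤ i.1 → b i ∈ S' := by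
  classical
  -- A basis of the span of `S` is chosen inside `S` and extended by elements of `S'`.
  obtain ⟨t, htS, htspan, htli⟩ := exists_linearIndependent ℝ S
  have htli' : LinearIndepOn ℝ id t := htli
  obtain ⟨t', ht't, htt', hspan, hli⟩ :=
    exists_linearIndepOn_id_extension htli' (Set.subset_union_left : t ⊆ t ∪ S')
  have hli' : LinearIndependent ℝ ((↑) : t' → Fin n → ℝ) := hli
  have hfin' : Finite t' := hli'.finite
  have := Fintype.ofFinite t'
  have hfin : Finite t := htli.finite
  have := Fintype.ofFinite t
  have hcard : Fintype.card t = m := by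
    rw [← hm, ← htspan, finrank_span_set_eq_card htli, Set.toFinset_card]
  have hspan' : Submodule.span ℝ t' = ⊤ := by
    rw [eq_top_iff, ← htop, Submodule.span_le]
    have h1 : (Submodule.span ℝ S : Set (Fin n → ℝ)) ⊆ Submodule.span ℝ t' := by
      rw [← htspan]
      exact Submodule.span_mono htt'
    refine Set.union_subset (Submodule.subset_span.trans h1) ?_
    exact Set.subset_union_right.trans hspan
  have hcard' : Fintype.card t' = n := by
    have h := finrank_span_set_eq_card hli'
    rw [hspan', finrank_top, Module.finrank_fin_fun, Set.toFinset_card] at h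
    exact h.symm
  have hmn : m ≤ n := by
    have := Fintype.card_le_of_injective (Set.inclusion htt') (Set.inclusion_injective htt')
    omega
  refine ⟨hmn, ?_⟩
  -- The first `m` indices are matched with `t`, the others with the rest of `t'`, which is
  -- contained in `S'`.
  have c1 : Fintype.card {i : Fin n // i.1 < m} = Fintype.card {z : t' // z.1 ∈ t} := by
    have e : {z : t' // z.1 ∈ t} ≃ t :=
      ⟨fun z => ⟨z.1.1, z.2⟩, fun z => ⟨⟨z.1, htt' z.2⟩, z.2⟩, fun _ => rfl, fun _ => rfl⟩
    rw [Fintype.card_congr e, hcard, Fintype.card_subtype]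
    rcases hmn.lt_or_eq with h | h
    · have : (Finset.univ.filter fun i : Fin n => i.1 < m) = Finset.Iio ⟨m, h⟩ := by
        ext i; simp [Fin.lt_def]
      rw [this, Fin.card_Iio]
    · subst h
      simp
  have c2 : Fintype.card {i : Fin n // ¬ i.1 < m} = Fintype.card {z : t' // ¬ z.1 ∈ t} := by
    rw [Fintype.card_subtype_compl, Fintype.card_subtype_compl, c1, hcard', Fintype.card_fin]
  let e1 := Fintype.equivOfCardEq c1
  let e2 := Fintype.equivOfCardEq c2
  let e : Fin n ≃ t' := (Equiv.sumCompl (fun i : Fin n => i.1 < m)).symm.trans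
    ((Equiv.sumCongr e1 e2).trans (Equiv.sumCompl (fun z : t' => z.1 ∈ t)))
  refine ⟨fun i => (e i).1, hli'.comp e e.injective, fun i hi => ?_, fun i hi => ?_⟩
  · have h1 : e i = (e1 ⟨i, hi⟩).1 := by
      change (Equiv.sumCompl (fun z : t' => z.1 ∈ t)) ((Equiv.sumCongr e1 e2)
        ((Equiv.sumCompl (fun i : Fin n => i.1 < m)).symm i)) = _
      rw [Equiv.sumCompl_symm_apply_of_pos (p := fun i : Fin n => i.1 < m) hi]
      rfl
    change (e i).1 ∈ S
    rw [h1]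
    exact htS (e1 ⟨i, hi⟩).2
  · have hi' : ¬ i.1 < m := not_lt.2 hi
    have h1 : e i = (e2 ⟨i, hi'⟩).1 := by
      change (Equiv.sumCompl (fun z : t' => z.1 ∈ t)) ((Equiv.sumCongr e1 e2)
        ((Equiv.sumCompl (fun i : Fin n => i.1 < m)).symm i)) = _
      rw [Equiv.sumCompl_symm_apply_of_neg (p := fun i : Fin n => i.1 < m) hi']
      rfl
    have h2 : (e i).1 ∉ t := by rw [h1]; exact (e2 ⟨i, hi'⟩).2
    exact (ht't (e i).2).resolve_left h2

namespace SuperRingedSpace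

theorem exists_common_open {X : Type*} [TopologicalSpace X] {ι : Type*} [Finite ι] {x : X}
    (U : ι → Opens X) (h : ∀ i, x ∈ U i) : ∃ V : Opens X, x ∈ V ∧ ∀ i, V ≤ U i :=
  ⟨⟨⋂ i, (U i : Set X), isOpen_iInter_of_finite fun i => (U i).2⟩, Set.mem_iInter.2 h,
    fun i _ hy => Set.mem_iInter.1 hy i⟩

section Parity

variable {M : SuperRingedSpace.{u}} {U : Opens M.carrier}

theorem eq_zero_of_parity_add {d : ZMod 2} {f g : M.Sec U} (hf : f ∈ M.parity U d)
    (hg : g ∈ M.parity U (d + 1)) (h : f + g ∈ M.parity U d) : g = 0 := by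
  have hg' : g ∈ M.parity U d := by
    have := Submodule.sub_mem _ h hf
    rwa [add_sub_cancel_left] at this
  have hc : ∀ e : ZMod 2, e = 0 ∨ e = 1 := by decide
  rcases hc d with rfl | rfl
  · exact eq_zero_of_mem_parity hg' hg
  · exact eq_zero_of_mem_parity hg hg'

theorem delta_mem_parity {ι κ : Type*} [DecidableEq (ι ⊕ κ)] (a b : ι ⊕ κ) :
    (if a = b then (1 : M.Sec U) else 0) ∈ M.parity U (coordParity a + coordParity b) := by
  split_ifs with h
  · have h2 : ∀ d : ZMod 2, d + d = 0 := by decide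
    rw [h, h2]
    exact one_mem_parity
  · exact Submodule.zero_mem _

end Parity

namespace Chart

variable {M : SuperRingedSpace.{u}} {p q : ℕ} (c : M.Chart p q) {U V : Opens M.carrier}

/-- Homogeneous linear functions of the coordinates. -/
noncomputable def linCoord (hU : U ≤ c.domain) (A : Matrix (Fin p) (Fin p) ℝ)
    (B : Matrix (Fin q) (Fin q) ℝ) : Fin p ⊕ Fin q → M.Sec U :=
  Sum.elim (fun i => ∑ k, A i k • c.coord hU (Sum.inl k))
    (fun j => ∑ l, B j l • c.coord hU (Sum.inr l))

theorem linCoord_mem_parity (hU : U ≤ c.domain) (A : Matrix (Fin p) (Fin p) ℝ)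
    (B : Matrix (Fin q) (Fin q) ℝ) (a : Fin p ⊕ Fin q) :
    c.linCoord hU A B a ∈ M.parity U (coordParity a) := by
  rcases a with i | j
  · change ∑ k, A i k • c.coord hU (Sum.inl k) ∈ M.parity U 0
    exact Submodule.sum_mem _ fun k _ =>
      Submodule.smul_mem (M.parity U 0) (A i k) (c.coord_mem_parity hU (Sum.inl k))
  · change ∑ k, B j k • c.coord hU (Sum.inr k) ∈ M.parity U 1
    exact Submodule.sum_mem _ fun k _ =>
      Submodule.smul_mem (M.parity U 1) (B j k) (c.coord_mem_parity hU (Sum.inr k))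

theorem cf_field_linCoord (hU : U ≤ c.domain) {x : M.carrier} (hx : x ∈ U)
    {X : M.EndFamily U} (hX : X ∈ M.vec U) (A : Matrix (Fin p) (Fin p) ℝ)
    (B : Matrix (Fin q) (Fin q) ℝ) (a : Fin p ⊕ Fin q) :
    c.cf (X ⟨U, le_rfl⟩ (c.linCoord hU A B a)) ∅ (c.φ x) =
      Sum.elim (fun i => ∑ k, A i k * c.comp x X (Sum.inl k))
        (fun j => ∑ l, B j l * c.comp x X (Sum.inr l)) a := by
  have hxi := c.mem_img (hU hx) hx
  rcases a with i | j <;>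
  · simp only [linCoord, Sum.elim_inl, Sum.elim_inr, map_sum, map_smul]
    rw [c.cf_sum _ _ _ hxi]
    refine Finset.sum_congr rfl fun k _ => ?_
    rw [c.cf_smul _ _ _ hxi, c.comp_eq hU hx hX]

theorem comp_add {x : M.carrier} (hx : x ∈ c.domain) (hxU : x ∈ U) (X Y : M.EndFamily U)
    (a : Fin p ⊕ Fin q) : c.comp x (X + Y) a = c.comp x X a + c.comp x Y a :=
  c.cf_add _ _ _ (c.mem_img hx (show x ∈ U ⊓ c.domain from ⟨hxU, hx⟩))

/-- Fields with an invertible matrix of components form a frame. -/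
theorem exists_eq_sum_of_isUnit (hU : U ≤ c.domain) {Z : Fin p ⊕ Fin q → M.EndFamily U}
    (hZ : ∀ a, Z a ∈ M.vec U)
    (hu : IsUnit (Matrix.of fun a b => Z a ⟨U, le_rfl⟩ (c.coord hU b)))
    (W : Opens M.carrier) (hW : W ≤ U) {Y : M.EndFamily W} (hY : Y ∈ M.vec W) :
    ∃ g : Fin p ⊕ Fin q → M.Sec W, Y = ∑ a, funMul (g a) (resVec hW (Z a)) := by
  obtain ⟨S, hS⟩ := hu
  set T : Matrix (Fin p ⊕ Fin q) (Fin p ⊕ Fin q) (M.Sec U) := ↑S⁻¹ with hT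
  have hTS : T * (Matrix.of fun a b => Z a ⟨U, le_rfl⟩ (c.coord hU b)) = 1 := by
    rw [← hS, hT, Units.inv_mul]
  have hWd := hW.trans hU
  -- The inverse matrix expresses the coordinate fields through the `Z a`, and coordinate fields
  -- generate all fields.
  have hpart : ∀ b, resVec hU (c.coordField b) = ∑ a, funMul (T b a) (Z a) := by
    intro b
    have h1 : ∀ a, funMul (T b a) (Z a) = ∑ e,
        funMul (T b a * Z a ⟨U, le_rfl⟩ (c.coord hU e)) (resVec hU (c.coordField e)) := by
      intro a
      conv_lhs => rw [c.vec_eq_sum hU (hZ a)]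
      rw [funMul_sum]
      simp only [funMul_funMul]
    simp only [h1]
    rw [Finset.sum_comm]
    simp only [← sum_funMul]
    have h2 : ∀ e, ∑ a, T b a * Z a ⟨U, le_rfl⟩ (c.coord hU e) = if b = e then 1 else 0 := by
      intro e
      have := congrFun (congrFun hTS b) e
      rw [Matrix.mul_apply, Matrix.one_apply] at this
      exact this
    simp only [h2]
    rw [Finset.sum_eq_single b]
    · rw [if_pos rfl, one_funMul]
    · intro e _ he
      rw [if_neg (Ne.symm he), zero_funMul]
    · simp
  refine ⟨fun a => ∑ b, Y ⟨W, le_rfl⟩ (c.coord hWd b) * M.res hW (T b a), ?_⟩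
  conv_lhs => rw [c.vec_eq_sum hWd hY]
  have h3 : ∀ b, resVec hWd (c.coordField b) =
      ∑ a, funMul (M.res hW (T b a)) (resVec hW (Z a)) := by
    intro b
    have := congrArg (resVec hW) (hpart b)
    rw [resVec_resVec, resVec_sum] at this
    simpa only [resVec_funMul] using this
  simp only [h3, funMul_sum, funMul_funMul, sum_funMul]
  exact Finset.sum_comm

end Chart

end SuperRingedSpace

namespace SuperRingedSpace

/-- The inclusion of the first `r|s` coordinates into the `p|q` coordinates. -/
def coordEmb {p q r s : ℕ} (hr : r ≤ p) (hs : s ≤ q) : Fin r ⊕ Fin s ↪ Fin p ⊕ Fin q :=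
  ⟨Sum.map (Fin.castLE hr) (Fin.castLE hs),
    (Fin.castLE_injective hr).sumMap (Fin.castLE_injective hs)⟩

theorem coordParity_coordEmb {p q r s : ℕ} (hr : r ≤ p) (hs : s ≤ q) (a : Fin r ⊕ Fin s) :
    coordParity (coordEmb hr hs a) = coordParity a := by
  rcases a with i | j <;> rfl

namespace Chart

variable {M : SuperRingedSpace.{u}} {p q : ℕ} (c : M.Chart p q) {U V : Opens M.carrier}

/-- Fields of parity `d` in a distribution and in a complement, whose components at `x` form a
basis. -/
theorem exists_adapted_fields {D : M.Distribution} {x : M.carrier} (hx : x ∈ c.domain)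
    {V : Opens M.carrier} (hxV : x ∈ V)
    {D' : ∀ U : Opens M.carrier, Submodule ℝ (M.EndFamily U)} (hD' : M.IsSubmoduleSheafOn V D')
    (htop : ∀ U ≤ V, D.sec U ⊔ D' U = M.vec U) {d : ZMod 2} {m n : ℕ}
    (hm : Module.rank ℝ (D.fibre x d) = m) {κ : Fin n → Fin p ⊕ Fin q}
    (hκ : Function.Injective κ) (hd : ∀ i, coordParity (κ i) = d)
    (hκ' : ∀ a, coordParity a = d → a ∈ Set.range κ) :
    m ≤ n ∧ ∃ b : Fin n → Fin n → ℝ, LinearIndependent ℝ b ∧ ∀ i, ∃ U : Opens M.carrier,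
      x ∈ U ∧ U ≤ V ∧ ∃ X ∈ M.vecParity U d, (i.1 < m → X ∈ D.sec U) ∧ (m ≤ i.1 → X ∈ D' U) ∧
        ∀ k, c.comp x X (κ k) = b i k := by
  classical
  let S : Set (Fin n → ℝ) := {v | ∃ U : Opens M.carrier, x ∈ U ∧
      ∃ X ∈ D.sec U ⊓ M.vecParity U d, v = fun k => c.comp x X (κ k)}
  let S' : Set (Fin n → ℝ) := {v | ∃ U : Opens M.carrier, x ∈ U ∧ U ≤ V ∧
      ∃ X ∈ D' U ⊓ M.vecParity U d, v = fun k => c.comp x X (κ k)}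
  -- Components of the other parity vanish, so restricting to the indices in the range of `κ` loses
  -- nothing; extension by zero undoes it.
  have hrank : Module.finrank ℝ (Submodule.span ℝ S) = m := by
    rw [← c.finrank_span_comp D hx d hm]
    let ι : (Fin n → ℝ) →ₗ[ℝ] (Fin p ⊕ Fin q → ℝ) :=
      { toFun := fun v => Function.extend κ v 0
        map_add' := fun v w => by
          have := Function.extend_add κ v w (0 : Fin p ⊕ Fin q → ℝ) 0
          rwa [add_zero] at this
        map_smul' := fun a v => by
          have := Function.extend_smul a κ v (0 : Fin p ⊕ Fin q → ℝ)
          rw [smul_zero] at this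
          exact this.symm ▸ rfl }
    have hι : Function.Injective ι := fun v w h => by
      funext k
      have := congrFun h (κ k)
      change Function.extend κ v 0 (κ k) = Function.extend κ w 0 (κ k) at this
      rwa [hκ.extend_apply, hκ.extend_apply] at this
    have himg : {v | ∃ U : Opens M.carrier, x ∈ U ∧
        ∃ X ∈ D.sec U ⊓ M.vecParity U d, v = c.comp x X} = ι '' S := by
      have hcomp : ∀ (U : Opens M.carrier) (X : M.EndFamily U), x ∈ U → X ∈ M.vecParity U d →
          ι (fun k => c.comp x X (κ k)) = c.comp x X := by
        intro U X hxU hX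
        funext a
        change Function.extend κ (fun k => c.comp x X (κ k)) 0 a = _
        by_cases ha : coordParity a = d
        · obtain ⟨k, rfl⟩ := hκ' a ha
          rw [hκ.extend_apply]
        · rw [Function.extend_apply' _ _ _ (by rintro ⟨k, rfl⟩; exact ha (hd k)),
            c.comp_eq_zero_of_parity hx hxU hX ha]
          rfl
      ext v
      constructor
      · rintro ⟨U, hxU, X, hX, rfl⟩
        exact ⟨_, ⟨U, hxU, X, hX, rfl⟩, hcomp U X hxU hX.2⟩
      · rintro ⟨_, ⟨U, hxU, X, hX, rfl⟩, rfl⟩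
        exact ⟨U, hxU, X, hX, hcomp U X hxU hX.2⟩
    rw [himg, Submodule.span_image]
    exact (LinearEquiv.finrank_eq (Submodule.equivMapOfInjective ι hι _))
  -- A coordinate field of parity `d` is a section of `D` plus one of `D'`. Passing to their parts
  -- of parity `d` does not change the components along `κ`, so each standard basis vector is the
  -- sum of an element of `S` and one of `S'`.
  have hspan : Submodule.span ℝ (S ∪ S') = ⊤ := by
    rw [eq_top_iff, ← (Pi.basisFun ℝ (Fin n)).span_eq, Submodule.span_le]
    rintro _ ⟨k, rfl⟩
    have hUV : V ⊓ c.domain ≤ V := inf_le_left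
    have hUc : V ⊓ c.domain ≤ c.domain := inf_le_right
    have hxU : x ∈ V ⊓ c.domain := ⟨hxV, hx⟩
    have hmem : resVec hUc (c.coordField (κ k)) ∈ M.vec (V ⊓ c.domain) :=
      resVec_mem_vec _ (vecParity_le_vec _ (c.coordField_mem _))
    have hmem' := hmem
    rw [← htop _ hUV] at hmem'
    obtain ⟨Y, hY, Y', hY', hsum⟩ := Submodule.mem_sup.1 hmem'
    have key : ∀ (F : Submodule ℝ (M.EndFamily (V ⊓ c.domain))),
        F ≤ (F ⊓ M.vecParity _ 0) ⊔ (F ⊓ M.vecParity _ 1) → ∀ Y ∈ F,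
        ∃ Y₁ ∈ F ⊓ M.vecParity _ d, ∀ k, c.comp x Y (κ k) = c.comp x Y₁ (κ k) := by
      intro F hF Y hY
      obtain ⟨Y₀, h₀, Y₁, h₁, rfl⟩ := Submodule.mem_sup.1 (hF hY)
      have hc : ∀ e : ZMod 2, e = 0 ∨ e = 1 := by decide
      rcases hc d with h | h
      · subst h
        refine ⟨Y₀, h₀, fun k => ?_⟩
        rw [c.comp_add hx hxU, c.comp_eq_zero_of_parity hx hxU h₁.2 (by rw [hd]; decide), add_zero]
      · subst h
        refine ⟨Y₁, h₁, fun k => ?_⟩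
        rw [c.comp_add hx hxU, c.comp_eq_zero_of_parity hx hxU h₀.2 (by rw [hd]; decide), zero_add]
    obtain ⟨Z, hZ, hZc⟩ := key _ (D.isSubmoduleSheaf.graded _ le_top) Y hY
    obtain ⟨Z', hZ', hZc'⟩ := key _ (hD'.graded _ hUV) Y' hY'
    have heq : Pi.basisFun ℝ (Fin n) k =
        (fun l => c.comp x Z (κ l)) + fun l => c.comp x Z' (κ l) := by
      funext l
      rw [Pi.add_apply, ← hZc, ← hZc', ← c.comp_add hx hxU, hsum, c.comp_eq hUc hxU hmem,
        resVec_apply, c.coordField_coord, Pi.basisFun_apply, Pi.single_apply]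
      by_cases hkl : l = k
      · subst hkl
        rw [if_pos rfl, if_pos rfl, c.cf_one hUc _ (c.mem_img hx hxU), if_pos rfl]
      · rw [if_neg hkl, if_neg fun h => hkl (hκ h).symm, c.cf_zero]
    rw [heq]
    exact Submodule.add_mem _
      (Submodule.subset_span (Or.inl ⟨_, hxU, Z, hZ, rfl⟩))
      (Submodule.subset_span (Or.inr ⟨_, hxU, hUV, Z', hZ', rfl⟩))
  obtain ⟨hmn, b, hb, hbS, hbS'⟩ := exists_adapted_basis hrank hspan
  refine ⟨hmn, b, hb, fun i => ?_⟩
  rcases lt_or_ge i.1 m with hi | hi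
  · obtain ⟨U, hxU, X, hX, hbX⟩ := hbS i hi
    refine ⟨U ⊓ V, ⟨hxU, hxV⟩, inf_le_right, resVec inf_le_left X,
      resVec_mem_vecParity _ hX.2, fun _ => D.isSubmoduleSheaf.res_mem U le_top _ _ X hX.1,
      fun h => absurd hi (not_lt.2 h), fun k => ?_⟩
    rw [c.comp_res _ hx (show x ∈ U ⊓ V from ⟨hxU, hxV⟩) (vecParity_le_vec _ hX.2), hbX]
  · obtain ⟨U, hxU, hUV, X, hX, hbX⟩ := hbS' i hi
    exact ⟨U, hxU, hUV, X, hX.2, fun h => absurd h (not_lt.2 hi), fun _ => hX.1,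
      fun k => by rw [hbX]⟩

/-- A chart with homogeneous fields in a distribution and in a complement which agree at `x` with
the coordinate fields. -/
theorem exists_adapted_chart {r s : ℕ} {D : M.Distribution} {x : M.carrier} (hx : x ∈ c.domain)
    {V : Opens M.carrier} (hxV : x ∈ V)
    {D' : ∀ U : Opens M.carrier, Submodule ℝ (M.EndFamily U)} (hD' : M.IsSubmoduleSheafOn V D')
    (htop : ∀ U ≤ V, D.sec U ⊔ D' U = M.vec U)
    (hr : Module.rank ℝ (D.fibre x 0) = r) (hs : Module.rank ℝ (D.fibre x 1) = s) :
    ∃ (hrp : r ≤ p) (hsq : s ≤ q) (c' : M.Chart p q) (Z : Fin p ⊕ Fin q → M.EndFamily c'.domain),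
      x ∈ c'.domain ∧ c'.domain ≤ V ∧ (∀ a, Z a ∈ M.vecParity c'.domain (coordParity a)) ∧
      (∀ a ∈ Set.range (coordEmb hrp hsq), Z a ∈ D.sec c'.domain) ∧
      (∀ a ∉ Set.range (coordEmb hrp hsq), Z a ∈ D' c'.domain) ∧
      ∀ a b, c'.cf (Z a ⟨c'.domain, le_rfl⟩ (c'.coord le_rfl b)) ∅ (c'.φ x) =
        if a = b then 1 else 0 := by
  classical
  obtain ⟨hrp, b₀, hb₀, h₀⟩ := c.exists_adapted_fields hx hxV hD' htop hr (κ := Sum.inl)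
    Sum.inl_injective (fun _ => rfl) (by
      rintro (i | j) h
      · exact ⟨i, rfl⟩
      · exact absurd h (by simp [coordParity]))
  obtain ⟨hsq, b₁, hb₁, h₁⟩ := c.exists_adapted_fields hx hxV hD' htop hs (κ := Sum.inr)
    Sum.inr_injective (fun _ => rfl) (by
      rintro (i | j) h
      · exact absurd h (by simp [coordParity])
      · exact ⟨j, rfl⟩)
  choose U₀ hxU₀ hU₀V X₀ hX₀ hX₀D hX₀D' hX₀c using h₀
  choose U₁ hxU₁ hU₁V X₁ hX₁ hX₁D hX₁D' hX₁c using h₁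
  obtain ⟨U, hxU, hU⟩ := exists_common_open (x := x)
    (Sum.elim (Sum.elim U₀ U₁) (fun _ : Unit => c.domain ⊓ V))
    (by rintro ((i | j) | _); exacts [hxU₀ i, hxU₁ j, ⟨hx, hxV⟩])
  have hU0 : ∀ i, U ≤ U₀ i := fun i => hU (Sum.inl (Sum.inl i))
  have hU1 : ∀ j, U ≤ U₁ j := fun j => hU (Sum.inl (Sum.inr j))
  have hUc : U ≤ c.domain := (hU (Sum.inr ())).trans inf_le_left
  have hUV : U ≤ V := (hU (Sum.inr ())).trans inf_le_right
  let Y : Fin p ⊕ Fin q → M.EndFamily U :=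
    Sum.elim (fun i => resVec (hU0 i) (X₀ i)) (fun j => resVec (hU1 j) (X₁ j))
  have hY : ∀ a, Y a ∈ M.vecParity U (coordParity a) := by
    rintro (i | j)
    · exact resVec_mem_vecParity (hU0 i) (hX₀ i)
    · exact resVec_mem_vecParity (hU1 j) (hX₁ j)
  have hYv : ∀ a, Y a ∈ M.vec U := fun a => vecParity_le_vec _ (hY a)
  have hY00 : ∀ i k, c.comp x (Y (Sum.inl i)) (Sum.inl k) = b₀ i k := fun i k =>
    (c.comp_res (hU0 i) hx hxU (vecParity_le_vec _ (hX₀ i)) _).trans (hX₀c i k)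
  have hY11 : ∀ j l, c.comp x (Y (Sum.inr j)) (Sum.inr l) = b₁ j l := fun j l =>
    (c.comp_res (hU1 j) hx hxU (vecParity_le_vec _ (hX₁ j)) _).trans (hX₁c j l)
  have hY01 : ∀ i l, c.comp x (Y (Sum.inl i)) (Sum.inr l) = 0 := fun i l =>
    c.comp_eq_zero_of_parity hx hxU (hY (Sum.inl i)) (by simp [coordParity])
  have hY10 : ∀ j k, c.comp x (Y (Sum.inr j)) (Sum.inl k) = 0 := fun j k =>
    c.comp_eq_zero_of_parity hx hxU (hY (Sum.inr j)) (by simp [coordParity])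
  have hu₀ : IsUnit (Matrix.of b₀) := Matrix.linearIndependent_rows_iff_isUnit.1 hb₀
  have hu₁ : IsUnit (Matrix.of b₁) := Matrix.linearIndependent_rows_iff_isUnit.1 hb₁
  have hi₀ := Matrix.mul_nonsing_inv _ ((Matrix.isUnit_iff_isUnit_det _).1 hu₀)
  have hi₁ := Matrix.mul_nonsing_inv _ ((Matrix.isUnit_iff_isUnit_det _).1 hu₁)
  -- With the transposed inverses as coefficients, the new functions are dual at `x` to the fields
  -- `Y a`.
  let w := c.linCoord hUc ((Matrix.of b₀)⁻¹.transpose) ((Matrix.of b₁)⁻¹.transpose)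
  have hYw : ∀ a b, c.cf (Y a ⟨U, le_rfl⟩ (w b)) ∅ (c.φ x) = if a = b then 1 else 0 := by
    intro a b
    rw [c.cf_field_linCoord hUc hxU (hYv a)]
    rcases a with i | j <;> rcases b with k | l
    · have := congrFun (congrFun hi₀ i) k
      rw [Matrix.mul_apply, Matrix.one_apply] at this
      simp only [Sum.elim_inl, hY00, Matrix.transpose_apply, Sum.inl.injEq]
      rw [← this]
      exact Finset.sum_congr rfl fun e _ => mul_comm _ _
    · simp [hY01]
    · simp [hY10]
    · have := congrFun (congrFun hi₁ j) l
      rw [Matrix.mul_apply, Matrix.one_apply] at this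
      simp only [Sum.elim_inr, hY11, Matrix.transpose_apply, Sum.inr.injEq]
      rw [← this]
      exact Finset.sum_congr rfl fun e _ => mul_comm _ _
  -- By the duality at `x`, the matrix of components of the `Y a` is inverse to the transposed
  -- Jacobian of `w`.
  have hdet : (Matrix.of fun a b => c.dAt x (w a) b).det ≠ 0 := by
    have h1 : (Matrix.of fun a e => c.comp x (Y a) e) *
        (Matrix.of fun a b => c.dAt x (w a) b).transpose = 1 := by
      ext a b
      rw [Matrix.mul_apply, Matrix.one_apply, ← hYw, c.cf_vec_empty hUc hxU (hYv a)]
      rfl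
    have h2 := congrArg Matrix.det h1
    rw [Matrix.det_mul, Matrix.det_transpose, Matrix.det_one] at h2
    exact right_ne_zero_of_mul (by rw [h2]; exact one_ne_zero)
  obtain ⟨c', h', hx', hw'⟩ := c.exists_chart_of_dAt hUc hxU
    (c.linCoord_mem_parity hUc _ _) hdet
  refine ⟨hrp, hsq, c', fun a => resVec h' (Y a), hx', h'.trans hUV,
    fun a => resVec_mem_vecParity _ (hY a), fun a ha => ?_, fun a ha => ?_, ?_⟩
  · refine D.isSubmoduleSheaf.res_mem U le_top _ h' (Y a) ?_
    obtain ⟨i | j, rfl⟩ := ha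
    · exact D.isSubmoduleSheaf.res_mem _ le_top _ (hU0 _) _ (hX₀D (Fin.castLE hrp i) i.2)
    · exact D.isSubmoduleSheaf.res_mem _ le_top _ (hU1 _) _ (hX₁D (Fin.castLE hsq j) j.2)
  · refine hD'.res_mem U hUV _ h' (Y a) ?_
    rcases a with i | j
    · refine hD'.res_mem _ (hU₀V i) _ (hU0 i) _ (hX₀D' i ?_)
      by_contra hlt
      exact ha ⟨Sum.inl ⟨i, not_le.1 hlt⟩, rfl⟩
    · refine hD'.res_mem _ (hU₁V j) _ (hU1 j) _ (hX₁D' j ?_)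
      by_contra hlt
      exact ha ⟨Sum.inr ⟨j, not_le.1 hlt⟩, rfl⟩
  · intro a b
    rw [hw', resVec_apply, ← c'.value_eq hx' hx', ← vec_res (hYv a) ⟨U, le_rfl⟩ ⟨c'.domain, h'⟩ h',
      c.value_eq hx hx', c.cf_res h' _ _ (c.mem_img hx hx')]
    exact hYw a b

end Chart

end SuperRingedSpace

/-! ### Supercommuting frames of integrable distributions -/

namespace SuperRingedSpace

theorem Distribution.funMul_sum_mem {M : SuperRingedSpace.{u}} (D : M.Distribution)
    {W : Opens M.carrier} {ι : Type*} {s : Finset ι} {g : ι → M.Sec W} {X : ι → M.EndFamily W}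
    (hX : ∀ i ∈ s, X i ∈ D.sec W) : ∑ i ∈ s, funMul (g i) (X i) ∈ D.sec W :=
  Submodule.sum_mem _ fun i hi => D.isSubmoduleSheaf.funMul_mem W le_top _ _ (hX i hi)

/-- In a graded submodule every field which acts homogeneously on given functions may be replaced
by a homogeneous one. -/
theorem exists_homogeneous {M : SuperRingedSpace.{u}} {U : Opens M.carrier}
    {F : Submodule ℝ (M.EndFamily U)}
    (hF : F ≤ (F ⊓ M.vecParity U 0) ⊔ (F ⊓ M.vecParity U 1)) {X : M.EndFamily U} (hX : X ∈ F)
    (d : ZMod 2) : ∃ Y ∈ F ⊓ M.vecParity U d, ∀ (f : M.Sec U) (e : ZMod 2), f ∈ M.parity U e →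
      X ⟨U, le_rfl⟩ f ∈ M.parity U (d + e) → Y ⟨U, le_rfl⟩ f = X ⟨U, le_rfl⟩ f := by
  obtain ⟨X₀, h₀, X₁, h₁, rfl⟩ := Submodule.mem_sup.1 (hF hX)
  have hc : ∀ e : ZMod 2, e = 0 ∨ e = 1 := by decide
  rcases hc d with h | h
  · subst h
    refine ⟨X₀, h₀, fun f e hf hXf => ?_⟩
    have h3 := eq_zero_of_parity_add (h₀.2.2.1 ⟨U, le_rfl⟩ e f hf)
      (by have := h₁.2.2.1 ⟨U, le_rfl⟩ e f hf
          rwa [add_comm (1 : ZMod 2), ← zero_add e] at this) hXf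
    change _ = X₀ ⟨U, le_rfl⟩ f + X₁ ⟨U, le_rfl⟩ f
    rw [h3, add_zero]
  · subst h
    refine ⟨X₁, h₁, fun f e hf hXf => ?_⟩
    have h3 := eq_zero_of_parity_add (h₁.2.2.1 ⟨U, le_rfl⟩ e f hf)
      (g := X₀ ⟨U, le_rfl⟩ f)
      (by have := h₀.2.2.1 ⟨U, le_rfl⟩ e f hf
          have he : (1 : ZMod 2) + e + 1 = 0 + e := by
            have : ∀ e : ZMod 2, 1 + e + 1 = 0 + e := by decide
            exact this e
          rwa [he]) (by rw [add_comm (X₁ ⟨U, le_rfl⟩ f)]; exact hXf)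
    change _ = X₀ ⟨U, le_rfl⟩ f + X₁ ⟨U, le_rfl⟩ f
    rw [h3, zero_add]

namespace Chart

variable {M : SuperRingedSpace.{u}} {p q : ℕ} (c : M.Chart p q) {U V : Opens M.carrier}

/-- An integrable distribution of rank `r|s` is locally spanned by supercommuting homogeneous
fields which are dual to the first `r|s` coordinates of a suitable chart. -/
theorem exists_frame {r s : ℕ} {D : M.Distribution} (hint : D.IsIntegrable) {x : M.carrier}
    (hx : x ∈ c.domain)
    (hr : Module.rank ℝ (D.fibre x 0) = r) (hs : Module.rank ℝ (D.fibre x 1) = s) :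
    ∃ (hrp : r ≤ p) (hsq : s ≤ q) (c' : M.Chart p q) (U : Opens M.carrier) (hU : U ≤ c'.domain)
      (X : Fin r ⊕ Fin s → M.EndFamily U), x ∈ U ∧ (∀ a, X a ∈ D.sec U) ∧
      (∀ a, X a ∈ M.vecParity U (coordParity a)) ∧
      (∀ a b, X a ⟨U, le_rfl⟩ (c'.coord hU (coordEmb hrp hsq b)) = if a = b then 1 else 0) ∧
      (∀ (W : Opens M.carrier) (hW : W ≤ U) (Y : M.EndFamily W), Y ∈ D.sec W →
        ∃ g : Fin r ⊕ Fin s → M.Sec W, Y = ∑ a, funMul (g a) (resVec hW (X a))) ∧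
      ∀ a b, bracket (coordParity a) (coordParity b) (X a) (X b) = 0 := by
  classical
  obtain ⟨V, D', hxV, hD', hDD'⟩ := D.locally_direct_factor x
  obtain ⟨hrp, hsq, c', Z, hx', hcV, hZp, hZD, hZD', hZx⟩ := c.exists_adapted_chart hx hxV hD'
    (fun U hU => (hDD' U hU).2) hr hs
  let emb := coordEmb hrp hsq
  let U₀ := c'.domain
  have hZv : ∀ a, Z a ∈ M.vec U₀ := fun a => vecParity_le_vec _ (hZp a)
  -- Two matrices are inverted: the full one makes the `Z a` a frame for all vector fields, and its
  -- `r|s` block lets the first coordinates separate the sections of `D`.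
  obtain ⟨U₁, hU₁, hxU₁, hu₁⟩ := c'.exists_isUnit_matrix (le_refl U₀) hx'
    (Matrix.of fun a b => Z a ⟨U₀, le_rfl⟩ (c'.coord le_rfl b)) (by
      have : ((Matrix.of fun a b => Z a ⟨U₀, le_rfl⟩ (c'.coord le_rfl b)).map
          fun f => c'.cf f ∅ (c'.φ x)) = 1 := by
        ext a b
        simpa [Matrix.one_apply] using hZx a b
      rw [this, Matrix.det_one]
      exact one_ne_zero)
  obtain ⟨U₂, hU₂, hxU₂, hu₂⟩ := c'.exists_isUnit_matrix (le_refl U₀) hx'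
    (Matrix.of fun a b => Z (emb a) ⟨U₀, le_rfl⟩ (c'.coord le_rfl (emb b))) (by
      have : ((Matrix.of fun a b => Z (emb a) ⟨U₀, le_rfl⟩ (c'.coord le_rfl (emb b))).map
          fun f => c'.cf f ∅ (c'.φ x)) = 1 := by
        ext a b
        simpa [Matrix.one_apply] using hZx (emb a) (emb b)
      rw [this, Matrix.det_one]
      exact one_ne_zero)
  have hres : ∀ (W : Opens M.carrier) (hW : W ≤ U₀) (a b), M.res hW (Z a ⟨U₀, le_rfl⟩
      (c'.coord le_rfl b)) = Z a ⟨W, hW⟩ (c'.coord hW b) := fun W hW a b => by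
    rw [vec_res (hZv a) ⟨U₀, le_rfl⟩ ⟨W, hW⟩ hW, c'.res_coord]
  let U := U₁ ⊓ U₂
  have hU1 : U ≤ U₁ := inf_le_left
  have hU2 : U ≤ U₂ := inf_le_right
  have hU : U ≤ U₀ := hU1.trans hU₁
  have hxU : x ∈ U := ⟨hxU₁, hxU₂⟩
  -- fields of the distribution are combinations of the `Z (emb a)`
  have hcomb : ∀ (W : Opens M.carrier) (hW : W ≤ U) (Y : M.EndFamily W), Y ∈ D.sec W →
      ∃ g : Fin r ⊕ Fin s → M.Sec W, Y = ∑ a, funMul (g a) (resVec (hW.trans hU) (Z (emb a))) := by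
    intro W hW Y hY
    have hu : IsUnit (Matrix.of fun a b => resVec hU₁ (Z a) ⟨U₁, le_rfl⟩ (c'.coord hU₁ b)) := by
      convert! hu₁ using 1
      ext1 a b
      exact (hres U₁ hU₁ a b).symm
    obtain ⟨g, hg⟩ := c'.exists_eq_sum_of_isUnit hU₁ (fun a => resVec_mem_vec hU₁ (hZv a)) hu W
      (hW.trans hU1) (D.isSubmoduleSheaf.le_vec W le_top hY)
    simp only [resVec_resVec] at hg
    refine ⟨fun a => g (emb a), ?_⟩
    have hWU := hW.trans hU
    have hsplit := Finset.sum_filter_add_sum_filter_not Finset.univ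
      (fun a => a ∈ Set.range emb) (fun a => funMul (g a) (resVec hWU (Z a)))
    have hfil : Finset.univ.filter (fun a => a ∈ Set.range emb) = Finset.univ.map emb := by
      ext a; simp
    rw [← hg, hfil, Finset.sum_map] at hsplit
    have h1 : ∑ a, funMul (g (emb a)) (resVec hWU (Z (emb a))) ∈ D.sec W :=
      D.funMul_sum_mem fun a _ =>
        D.isSubmoduleSheaf.res_mem _ le_top _ _ _ (hZD (emb a) ⟨a, rfl⟩)
    have hWV : W ≤ V := hWU.trans hcV
    have h2 : ∑ a with a ∉ Set.range emb, funMul (g a) (resVec hWU (Z a)) ∈ D' W :=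
      Submodule.sum_mem _ fun a ha => hD'.funMul_mem W hWV _ _
        (hD'.res_mem _ hcV _ _ _ (hZD' a (Finset.mem_filter.1 ha).2))
    have h3 : ∑ a with a ∉ Set.range emb, funMul (g a) (resVec hWU (Z a)) ∈ D.sec W := by
      have := Submodule.sub_mem _ hY h1
      rwa [← hsplit, add_sub_cancel_left] at this
    -- The contribution of the complement lies in `D` as well as in `D'`, and these intersect in
    -- zero.
    have h4 : ∑ a with a ∉ Set.range emb, funMul (g a) (resVec hWU (Z a)) = 0 := by
      have : _ ∈ D.sec W ⊓ D' W := ⟨h3, h2⟩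
      rwa [(hDD' W hWV).1, Submodule.mem_bot] at this
    rw [h4, add_zero] at hsplit
    exact hsplit.symm
  obtain ⟨T, hT⟩ := hu₂
  let R : Matrix (Fin r ⊕ Fin s) (Fin r ⊕ Fin s) (M.Sec U₂) := ↑T⁻¹
  have hRl : R * ((Matrix.of fun a b =>
      Z (emb a) ⟨U₀, le_rfl⟩ (c'.coord le_rfl (emb b))).map (M.res hU₂)) = 1 := by
    rw [← hT, Units.inv_mul]
  have hRr : ((Matrix.of fun a b =>
      Z (emb a) ⟨U₀, le_rfl⟩ (c'.coord le_rfl (emb b))).map (M.res hU₂)) * R = 1 := by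
    rw [← hT, Units.mul_inv]
  -- a field of the distribution is determined by its values on the first coordinates
  have hzero : ∀ (W : Opens M.carrier) (hW : W ≤ U) (Y : M.EndFamily W), Y ∈ D.sec W →
      (∀ b, Y ⟨W, le_rfl⟩ (c'.coord (hW.trans hU) (emb b)) = 0) → Y = 0 := by
    intro W hW Y hY h0
    obtain ⟨g, rfl⟩ := hcomb W hW Y hY
    have hW2 : W ≤ U₂ := hW.trans hU2
    have h1 : ∀ b, ∑ a, g a * M.res hW2
        (M.res hU₂ (Z (emb a) ⟨U₀, le_rfl⟩ (c'.coord le_rfl (emb b)))) = 0 := by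
      intro b
      rw [← h0 b, sum_endFamily_apply]
      refine Finset.sum_congr rfl fun a _ => ?_
      rw [funMul_apply, res_self, resVec_apply, res_res, hres]
    have h2 : ∀ e, g e = 0 := by
      intro e
      have h3 : ∑ b, (∑ a, g a * M.res hW2
          (M.res hU₂ (Z (emb a) ⟨U₀, le_rfl⟩ (c'.coord le_rfl (emb b))))) * M.res hW2 (R b e) =
            g e := by
        simp only [Finset.sum_mul, mul_assoc, ← map_mul]
        rw [Finset.sum_comm]
        simp only [← Finset.mul_sum, ← map_sum]
        have h4 : ∀ a, ∑ b, M.res hU₂ (Z (emb a) ⟨U₀, le_rfl⟩ (c'.coord le_rfl (emb b))) * R b e =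
            if a = e then 1 else 0 := fun a => by
          have := congrFun (congrFun hRr a) e
          rwa [Matrix.mul_apply, Matrix.one_apply] at this
        simp only [h4]
        rw [Finset.sum_eq_single e]
        · simp
        · intro b _ hb
          simp [hb]
        · simp
      rw [← h3]
      simp only [h1, zero_mul, Finset.sum_const_zero]
    simp only [h2, zero_funMul, Finset.sum_const_zero]
  -- Multiplication by the inverse of the block normalizes the values on the first coordinates on
  -- all of `U`, not just at `x`.
  have hX' : ∀ a, ∃ X ∈ D.sec U, ∀ b, X ⟨U, le_rfl⟩ (c'.coord hU (emb b)) =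
      if a = b then 1 else 0 := by
    intro a
    refine ⟨∑ e, funMul (M.res hU2 (R a e)) (resVec hU (Z (emb e))), D.funMul_sum_mem fun e _ =>
      D.isSubmoduleSheaf.res_mem _ le_top _ _ _ (hZD (emb e) ⟨e, rfl⟩), fun b => ?_⟩
    have h1 := congrArg (M.res hU2) (congrFun (congrFun hRl a) b)
    rw [Matrix.mul_apply, map_sum, Matrix.one_apply] at h1
    rw [sum_endFamily_apply, ← map_one (M.res hU2), ← map_zero (M.res hU2),
      ← apply_ite (M.res hU2), ← h1]
    refine Finset.sum_congr rfl fun e _ => ?_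
    rw [funMul_apply, res_self, resVec_apply, map_mul, Matrix.map_apply, Matrix.of_apply, res_res,
      hres]
  -- The inverse matrix is not known to have homogeneous entries. The part of the field of the right
  -- parity has the same values on the first coordinates, since those values already have the
  -- matching parity.
  have hX'' : ∀ a, ∃ X ∈ D.sec U ⊓ M.vecParity U (coordParity a), ∀ b,
      X ⟨U, le_rfl⟩ (c'.coord hU (emb b)) = if a = b then 1 else 0 := by
    intro a
    obtain ⟨X, hX, hXb⟩ := hX' a
    obtain ⟨Y, hY, hYX⟩ := exists_homogeneous (D.isSubmoduleSheaf.graded U le_top) hX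
      (coordParity a)
    refine ⟨Y, hY, fun b => ?_⟩
    rw [hYX _ (coordParity b), hXb]
    · rw [← coordParity_coordEmb hrp hsq b]
      exact c'.coord_mem_parity hU (emb b)
    · rw [hXb]
      exact delta_mem_parity a b
  choose X hX hXb using hX''
  refine ⟨hrp, hsq, c', U, hU, X, hxU, fun a => (hX a).1, fun a => (hX a).2, hXb, ?_, ?_⟩
  · intro W hW Y hY
    have hWU := hW.trans hU
    refine ⟨fun a => Y ⟨W, le_rfl⟩ (c'.coord hWU (emb a)), ?_⟩
    rw [← sub_eq_zero]
    refine hzero W hW _ (Submodule.sub_mem _ hY (D.funMul_sum_mem fun a _ =>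
      D.isSubmoduleSheaf.res_mem _ le_top _ _ _ (hX a).1)) fun b => ?_
    change Y ⟨W, le_rfl⟩ (c'.coord hWU (emb b)) - (∑ a, funMul
      (Y ⟨W, le_rfl⟩ (c'.coord hWU (emb a))) (resVec hW (X a))) ⟨W, le_rfl⟩ _ = 0
    have hXW : ∀ a, X a ⟨W, hW⟩ (c'.coord hWU (emb b)) = if a = b then 1 else 0 := by
      intro a
      rw [← c'.res_coord hW hU, ← vec_res (vecParity_le_vec _ (hX a).2) ⟨U, le_rfl⟩ ⟨W, hW⟩ hW,
        hXb, apply_ite (M.res hW), map_one, map_zero]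
    rw [sum_endFamily_apply, sub_eq_zero, Finset.sum_eq_single b]
    · rw [funMul_apply, res_self, resVec_apply, hXW, if_pos rfl, mul_one]
    · intro a _ ha
      rw [funMul_apply, res_self, resVec_apply, hXW, if_neg ha, mul_zero]
    · simp
  · intro a b
    -- Integrability puts the bracket into `D`, where the first coordinates detect it; there it
    -- vanishes, because the frame takes constant values on these coordinates.
    refine hzero U le_rfl _ (hint U _ _ _ (hX a) _ (hX b)) fun e => ?_
    have hdelta : ∀ a b, X a ⟨U, le_rfl⟩ (if b = e then (1 : M.Sec U) else 0) = 0 := by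
      intro a b
      split_ifs
      · exact vecParity_one (hX a).2 ⟨U, le_rfl⟩
      · exact map_zero _
    change X a ⟨U, le_rfl⟩ (X b ⟨U, le_rfl⟩ (c'.coord hU (emb e))) -
      superSign _ _ • X b ⟨U, le_rfl⟩ (X a ⟨U, le_rfl⟩ (c'.coord hU (emb e))) = 0
    rw [hXb, hXb, hdelta, hdelta, smul_zero, sub_zero]

end Chart

end SuperRingedSpace

/-! ### Transport along even fields -/

namespace SuperRingedSpace

namespace Chart

variable {M : SuperRingedSpace.{u}} {p q : ℕ} (c : M.Chart p q) {U V : Opens M.carrier}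

/-- An even field sends an odd coordinate to an odd function, so differentiating one factor of the
monomial does not lower the degree. -/
theorem inFil_evenField_thetaProd (hU : U ≤ c.domain) {X : M.EndFamily U}
    (hX : X ∈ M.vecParity U 0) (L : List (Fin q)) :
    c.InFil L.length (X ⟨U, le_rfl⟩ (c.thetaProd hU L)) := by
  induction L with
  | nil => exact c.inFil_zero _
  | cons j L ih =>
    rw [c.thetaProd_cons, evenField_mul hX, List.length_cons, add_comm]
    have h1 : X ⟨U, le_rfl⟩ (c.thetaProd hU [j]) ∈ M.parity U 1 := by
      simpa using hX.2.1 ⟨U, le_rfl⟩ 1 _ (c.thetaProd_odd hU j)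
    exact ((c.inFil_one_of_odd hU h1).mul hU (c.inFil_thetaProd hU L)).add
      ((c.inFil_one_of_odd hU (c.thetaProd_odd hU j)).mul hU ih)

/-- The body of a field: its even components modulo nilpotents. -/
noncomputable def bodyField (hU : U ≤ c.domain) (X : M.EndFamily U) (y : Fin p → ℝ) : Fin p → ℝ :=
  fun i => c.cf (X ⟨U, le_rfl⟩ (c.coord hU (Sum.inl i))) ∅ y

theorem contDiffOn_bodyField (hU : U ≤ c.domain) (X : M.EndFamily U) :
    ContDiffOn ℝ ∞ (c.bodyField hU X) (c.img U) := contDiffOn_pi.2 fun _ => c.contDiffOn_cf _ _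

/-- A pulled back function has no odd derivatives; the even directions add up to the derivative
along the body field. -/
theorem cf_field_pullTo_empty (hU : U ≤ c.domain) {X : M.EndFamily U} (hX : X ∈ M.vec U)
    (g : smoothFun (c.img U)) {y : Fin p → ℝ} (hy : y ∈ c.img U) :
    c.cf (X ⟨U, le_rfl⟩ (c.pullTo hU g)) ∅ y =
      fderiv ℝ (smoothFun.ext0 g) y (c.bodyField hU X y) := by
  have hxU : c.φ.symm y ∈ U := hy.2
  have hφ : c.φ (c.φ.symm y) = y := c.φ.right_inv hy.1
  have h := c.cf_vec_empty hU hxU hX (c.pullTo hU g)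
  rw [hφ] at h
  have hodd : ∀ j, c.dAt (c.φ.symm y) (c.pullTo hU g) (Sum.inr j) = 0 := fun j => by
    change c.cf (c.pullTo hU g) {j} _ = 0
    rw [c.cf_pullTo, if_neg (by simp)]
  have heven : ∀ i, c.dAt (c.φ.symm y) (c.pullTo hU g) (Sum.inl i) =
      fderiv ℝ (smoothFun.ext0 g) y (Pi.single i 1) := fun i => by
    change fderiv ℝ (c.cf (c.pullTo hU g) ∅) (c.φ (c.φ.symm y)) (Pi.single i 1) = _
    rw [hφ, c.fderiv_congr_img (U := U) (F := c.cf (c.pullTo hU g) ∅) (G := smoothFun.ext0 g)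
      (fun z _ => by rw [c.cf_pullTo, if_pos rfl]) hy]
  rw [h, Fintype.sum_sum_type]
  simp only [hodd, mul_zero, Finset.sum_const_zero, add_zero, heven, c.comp_eq hU hxU hX, hφ]
  conv_rhs => rw [pi_eq_sum_univ' (c.bodyField hU X y), map_sum]
  refine Finset.sum_congr rfl fun i _ => ?_
  rw [map_smul, smul_eq_mul]
  rfl

theorem cf_mul_thetaProd_of_card_le (hU : U ≤ c.domain) (f : M.Sec U) {I J : Finset (Fin q)}
    (hIJ : I.card ≤ J.card) {y : Fin p → ℝ} (hy : y ∈ c.img U) :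
    c.cf (f * c.thetaProd hU J.sort) I y = if J = I then c.cf f ∅ y else 0 :=
  c.cf_mul_thetaProd_of_inFil hU (c.inFil_nilPart hU f) hIJ hy

/-- The leading coefficients of the derivative along an even field. -/
theorem cf_evenField (hU : U ≤ c.domain) {X : M.EndFamily U} (hX : X ∈ M.vecParity U 0) {k : ℕ}
    {f : M.Sec U} (hf : c.InFil k f) {K : Finset (Fin q)} (hK : K.card ≤ k) {y : Fin p → ℝ}
    (hy : y ∈ c.img U) : c.cf (X ⟨U, le_rfl⟩ f) K y =
      fderiv ℝ (c.cf f K) y (c.bodyField hU X y) +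
        ∑ I, c.cf (X ⟨U, le_rfl⟩ (c.thetaProd hU I.sort)) K y * c.cf f I y := by
  have h0 : ∀ I : Finset (Fin q), I.card < k → c.coef U f I = 0 := fun I hI =>
    smoothFun.ext_of_ext0 fun z hz => by rw [smoothFun.ext0_zero]; exact hf I hI z hz
  have hexp : c.cf (X ⟨U, le_rfl⟩ f) K y = ∑ I,
      (c.cf (X ⟨U, le_rfl⟩ (c.pullTo hU (c.coef U f I)) * c.thetaProd hU I.sort) K y +
        c.cf (X ⟨U, le_rfl⟩ (c.thetaProd hU I.sort)) K y * c.cf f I y) := by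
    conv_lhs => rw [c.eq_sum hU f]
    rw [map_sum, c.cf_sum _ _ _ hy]
    refine Finset.sum_congr rfl fun I _ => ?_
    rw [evenField_mul hX, c.cf_add _ _ _ hy, c.cf_pullTo_mul hU _ _ _ hy, mul_comm (c.cf _ _ _)]
    rfl
  rw [hexp, Finset.sum_add_distrib]
  congr 1
  -- For `|K| ≤ k ≤ |I|`, the product of the derivative of `f_I` with `θ^I` reaches degree `|K|`
  -- only through its leading term, so `I = K` alone contributes.
  rw [Finset.sum_eq_single K]
  · rw [c.cf_mul_thetaProd_of_card_le hU _ le_rfl hy, if_pos rfl,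
      c.cf_field_pullTo_empty hU (vecParity_le_vec _ hX) _ hy]
    rfl
  · intro I _ hI
    by_cases hIk : I.card < k
    · rw [h0 I hIk, map_zero, map_zero, zero_mul, c.cf_zero]
    · rw [c.cf_mul_thetaProd_of_card_le hU _ (by omega) hy, if_neg hI]
  · simp

theorem InFil.evenField (hU : U ≤ c.domain) {X : M.EndFamily U} (hX : X ∈ M.vecParity U 0)
    {k : ℕ} {f : M.Sec U} (hf : c.InFil k f) : c.InFil k (X ⟨U, le_rfl⟩ f) := by
  intro K hK y hy
  rw [c.cf_evenField hU hX hf hK.le hy,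
    c.fderiv_congr_img (G := fun _ => (0 : ℝ)) (fun z hz => hf K hK z hz) hy, Finset.sum_eq_zero]
  · simp
  · intro I _
    by_cases hI : I.card < k
    · rw [hf I hI y hy, mul_zero]
    · have h := c.inFil_evenField_thetaProd hU hX I.sort K (by rw [Finset.length_sort]; omega) y hy
      rw [h, zero_mul]

/-- All coefficients of `f` vanish on the hyperplane `t^i = τ`. -/
def VanishesOn (i : Fin p) (τ : ℝ) (f : M.Sec U) : Prop :=
  ∀ I, ∀ y ∈ c.img U, y i = τ → c.cf f I y = 0

variable {c} in
theorem VanishesOn.add {i : Fin p} {τ : ℝ} {f g : M.Sec U} (hf : c.VanishesOn i τ f)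
    (hg : c.VanishesOn i τ g) : c.VanishesOn i τ (f + g) := fun I y hy h => by
  rw [c.cf_add _ _ _ hy, hf I y hy h, hg I y hy h, add_zero]

variable {c} in
theorem VanishesOn.res {i : Fin p} {τ : ℝ} {f : M.Sec U} (hf : c.VanishesOn i τ f) (h : V ≤ U) :
    c.VanishesOn i τ (M.res h f) := fun I y hy hi => by
  rw [c.cf_res h _ _ hy]; exact hf I y (c.img_mono h hy) hi

theorem vanishesOn_zero (i : Fin p) (τ : ℝ) : c.VanishesOn i τ (0 : M.Sec U) :=
  fun I y _ _ => c.cf_zero I y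

theorem vanishesOn_sum {ι : Type*} {s : Finset ι} {i : Fin p} {τ : ℝ} {f : ι → M.Sec U}
    (h : ∀ a ∈ s, c.VanishesOn i τ (f a)) : c.VanishesOn i τ (∑ a ∈ s, f a) :=
  fun I y hy hi => by
    rw [c.cf_sum _ _ _ hy]; exact Finset.sum_eq_zero fun a ha => h a ha I y hy hi

variable {c} in
theorem VanishesOn.mul_left (hU : U ≤ c.domain) {i : Fin p} {τ : ℝ} {f : M.Sec U}
    (hf : c.VanishesOn i τ f) (g : M.Sec U) : c.VanishesOn i τ (g * f) := fun K y hy hi => by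
  rw [c.cf_mul hU _ _ _ hy]
  refine Finset.sum_eq_zero fun I _ => Finset.sum_eq_zero fun J _ => ?_
  rw [hf J y hy hi]
  simp

/-- Moving in a direction `k ≠ i` stays inside the hyperplane. -/
theorem fderiv_eq_zero_of_vanishes {W : Opens (Fin p → ℝ)} {F : (Fin p → ℝ) → ℝ} {i k : Fin p}
    (hik : k ≠ i) {τ : ℝ} (hF : ∀ y ∈ W, y i = τ → F y = 0) {y : Fin p → ℝ} (hy : y ∈ W)
    (hi : y i = τ) (hd : DifferentiableAt ℝ F y) : fderiv ℝ F y (Pi.single k 1) = 0 := by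
  rw [← hd.lineDeriv_eq_fderiv, lineDeriv]
  have hc : Continuous fun t : ℝ => y + t • (Pi.single k 1 : Fin p → ℝ) := by fun_prop
  have hev : (fun t : ℝ => F (y + t • (Pi.single k 1 : Fin p → ℝ))) =ᶠ[nhds 0] fun _ => 0 := by
    have := hc.continuousAt.preimage_mem_nhds (x := 0) (W.2.mem_nhds (by simpa using hy))
    refine Filter.eventually_of_mem this fun t ht => hF _ ht ?_
    simp [hi, Pi.single_eq_of_ne hik.symm]
  rw [hev.deriv_eq, deriv_const]

-- The condition on `X` is tangency to the hyperplane: `∂/∂t^i` does not occur in `X`, and the other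
-- coordinate fields preserve vanishing there.
variable {c} in
theorem VanishesOn.field (hU : U ≤ c.domain) {i : Fin p} {τ : ℝ} {f : M.Sec U}
    (hf : c.VanishesOn i τ f) {X : M.EndFamily U} (hX : X ∈ M.vec U)
    (hXi : X ⟨U, le_rfl⟩ (c.coord hU (Sum.inl i)) = 0) :
    c.VanishesOn i τ (X ⟨U, le_rfl⟩ f) := by
  have h : X ⟨U, le_rfl⟩ f = ∑ a, X ⟨U, le_rfl⟩ (c.coord hU a) * c.coordField a ⟨U, hU⟩ f := by
    conv_lhs => rw [c.vec_eq_sum hU hX]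
    rw [sum_endFamily_apply]
    refine Finset.sum_congr rfl fun a _ => ?_
    rw [funMul_apply, res_self]
    rfl
  rw [h]
  refine c.vanishesOn_sum fun a _ => ?_
  rcases a with k | j
  · by_cases hk : k = i
    · rw [hk, hXi, zero_mul]
      exact c.vanishesOn_zero i τ
    · refine VanishesOn.mul_left hU (fun I y hy hi => ?_) _
      change c.cf (c.partialT k ⟨U, hU⟩ f) I y = 0
      rw [c.cf_partialT k ⟨U, hU⟩ f I hy]
      exact fderiv_eq_zero_of_vanishes hk (fun z hz hzi => hf I z hz hzi) hy hi
        (c.differentiableAt_cf f I hy)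
  · refine VanishesOn.mul_left hU (fun I y hy hi => ?_) _
    change c.cf (c.partialTheta j ⟨U, hU⟩ f) I y = 0
    rw [c.cf_partialTheta j ⟨U, hU⟩ f I hy, hf _ y hy hi]
    simp

theorem dAt_eq_zero_of_vanishesOn {x : M.carrier} (hx : x ∈ c.domain) (hxU : x ∈ U) {i : Fin p}
    {f : M.Sec U} (hf : c.VanishesOn i (c.φ x i) f) {a : Fin p ⊕ Fin q} (ha : a ≠ Sum.inl i) :
    c.dAt x f a = 0 := by
  have hxi := c.mem_img hx hxU
  rcases a with k | j
  · exact fderiv_eq_zero_of_vanishes (fun h => ha (by rw [h])) (fun z hz hzi => hf ∅ z hz hzi) hxi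
      rfl (c.differentiableAt_cf f ∅ hxi)
  · exact hf _ _ hxi rfl

end Chart

end SuperRingedSpace

/-! ### Existence and uniqueness for transport of sections -/

namespace SuperRingedSpace

namespace Chart

variable {M : SuperRingedSpace.{u}} {p q : ℕ} (c : M.Chart p q) {U V : Opens M.carrier}

theorem bodyField_resVec (h : V ≤ U) (hU : U ≤ c.domain) {X : M.EndFamily U} (hX : X ∈ M.vec U)
    {y : Fin p → ℝ} (hy : y ∈ c.img V) :
    c.bodyField (h.trans hU) (resVec h X) y = c.bodyField hU X y := by
  funext i
  rw [bodyField, bodyField, resVec_apply, ← c.res_coord h hU,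
    ← vec_res hX ⟨U, le_rfl⟩ ⟨V, h⟩ h, c.cf_res h _ _ hy]

theorem cf_field_thetaProd_resVec (h : V ≤ U) (hU : U ≤ c.domain) {X : M.EndFamily U}
    (hX : X ∈ M.vec U) (L : List (Fin q)) (K : Finset (Fin q)) {y : Fin p → ℝ}
    (hy : y ∈ c.img V) : c.cf (resVec h X ⟨V, le_rfl⟩ (c.thetaProd (h.trans hU) L)) K y =
      c.cf (X ⟨U, le_rfl⟩ (c.thetaProd hU L)) K y := by
  rw [resVec_apply, ← c.res_thetaProd h hU, ← vec_res hX ⟨U, le_rfl⟩ ⟨V, h⟩ h, c.cf_res h _ _ hy]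

theorem proj_bodyField (hU : U ≤ c.domain) {X : M.EndFamily U} {i : Fin p}
    (hXi : X ⟨U, le_rfl⟩ (c.coord hU (Sum.inl i)) = 1) {y : Fin p → ℝ} (hy : y ∈ c.img U) :
    ContinuousLinearMap.proj (R := ℝ) (φ := fun _ : Fin p => ℝ) i (c.bodyField hU X y) = 1 := by
  change c.cf (X ⟨U, le_rfl⟩ (c.coord hU (Sum.inl i))) ∅ y = 1
  rw [hXi, c.cf_one hU _ hy, if_pos rfl]

/-- The coefficients of degree `k` in the derivative of a family of coefficients of degree `k`. -/
theorem contDiffOn_cf_sub_sum (hU : U ≤ c.domain) (X : M.EndFamily U) (f : M.Sec U) (k : ℕ) :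
    ContDiffOn ℝ ∞ (fun (z : (Fin p → ℝ) × (Finset (Fin q) → ℝ)) (K : Finset (Fin q)) =>
      c.cf f K z.1 - ∑ I, (if I.card = k then
        c.cf (X ⟨U, le_rfl⟩ (c.thetaProd hU I.sort)) K z.1 else 0) * z.2 I)
      ((c.img U : Set (Fin p → ℝ)) ×ˢ Set.univ) := by
  have hmaps : Set.MapsTo (Prod.fst : (Fin p → ℝ) × (Finset (Fin q) → ℝ) → Fin p → ℝ)
      ((c.img U : Set (Fin p → ℝ)) ×ˢ Set.univ) (c.img U) := fun z hz => hz.1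
  refine contDiffOn_pi.2 fun K => ContDiffOn.sub
    ((c.contDiffOn_cf f K).comp contDiff_fst.contDiffOn hmaps)
    (ContDiffOn.sum fun I _ => ContDiffOn.mul ?_ ?_)
  · split_ifs
    · exact (c.contDiffOn_cf _ K).comp contDiff_fst.contDiffOn hmaps
    · exact contDiffOn_const
  · exact ((contDiff_apply ℝ ℝ I).comp contDiff_snd).contDiffOn

/-- Modulo degree `k + 1`, the equation `X G = f` is a linear transport system along the body field
for the coefficients of `G` of degree `k`; its zeroth-order terms come from the derivatives of the
monomials `θ^I`. The other coefficients of `G` are set to zero. -/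
theorem exists_transport_inFil (hU : U ≤ c.domain) {x : M.carrier} (hx : x ∈ U)
    {X : M.EndFamily U} (hX : X ∈ M.vecParity U 0) {i : Fin p}
    (hXi : X ⟨U, le_rfl⟩ (c.coord hU (Sum.inl i)) = 1) {k : ℕ} {f : M.Sec U}
    (hf : c.InFil k f) : ∃ (V : Opens M.carrier) (h : V ≤ U) (G : M.Sec V), x ∈ V ∧
      c.VanishesOn i (c.φ x i) G ∧ c.InFil (k + 1) (M.res h f - X ⟨V, h⟩ G) := by
  have hXv := vecParity_le_vec _ hX
  obtain ⟨W', hW', hW'o, hxW', g, hg, hg0, hgd⟩ := exists_transport (c.img U).2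
    (c.mem_img (hU hx) hx) (c.contDiffOn_bodyField hU X) (c.contDiffOn_cf_sub_sum hU X f k)
    (ℓ := ContinuousLinearMap.proj i) (fun y hy => c.proj_bodyField hU hXi hy)
  have hN : (⟨W', hW'o⟩ : Opens (Fin p → ℝ)) ≤ c.img U := hW'
  let V := chartPreimage c.φ ⟨W', hW'o⟩
  have hV : V ≤ U := c.preimage_le_of_le_img hN
  have hVW : ∀ y ∈ c.img V, y ∈ W' := fun y hy => c.img_preimage_le _ hy
  let F : Finset (Fin q) → (Fin p → ℝ) → ℝ := fun K y => if K.card = k then g y K else 0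
  have hF : ∀ K, ContDiffOn ℝ ∞ (F K) (c.img V) := by
    intro K
    by_cases hK : K.card = k
    · simp only [F, if_pos hK]
      exact (contDiffOn_pi.1 hg K).mono hVW
    · simp only [F, if_neg hK]
      exact contDiffOn_const
  have hG := fun K {y} hy => c.cf_ofCf (hV.trans hU) F hF K (y := y) hy
  set G := c.ofCf (hV.trans hU) F hF with hGdef
  have hGfil : c.InFil k G := fun I hI y hy => by
    rw [hG I hy]
    exact if_neg (by omega)
  refine ⟨V, hV, G, ⟨hU hx, hxW'⟩, fun I y hy hi => ?_, fun K hK y hy => ?_⟩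
  · rw [hG I hy]
    simp only [F, hg0 y (hVW y hy) hi, Pi.zero_apply, ite_self]
  · have hXV := resVec_mem_vecParity hV hX
    rw [c.cf_sub _ _ _ hy, c.cf_res hV _ _ hy]
    change _ - c.cf (resVec hV X ⟨V, le_rfl⟩ G) K y = 0
    rcases Nat.lt_succ_iff_lt_or_eq.1 hK with hlt | heq
    · rw [hf K hlt y (c.img_mono hV hy), InFil.evenField c (hV.trans hU) hXV hGfil K hlt y hy,
        sub_zero]
    · rw [c.cf_evenField (hV.trans hU) hXV hGfil heq.le hy, c.bodyField_resVec hV hU hXv hy]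
      simp only [c.cf_field_thetaProd_resVec hV hU hXv _ _ hy]
      have h1 : fderiv ℝ (c.cf G K) y = fderiv ℝ (fun z => g z K) y :=
        c.fderiv_congr_img (U := V) (fun z hz => by rw [hG K hz]; exact if_pos heq) hy
      have hgy : DifferentiableAt ℝ g y :=
        (hg.contDiffAt (hW'o.mem_nhds (hVW y hy))).differentiableAt (by simp)
      have h2 : fderiv ℝ (fun z => g z K) y (c.bodyField hU X y) =
          (fderiv ℝ g y (c.bodyField hU X y)) K := by
        rw [fderiv_apply (hΦ := hgy)]
        rfl
      rw [h1, h2, hgd y (hVW y hy)]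
      simp only [hG _ hy, F]
      rw [sub_eq_zero, eq_comm, sub_add_eq_add_sub, sub_eq_iff_eq_add]
      congr 1
      refine Finset.sum_congr rfl fun I _ => ?_
      split_ifs <;> simp

/-- Successive approximation: each step solves the equation in the lowest remaining degree, on a
smaller neighbourhood, and after degree `q` nothing remains. Sums of solutions keep the zero data on
the hyperplane. -/
theorem exists_transport_section (hU : U ≤ c.domain) {x : M.carrier} (hx : x ∈ U)
    {X : M.EndFamily U} (hX : X ∈ M.vecParity U 0) {i : Fin p}
    (hXi : X ⟨U, le_rfl⟩ (c.coord hU (Sum.inl i)) = 1) (f : M.Sec U) :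
    ∃ (V : Opens M.carrier) (h : V ≤ U) (G : M.Sec V), x ∈ V ∧
      c.VanishesOn i (c.φ x i) G ∧ X ⟨V, h⟩ G = M.res h f := by
  suffices H : ∀ m k, q + 1 ≤ k + m → ∀ (V : Opens M.carrier) (hV : V ≤ U), x ∈ V →
      ∀ f : M.Sec V, c.InFil k f → ∃ (V' : Opens M.carrier) (h : V' ≤ V) (G : M.Sec V'), x ∈ V' ∧
      c.VanishesOn i (c.φ x i) G ∧ X ⟨V', h.trans hV⟩ G = M.res h f from
    H (q + 1) 0 (by omega) U le_rfl hx f (c.inFil_zero f)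
  intro m
  induction m with
  | zero =>
    intro k hk V hV hxV f hf
    refine ⟨V, le_rfl, 0, hxV, c.vanishesOn_zero _ _, ?_⟩
    rw [hf.eq_zero (hV.trans hU) (by omega), map_zero, map_zero]
  | succ m ih =>
    intro k hk V hV hxV f hf
    have hXV : resVec hV X ⟨V, le_rfl⟩ (c.coord (hV.trans hU) (Sum.inl i)) = 1 := by
      rw [resVec_apply, ← c.res_coord hV hU, ← vec_res (vecParity_le_vec _ hX) ⟨U, le_rfl⟩ ⟨V, hV⟩ hV,
        hXi, map_one]
    obtain ⟨V₁, h₁, G₁, hx₁, hG₁, hr⟩ := c.exists_transport_inFil (hV.trans hU) hxV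
      (resVec_mem_vecParity hV hX) hXV hf
    obtain ⟨V₂, h₂, G₂, hx₂, hG₂, hXG⟩ := ih (k + 1) (by omega) V₁ (h₁.trans hV) hx₁ _ hr
    refine ⟨V₂, h₂.trans h₁, M.res h₂ G₁ + G₂, hx₂, (hG₁.res h₂).add hG₂, ?_⟩
    rw [map_add, hXG, map_sub, res_res, ← vec_res (vecParity_le_vec _ hX) ⟨V₁, h₁.trans hV⟩
      ⟨V₂, (h₂.trans h₁).trans hV⟩ h₂, add_comm]
    exact sub_add_cancel _ _

/-- The coefficients of degree `k` solve a homogeneous linear transport system with zero data, so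
they vanish near the base point. -/
theorem exists_inFil_succ_of_field_eq_zero (hU : U ≤ c.domain) {x : M.carrier} (hx : x ∈ U)
    {X : M.EndFamily U} (hX : X ∈ M.vecParity U 0) {i : Fin p}
    (hXi : X ⟨U, le_rfl⟩ (c.coord hU (Sum.inl i)) = 1) {k : ℕ} {f : M.Sec U}
    (hf : c.InFil k f) (hf0 : c.VanishesOn i (c.φ x i) f) (hXf : X ⟨U, le_rfl⟩ f = 0) :
    ∃ (V : Opens M.carrier) (h : V ≤ U), x ∈ V ∧ c.InFil (k + 1) (M.res h f) := by
  let g : (Fin p → ℝ) → Finset (Fin q) → ℝ := fun y K => if K.card = k then c.cf f K y else 0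
  -- Both `g` and `w` are set to zero in degrees other than `k`, so that they fit into one system
  -- over all index sets.
  let w : (Fin p → ℝ) × (Finset (Fin q) → ℝ) → Finset (Fin q) → ℝ := fun z K =>
    if K.card = k then c.cf (0 : M.Sec U) K z.1 - ∑ I, (if I.card = k then
        c.cf (X ⟨U, le_rfl⟩ (c.thetaProd hU I.sort)) K z.1 else 0) * z.2 I else 0
  have hw : ContDiffOn ℝ ∞ w ((c.img U : Set (Fin p → ℝ)) ×ˢ Set.univ) := by
    refine contDiffOn_pi.2 fun K => ?_
    by_cases hK : K.card = k
    · simp only [w, if_pos hK]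
      exact contDiffOn_pi.1 (c.contDiffOn_cf_sub_sum hU X 0 k) K
    · simp only [w, if_neg hK]
      exact contDiffOn_const
  have hgK : ∀ K, ∀ y ∈ c.img U, DifferentiableAt ℝ (fun y => g y K) y := by
    intro K y hy
    by_cases hK : K.card = k
    · simp only [g, if_pos hK]
      exact c.differentiableAt_cf f K hy
    · simp only [g, if_neg hK]
      exact differentiableAt_const _
  have hg : ∀ y ∈ c.img U, DifferentiableAt ℝ g y := fun y hy =>
    differentiableAt_pi.2 fun K => hgK K y hy
  have hev := transport_unique (c.img U).2 (c.mem_img (hU hx) hx) (c.contDiffOn_bodyField hU X) hw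
    (ℓ := ContinuousLinearMap.proj i) (fun y hy => c.proj_bodyField hU hXi hy)
    (fun y => by funext K; simp [w, c.cf_zero])
    (g := g) (fun y hy => (hg y hy).differentiableWithinAt)
    (fun y hy hi => by
      funext K
      simp only [g, hf0 K y hy hi, ite_self, Pi.zero_apply])
    (fun y hy => by
      funext K
      have h2 : (fderiv ℝ g y (c.bodyField hU X y)) K =
          fderiv ℝ (fun z => g z K) y (c.bodyField hU X y) := by
        rw [fderiv_apply (hΦ := hg y hy)]
        rfl
      rw [h2]
      by_cases hK : K.card = k
      · have h3 := c.cf_evenField hU hX hf hK.le hy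
        rw [hXf, c.cf_zero] at h3
        simp only [g, w, if_pos hK, c.cf_zero]
        rw [zero_sub, eq_neg_iff_add_eq_zero]
        refine Eq.trans ?_ h3.symm
        congr 1
        refine Finset.sum_congr rfl fun I _ => ?_
        split_ifs with hI
        · rfl
        -- Degrees below `k` are absent from `f`, and an even field does not lower the degree of a
        -- monomial of degree above `k`; only degree `k` couples to degree `k`.
        · have h4 : c.cf (X ⟨U, le_rfl⟩ (c.thetaProd hU I.sort)) K y * c.cf f I y = 0 := by
            rcases lt_or_gt_of_ne hI with hlt | hgt
            · rw [hf I hlt y hy, mul_zero]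
            · have h := c.inFil_evenField_thetaProd hU hX I.sort K
                (by rw [Finset.length_sort]; omega) y hy
              rw [h, zero_mul]
          rw [h4, zero_mul]
      · simp only [g, w, if_neg hK]
        simp)
  obtain ⟨N, hN, hNo, hxN⟩ := eventually_nhds_iff.1 hev
  let N' : Opens (Fin p → ℝ) := ⟨N ∩ c.img U, hNo.inter (c.img U).2⟩
  have hN'U : N' ≤ c.img U := fun y hy => hy.2
  refine ⟨chartPreimage c.φ N', c.preimage_le_of_le_img hN'U, ⟨hU hx, hxN, c.mem_img (hU hx) hx⟩,
    fun K hK y hy => ?_⟩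
  have hyN := c.img_preimage_le N' hy
  rw [c.cf_res _ _ _ hy]
  rcases Nat.lt_succ_iff_lt_or_eq.1 hK with hlt | heq
  · exact hf K hlt y hyN.2
  · have := congrFun (hN y hyN.1) K
    simpa only [g, if_pos heq, Pi.zero_apply] using this

/-- The filtration degree is raised step by step, each time on a smaller neighbourhood, until it
exceeds `q`. -/
theorem eq_zero_of_field_eq_zero (hU : U ≤ c.domain) {x : M.carrier} (hx : x ∈ U)
    {X : M.EndFamily U} (hX : X ∈ M.vecParity U 0) {i : Fin p}
    (hXi : X ⟨U, le_rfl⟩ (c.coord hU (Sum.inl i)) = 1) {f : M.Sec U}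
    (hf0 : c.VanishesOn i (c.φ x i) f) (hXf : X ⟨U, le_rfl⟩ f = 0) :
    ∃ (V : Opens M.carrier) (h : V ≤ U), x ∈ V ∧ M.res h f = 0 := by
  suffices H : ∀ k, ∃ (V : Opens M.carrier) (h : V ≤ U), x ∈ V ∧ c.InFil k (M.res h f) by
    obtain ⟨V, h, hxV, hV⟩ := H (q + 1)
    exact ⟨V, h, hxV, hV.eq_zero (h.trans hU) (by omega)⟩
  intro k
  induction k with
  | zero => exact ⟨U, le_rfl, hx, c.inFil_zero _⟩
  | succ k ih =>
    obtain ⟨V, h, hxV, hV⟩ := ih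
    have hv := fun g => vec_res (vecParity_le_vec _ hX) ⟨U, le_rfl⟩ ⟨V, h⟩ h g
    obtain ⟨V', h', hxV', hV'⟩ := c.exists_inFil_succ_of_field_eq_zero (h.trans hU) hxV
      (resVec_mem_vecParity h hX) (i := i)
      (by rw [resVec_apply, ← c.res_coord h hU, ← hv, hXi, map_one]) hV (hf0.res h)
      (by rw [resVec_apply, ← hv, hXf, map_zero])
    rw [res_res] at hV'
    exact ⟨V', h'.trans h, hxV', hV'⟩

end Chart

end SuperRingedSpace

/-! ### First integrals of a supercommuting frame -/

namespace SuperRingedSpace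

namespace Chart

variable {M : SuperRingedSpace.{u}} {p q : ℕ} (c : M.Chart p q) {U V : Opens M.carrier}

theorem dAt_add (hU : U ≤ c.domain) {x : M.carrier} (hx : x ∈ U) (f g : M.Sec U)
    (a : Fin p ⊕ Fin q) : c.dAt x (f + g) a = c.dAt x f a + c.dAt x g a := by
  have h := fun k => c.cf_coordField_empty ⟨U, hU⟩ hx k a
  rw [← h, ← h, ← h, map_add, c.cf_add _ _ _ (c.mem_img (hU hx) hx)]

theorem dAt_sub (hU : U ≤ c.domain) {x : M.carrier} (hx : x ∈ U) (f g : M.Sec U)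
    (a : Fin p ⊕ Fin q) : c.dAt x (f - g) a = c.dAt x f a - c.dAt x g a := by
  have := c.dAt_add hU hx (f - g) g a
  rw [sub_add_cancel] at this
  linarith

theorem dAt_eq_zero_of_parity (hU : U ≤ c.domain) {x : M.carrier} (hx : x ∈ U) {d : ZMod 2}
    {f : M.Sec U} (hf : f ∈ M.parity U d) {a : Fin p ⊕ Fin q} (ha : coordParity a ≠ d) :
    c.dAt x f a = 0 := by
  rw [← c.cf_coordField_empty ⟨U, hU⟩ hx]
  refine c.cf_eq_zero_of_mem_parity hU
    ((c.coordField_mem a).2.1 ⟨U, hU⟩ d f hf) ?_ (c.mem_img (hU hx) hx)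
  have : ∀ e d : ZMod 2, e ≠ d → (0 : ZMod 2) ≠ e + d := by decide
  simpa using this _ _ ha

theorem dAt_theta_mul (hU : U ≤ c.domain) {x : M.carrier} (hx : x ∈ U) (j : Fin q) (f : M.Sec U)
    {a : Fin p ⊕ Fin q} (ha : a ≠ Sum.inr j) :
    c.dAt x (c.coord hU (Sum.inr j) * f) a = 0 := by
  have hxi := c.mem_img (hU hx) hx
  change c.dAt x (c.thetaProd hU [j] * f) a = 0
  rcases a with k | l
  · change fderiv ℝ (c.cf (c.thetaProd hU [j] * f) ∅) (c.φ x) (Pi.single k 1) = 0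
    rw [c.fderiv_congr_img (U := U) (G := fun _ => (0 : ℝ))
      (fun y hy => by rw [c.cf_theta_mul hU _ _ _ hy, if_neg (by simp)]) hxi]
    simp
  · change c.cf (c.thetaProd hU [j] * f) {l} (c.φ x) = 0
    rw [c.cf_theta_mul hU _ _ _ hxi, if_neg]
    rw [Finset.mem_singleton]
    rintro rfl
    exact ha rfl

end Chart

/-- A supercommuting family of homogeneous fields dual to the first coordinates of a chart. -/
structure Chart.IsDualFrame {M : SuperRingedSpace.{u}} {p q r s : ℕ} (c : M.Chart p q)
    (hrp : r ≤ p) (hsq : s ≤ q) {U : Opens M.carrier} (hU : U ≤ c.domain)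
    (X : Fin r ⊕ Fin s → M.EndFamily U) : Prop where
  parity : ∀ a, X a ∈ M.vecParity U (coordParity a)
  apply_coord : ∀ a b, X a ⟨U, le_rfl⟩ (c.coord hU (coordEmb hrp hsq b)) = if a = b then 1 else 0
  bracket_eq_zero : ∀ a b, bracket (coordParity a) (coordParity b) (X a) (X b) = 0

namespace Chart

variable {M : SuperRingedSpace.{u}} {p q r s : ℕ} {c : M.Chart p q} {hrp : r ≤ p} {hsq : s ≤ q}
  {U V : Opens M.carrier} {hU : U ≤ c.domain} {X : Fin r ⊕ Fin s → M.EndFamily U}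

theorem IsDualFrame.res_apply (hX : c.IsDualFrame hrp hsq hU X) (a : Fin r ⊕ Fin s)
    {V V' : Opens M.carrier} (hV : V ≤ U) (h : V' ≤ V) (f : M.Sec V) :
    M.res h (X a ⟨V, hV⟩ f) = X a ⟨V', h.trans hV⟩ (M.res h f) :=
  vec_res (vecParity_le_vec _ (hX.parity a)) ⟨V, hV⟩ ⟨V', h.trans hV⟩ h f

theorem IsDualFrame.comm (hX : c.IsDualFrame hrp hsq hU X) (a b : Fin r ⊕ Fin s) (hV : V ≤ U)
    (f : M.Sec V) : X a ⟨V, hV⟩ (X b ⟨V, hV⟩ f) =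
      superSign (coordParity a) (coordParity b) • X b ⟨V, hV⟩ (X a ⟨V, hV⟩ f) := by
  have h := congrArg (fun Y : M.EndFamily U => Y ⟨V, hV⟩ f) (hX.bracket_eq_zero a b)
  exact sub_eq_zero.1 h

theorem IsDualFrame.restrict (hX : c.IsDualFrame hrp hsq hU X) (hV : V ≤ U) :
    c.IsDualFrame hrp hsq (hV.trans hU) fun a => resVec hV (X a) where
  parity a := resVec_mem_vecParity hV (hX.parity a)
  apply_coord a b := by
    rw [resVec_apply, ← c.res_coord hV hU, ← hX.res_apply a le_rfl hV, hX.apply_coord,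
      apply_ite (M.res hV), map_one, map_zero]
  bracket_eq_zero a b := congrArg (resVec hV) (hX.bracket_eq_zero a b)

/-- Any function can be corrected, without changing its differential transversally to the frame, to
one which is annihilated by given even fields of the frame. -/
theorem IsDualFrame.exists_evenInvariant (hX : c.IsDualFrame hrp hsq hU X) {x : M.carrier}
    (hx : x ∈ U) (S : Finset (Fin r)) (f : M.Sec U) :
    ∃ (V : Opens M.carrier) (hV : V ≤ U) (G : M.Sec V), x ∈ V ∧
      (∀ i ∈ S, X (Sum.inl i) ⟨V, hV⟩ G = 0) ∧
      ∀ b ∉ Set.range (coordEmb hrp hsq), c.dAt x G b = c.dAt x f b := by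
  classical
  induction S using Finset.induction_on with
  | empty => exact ⟨U, le_rfl, f, hx, by simp, fun _ _ => rfl⟩
  | insert i S hi ih =>
    obtain ⟨V, hV, G, hxV, hG, hd⟩ := ih
    have hVc := hV.trans hU
    have hXV := hX.restrict hV
    -- `H` cancels the derivative of `G` along the new field and has zero data on the hyperplane
    -- `t^i = t^i(x)`.
    obtain ⟨V₁, h₁, H, hx₁, hH, hXH⟩ := c.exists_transport_section hVc hxV
      (hXV.parity (Sum.inl i)) (i := Fin.castLE hrp i)
      ((hXV.apply_coord (Sum.inl i) (Sum.inl i)).trans (if_pos rfl)) (-(X (Sum.inl i) ⟨V, hV⟩ G))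
    have hV₁ := h₁.trans hV
    have hXH' : X (Sum.inl i) ⟨V₁, hV₁⟩ H = -X (Sum.inl i) ⟨V₁, hV₁⟩ (M.res h₁ G) := by
      refine hXH.trans ?_
      rw [map_neg, hX.res_apply _ hV h₁]
    have hXV₁ := hX.restrict hV₁
    -- The correction must not destroy the invariance already achieved. For `j ∈ S` the fields
    -- commute, so `X_i` annihilates `X_j H`; this function vanishes on the hyperplane because `X_j`
    -- is tangent to it, and hence is zero near `x`.
    have hkill : ∀ j : Fin r, ∃ V₂ : Opens M.carrier, x ∈ V₂ ∧ ∃ h₂ : V₂ ≤ V₁,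
        j ∈ S → X (Sum.inl j) ⟨V₂, h₂.trans hV₁⟩ (M.res h₂ H) = 0 := by
      intro j
      by_cases hj : j ∈ S
      · have hji : j ≠ i := fun h => hi (h ▸ hj)
        obtain ⟨V₂, h₂, hx₂, h0⟩ := c.eq_zero_of_field_eq_zero (hV₁.trans hU) hx₁
          (hXV₁.parity (Sum.inl i)) (i := Fin.castLE hrp i)
          ((hXV₁.apply_coord (Sum.inl i) (Sum.inl i)).trans (if_pos rfl))
          (f := X (Sum.inl j) ⟨V₁, hV₁⟩ H)
          (hH.field (hV₁.trans hU) (vecParity_le_vec _ (hXV₁.parity (Sum.inl j)))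
            ((hXV₁.apply_coord (Sum.inl j) (Sum.inl i)).trans (if_neg (by simpa using hji))))
          (by
            change X (Sum.inl i) ⟨V₁, hV₁⟩ (X (Sum.inl j) ⟨V₁, hV₁⟩ H) = 0
            rw [hX.comm, hXH', map_neg, hX.comm, ← hX.res_apply (Sum.inl j) hV h₁, hG j hj]
            simp)
        exact ⟨V₂, hx₂, h₂, fun _ => by rw [← hX.res_apply _ hV₁ h₂]; exact h0⟩
      · exact ⟨V₁, hx₁, le_rfl, fun h => absurd h hj⟩
    choose V₂ hx₂ h₂ hk₂ using hkill
    obtain ⟨V₃, hx₃, h₃⟩ := exists_common_open (x := x) V₂ hx₂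
    let V₄ := V₃ ⊓ V₁
    have h₄ : V₄ ≤ V₁ := inf_le_right
    have hx₄ : x ∈ V₄ := ⟨hx₃, hx₁⟩
    refine ⟨V₄, h₄.trans hV₁, M.res (h₄.trans h₁) G + M.res h₄ H, hx₄, fun j hj => ?_,
      fun b hb => ?_⟩
    · rw [map_add]
      rcases Finset.mem_insert.1 hj with rfl | hj
      · rw [← res_res h₁ h₄, ← hX.res_apply _ hV₁ h₄, ← hX.res_apply _ hV₁ h₄, hXH', map_neg,
          add_neg_cancel]
      · have h42 : V₄ ≤ V₂ j := inf_le_left.trans (h₃ j)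
        rw [← hX.res_apply _ hV (h₄.trans h₁), hG j hj, ← res_res (h₂ j) h42,
          ← hX.res_apply _ ((h₂ j).trans hV₁) h42, hk₂ j hj, map_zero, map_zero, add_zero]
    -- At `x` the differential of `H` has only a `t^i` component, which belongs to the directions of
    -- the frame.
    · rw [c.dAt_add (h₄.trans (hV₁.trans hU)) hx₄, c.dAt_res _ (hU hx) hx₄,
        c.dAt_res _ (hU hx) hx₄, hd b hb,
        c.dAt_eq_zero_of_vanishesOn (hU hx) hx₁ hH (fun h => hb ⟨Sum.inl i, h.symm⟩), add_zero]

/-- Any function can be corrected, without changing its differential transversally to the frame, to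
one which is annihilated by the frame. -/
theorem IsDualFrame.exists_invariant (hX : c.IsDualFrame hrp hsq hU X) {x : M.carrier}
    (hx : x ∈ U) (f : M.Sec U) :
    ∃ (V : Opens M.carrier) (hV : V ≤ U) (G : M.Sec V), x ∈ V ∧ (∀ a, X a ⟨V, hV⟩ G = 0) ∧
      ∀ b ∉ Set.range (coordEmb hrp hsq), c.dAt x G b = c.dAt x f b := by
  classical
  obtain ⟨V, hV, G₀, hxV, hG₀, hd₀⟩ := hX.exists_evenInvariant hx Finset.univ f
  have hVc := hV.trans hU
  suffices H : ∀ S : Finset (Fin s), ∃ G : M.Sec V, (∀ i, X (Sum.inl i) ⟨V, hV⟩ G = 0) ∧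
      (∀ j ∈ S, X (Sum.inr j) ⟨V, hV⟩ G = 0) ∧
      ∀ b ∉ Set.range (coordEmb hrp hsq), c.dAt x G b = c.dAt x f b by
    obtain ⟨G, h1, h2, h3⟩ := H Finset.univ
    refine ⟨V, hV, G, hxV, ?_, h3⟩
    rintro (i | j)
    exacts [h1 i, h2 j (Finset.mem_univ j)]
  intro S
  induction S using Finset.induction_on with
  | empty => exact ⟨G₀, fun i => hG₀ i (Finset.mem_univ i), by simp, hd₀⟩
  | insert j S hj ih =>
    obtain ⟨G, h1, h2, h3⟩ := ih
    have hXV := hX.restrict hV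
    let e : Fin p ⊕ Fin q := coordEmb hrp hsq (Sum.inr j)
    have he : e = Sum.inr (Fin.castLE hsq j) := rfl
    have hcoord : ∀ a, X a ⟨V, hV⟩ (c.coord hVc e) = if a = Sum.inr j then 1 else 0 := fun a =>
      hXV.apply_coord a (Sum.inr j)
    have hodd : c.coord hVc e ∈ M.parity V 1 := c.coord_mem_parity hVc (Sum.inr _)
    -- An odd field that supercommutes with itself has square zero.
    have hsq0 : X (Sum.inr j) ⟨V, hV⟩ (X (Sum.inr j) ⟨V, hV⟩ G) = 0 := by
      have h := hX.comm (Sum.inr j) (Sum.inr j) hV G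
      have h' : superSign (coordParity (Sum.inr j : Fin r ⊕ Fin s))
        (coordParity (Sum.inr j : Fin r ⊕ Fin s)) = -1 := superSign_one_one
      rw [h', neg_one_smul] at h
      have h2 : (2 : ℝ) • X (Sum.inr j) ⟨V, hV⟩ (X (Sum.inr j) ⟨V, hV⟩ G) = 0 := by
        rw [two_smul]
        nth_rewrite 1 [h]
        exact neg_add_cancel _
      exact (smul_eq_zero.1 h2).resolve_left two_ne_zero
    -- No equation has to be solved. The derivative along `X_j` disappears because `X_j θ^j = 1` and
    -- `X_j` has square zero; the even fields and the odd ones already treated annihilate `θ^j` and,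
    -- by supercommutation, `X_j G`.
    refine ⟨G - c.coord hVc e * X (Sum.inr j) ⟨V, hV⟩ G, fun i => ?_, fun k hk => ?_,
      fun b hb => ?_⟩
    · rw [map_sub, evenField_mul (hX.parity (Sum.inl i)), h1, hcoord, if_neg (by simp), hX.comm, h1]
      simp
    · rw [map_sub, oddField_odd_mul (hX.parity (Sum.inr k)) ⟨V, hV⟩ hodd, hcoord]
      rcases Finset.mem_insert.1 hk with rfl | hk
      · rw [if_pos rfl, hsq0]
        simp
      · have hkj : k ≠ j := fun h => hj (h ▸ hk)
        rw [if_neg (by simpa using hkj), h2 k hk, hX.comm, h2 k hk]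
        simp
    · rw [c.dAt_sub hVc hxV, h3 b hb, he, c.dAt_theta_mul hVc hxV _ _
        (fun h => hb ⟨Sum.inr j, h.symm⟩), sub_zero]

/-- A homogeneous version of `exists_invariant`. -/
theorem IsDualFrame.exists_homogeneousInvariant (hX : c.IsDualFrame hrp hsq hU X) {x : M.carrier}
    (hx : x ∈ U) {d : ZMod 2} {f : M.Sec U} (hf : f ∈ M.parity U d) :
    ∃ (V : Opens M.carrier) (hV : V ≤ U), x ∈ V ∧ ∃ G ∈ M.parity V d,
      (∀ a, X a ⟨V, hV⟩ G = 0) ∧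
      ∀ b ∉ Set.range (coordEmb hrp hsq), c.dAt x G b = c.dAt x f b := by
  obtain ⟨V, hV, G, hxV, hG, hd⟩ := hX.exists_invariant hx f
  have hVc := hV.trans hU
  obtain ⟨G₁, hG₁, G₂, hG₂, rfl⟩ : ∃ G₁ ∈ M.parity V d, ∃ G₂ ∈ M.parity V (d + 1),
      G = G₁ + G₂ := by
    obtain ⟨G₀, h₀, G₁, h₁, rfl⟩ := exists_parity_add G
    have hc : ∀ e : ZMod 2, e = 0 ∨ e = 1 := by decide
    rcases hc d with rfl | rfl
    · exact ⟨G₀, h₀, G₁, h₁, rfl⟩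
    · exact ⟨G₁, h₁, G₀, h₀, add_comm _ _⟩
  -- The images of the two homogeneous parts under `X a` have different parities, so they vanish
  -- separately. The discarded part does not enter the derivatives of parity `d`, and the other
  -- derivatives vanish for both `G₁` and `f`.
  refine ⟨V, hV, hxV, G₁, hG₁, fun a => ?_, fun b hb => ?_⟩
  · have h := hG a
    rw [map_add] at h
    have h1 := (hX.parity a).2.1 ⟨V, hV⟩ d G₁ hG₁
    have h2 := (hX.parity a).2.1 ⟨V, hV⟩ (d + 1) G₂ hG₂
    rw [← add_assoc] at h2
    have h3 : X a ⟨V, hV⟩ G₂ = 0 := eq_zero_of_parity_add h1 h2 (by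
      rw [h]; exact Submodule.zero_mem _)
    rwa [h3, add_zero] at h
  · have h := hd b hb
    by_cases hbd : coordParity b = d
    · rwa [c.dAt_add hVc hxV, c.dAt_eq_zero_of_parity hVc hxV hG₂ (by rw [hbd]; simp),
        add_zero] at h
    · rw [c.dAt_eq_zero_of_parity hVc hxV hG₁ hbd, c.dAt_eq_zero_of_parity hU hx hf hbd]

/-- A supercommuting dual frame consists of coordinate fields in a suitable chart. -/
theorem IsDualFrame.exists_chart (hX : c.IsDualFrame hrp hsq hU X) {x : M.carrier} (hx : x ∈ U) :
    ∃ (c' : M.Chart p q) (h' : c'.domain ≤ U), x ∈ c'.domain ∧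
      ∀ a, resVec h' (X a) = c'.coordField (coordEmb hrp hsq a) := by
  classical
  let emb := coordEmb hrp hsq
  -- The first `r|s` coordinates are kept, and each of the others is replaced by an invariant with
  -- the same transversal differential.
  have hw : ∀ b, ∃ (V : Opens M.carrier), x ∈ V ∧ ∃ (hV : V ≤ U), ∃ G ∈ M.parity V (coordParity b),
      (∀ a, X a ⟨V, hV⟩ G = if emb a = b then 1 else 0) ∧
      (b ∈ Set.range emb → ∀ e, c.dAt x G e = if e = b then 1 else 0) ∧
      ∀ e ∉ Set.range emb, c.dAt x G e = if e = b then 1 else 0 := by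
    intro b
    have hcp := c.coord_mem_parity hU b
    have hcd := fun e => c.dAt_coord hU hx e b
    by_cases hb : b ∈ Set.range emb
    · refine ⟨U, hx, le_rfl, c.coord hU b, hcp, fun a => ?_, fun _ e => hcd e, fun e _ => hcd e⟩
      obtain ⟨a', rfl⟩ := hb
      rw [hX.apply_coord]
      simp only [EmbeddingLike.apply_eq_iff_eq]
    · obtain ⟨V, hV, hxV, G, hGp, hG0, hGd⟩ := hX.exists_homogeneousInvariant hx hcp
      refine ⟨V, hxV, hV, G, hGp, fun a => ?_, fun h => absurd h hb, fun e he => ?_⟩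
      · rw [hG0, if_neg fun h => hb ⟨a, h⟩]
      · rw [hGd e he, hcd]
  choose V hxV hV G hGp hGX hGd hGd' using hw
  obtain ⟨V₁, hx₁, h₁⟩ := exists_common_open (x := x)
    (Sum.elim V (fun _ : Unit => U)) (by rintro (b | _); exacts [hxV b, hx])
  have hV₁ : ∀ b, V₁ ≤ V b := fun b => h₁ (Sum.inl b)
  have hU₁ : V₁ ≤ U := h₁ (Sum.inr ())
  -- The Jacobian at `x` is block triangular with identity blocks on the diagonal: a vector in its
  -- kernel vanishes first in the frame directions and then in the others.
  have hdet : (Matrix.of fun a b => c.dAt x (M.res (hV₁ a) (G a)) b).det ≠ 0 := by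
    intro h0
    obtain ⟨v, hv, hmul⟩ := Matrix.exists_mulVec_eq_zero_iff.2 h0
    have hrow : ∀ b, ∑ e, c.dAt x (G b) e * v e = 0 := by
      intro b
      have := congrFun hmul b
      simp only [Matrix.mulVec, dotProduct, Matrix.of_apply, Pi.zero_apply,
        c.dAt_res (hV₁ _) (hU hx) hx₁] at this
      exact this
    have hr1 : ∀ b ∈ Set.range emb, v b = 0 := by
      intro b hb
      have := hrow b
      simpa only [hGd b hb, ite_mul, one_mul, zero_mul, Finset.sum_ite_eq', Finset.mem_univ,
        if_true] using this
    refine hv (funext fun b => ?_)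
    by_cases hb : b ∈ Set.range emb
    · exact hr1 b hb
    · have := hrow b
      rw [Finset.sum_eq_single b] at this
      · rwa [hGd' b b hb, if_pos rfl, one_mul] at this
      · intro e _ he
        by_cases her : e ∈ Set.range emb
        · rw [hr1 e her, mul_zero]
        · rw [hGd' b e her, if_neg he, zero_mul]
      · simp
  obtain ⟨c', h', hx', hc'⟩ := c.exists_chart_of_dAt (hU₁.trans hU) hx₁
    (w := fun b => M.res (hV₁ b) (G b)) (fun b => res_mem_parity _ (hGp b)) hdet
  refine ⟨c', h'.trans hU₁, hx', fun a => ?_⟩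
  -- Both fields have the values `δ` on the coordinates of `c'`, and these values determine a field.
  refine c'.vec_ext le_rfl (resVec_mem_vec _ (vecParity_le_vec _ (hX.parity a)))
    (vecParity_le_vec _ (c'.coordField_mem _)) fun b => ?_
  rw [c'.coordField_coord, hc', resVec_apply, res_res, ← hX.res_apply a (hV b) (h'.trans (hV₁ b)),
    hGX, apply_ite (M.res _), map_one, map_zero]

end Chart

end SuperRingedSpace

/-! ### The local Frobenius theorem -/

open SuperRingedSpace in
theorem mainTheorem1 {p q r s : ℕ} (M : SuperRingedSpace.{u}) (hM : M.IsSupermanifold p q)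
    (D : M.Distribution) (hint : D.IsIntegrable) (hrank : D.HasRank r s) (x : M.carrier) :
    ∃ (hr : r ≤ p) (hs : s ≤ q) (c : M.Chart p q)
      (dt : Fin p → M.EndFamily c.domain) (dθ : Fin q → M.EndFamily c.domain),
      x ∈ c.domain ∧
      (∀ i, c.IsPartialT i (dt i)) ∧
      (∀ j, c.IsPartialTheta j (dθ j)) ∧
      ∀ (W : Opens M.carrier) (hW : W ≤ c.domain) (X : M.EndFamily W),
        X ∈ D.sec W ↔
          ∃ (a : Fin r → M.Sec W) (b : Fin s → M.Sec W),
            X = ∑ i, funMul (a i) (resVec hW (dt (Fin.castLE hr i))) +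
                ∑ j, funMul (b j) (resVec hW (dθ (Fin.castLE hs j))) := by
  obtain ⟨c₀, hx₀⟩ := hM.exists_chart x
  obtain ⟨hr, hs, c₁, U, hU, X, hxU, hXD, hXp, hXδ, hXspan, hXbr⟩ :=
    c₀.exists_frame hint hx₀ (hrank x).1 (hrank x).2
  obtain ⟨c, hc, hx, hXc⟩ := Chart.IsDualFrame.exists_chart ⟨hXp, hXδ, hXbr⟩ hxU
  refine ⟨hr, hs, c, c.partialT, c.partialTheta, hx, c.isPartialT_partialT,
    c.isPartialTheta_partialTheta, fun W hW Y => ⟨fun hY => ?_, ?_⟩⟩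
  · obtain ⟨g, rfl⟩ := hXspan W (hW.trans hc) Y hY
    refine ⟨fun i => g (Sum.inl i), fun j => g (Sum.inr j), ?_⟩
    rw [Fintype.sum_sum_type]
    simp only [← resVec_resVec hc hW, hXc]
    rfl
  · rintro ⟨a, b, rfl⟩
    have hmem : ∀ e, resVec hW (c.coordField (coordEmb hr hs e)) ∈ D.sec W := fun e => by
      rw [← hXc]
      exact D.isSubmoduleSheaf.res_mem _ le_top _ hW _
        (D.isSubmoduleSheaf.res_mem _ le_top _ hc _ (hXD e))
    exact Submodule.add_mem _ (D.funMul_sum_mem fun i _ => hmem (Sum.inl i))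
      (D.funMul_sum_mem fun j _ => hmem (Sum.inr j))
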